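/- Let $p$ be a prime, $w_1,\dots,w_n\in\mathbf Z^n$, $J=(w_1,\dots,w_n)$ with $(p,\det J)=1$, and $f=\sum_{i=1}^n x^{w_i}$ over $\mathbf F_p$. Let $M(f)=C(f)\cap\mathbf Z^n$, where $C(f)\subset\mathbf R^n$ is the convex cone generated by the $w_i$. Write $u\in M(f)$ uniquely as $u=\sum_i r_iw_i$ with $r_i\in\mathbf R$, and set $w(u)=\sum_i r_i$, $S(\Delta)=\{u\in M(f): 0\le r_i<1\text{ for all }i\}$ and, for $u\in S(\Delta)$, $p.u=\sum_i\{pr_i\}w_i$, where $\{\cdot\}$ is the fractional part. Let $\Omega$ be the completion of an algebraic closure of $\mathbf Q_p$, with $\mathrm{ord}$ normalized by $\mathrm{ord}(p)=1$ and $\mathrm{ord}(0)=+\infty$. Let $\gamma\in\Omega$ be a zero of $\sum_{i\ge0}t^{p^i}/p^i$ with $\mathrm{ord}\,\gamma=1/(p-1)$, let $M\ge1$ be an integer with $w(M(f))\subset\frac1M\mathbf Z$, let $\tilde\gamma\in\Omega$ satisfy $\tilde\gamma^M=\gamma$, and let $K=\mathbf Q_p(\tilde\gamma)$. Put $$B=\Big\{\sum_{u\in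 M(f)}A_u\tilde\gamma^{Mw(u)}x^u : A_u\in K,\ A_u\to0\text{ as }u\to\infty\Big\}.$$ Let $E(t)=\exp\big(\sum_{i\ge0}t^{p^i}/p^i\big)$, $\theta(t)=E(\gamma t)$, $F_0(x)=\prod_{i=1}^n\theta(x^{w_i})$, $\gamma_l=\sum_{i=0}^l\gamma^{p^i}/p^i$, $h(t)=\sum_{l\ge0}\gamma_lt^{p^l}$ and $H(x)=\sum_{j=1}^nh(x^{w_j})$. Let $\psi(\sum_u a_ux^u)=\sum_u a_{pu}x^u$, $\alpha=\psi\circ F_0$, $E_i=x_i\partial/\partial x_i$ and $\hat D_i=E_i+E_i(H)$ for $1\le i\le n$ (here $F_0$ and $E_i(H)$ act by multiplication). Then each $\hat D_i$ and $\alpha$ map $B$ into $B$; $\alpha$ induces a $K$-linear endomorphism of $B/\sum_{i=1}^n\hat D_iB$; and the classes of $x^u$, $u\in S(\Delta)$, form a $K$-basis of $B/\sum_{i=1}^n\hat D_iB$. If $\gamma(u,u')\in K$ is defined for $u,u'\in S(\Delta)$ by $$\alpha(x^u)\equiv\sum_{u'\in S(\Delta)}\gamma(u,u')x^{u'}\mod\sum_{i=1}^n\hat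 D_iB,$$ then for all $u,u'\in S(\Delta)$ $$\mathrm{ord}(\gamma(u,u'))=\begin{cases}+\infty&\text{if }p.u'\ne u,\ \text{i.e. }\gamma(u,u')=0,\\[2pt]\dfrac{p\,w(u')-w(u)}{p-1}&\text{if }p.u'=u.\end{cases}$$ -/

import Mathlib

open scoped PadicComplex

namespace DworkDiag

noncomputable section

/-- The additive valuation on `ℂ_[p]`, normalized by `ord p = 1`, with `ord 0 = ⊤`. -/
def ord (p : ℕ) [Fact p.Prime] (x : ℂ_[p]) : WithTop ℝ :=
  open Classical in if x = 0 then ⊤ else ((-Real.logb p ‖x‖ : ℝ) : WithTop ℝ)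

/-! ### The lattice cone, the weight and the fundamental domain -/

/-- An integral vector regarded as a real vector. -/
def toReal {n : ℕ} (u : Fin n → ℤ) : Fin n → ℝ := fun i => (u i : ℝ)

/-- The matrix `J` whose rows are the exponent vectors `w₁, …, wₙ`. -/
def expMatrix {n : ℕ} (w : Fin n → Fin n → ℤ) : Matrix (Fin n) (Fin n) ℤ := Matrix.of w

/-- `M(f) = C(f) ∩ ℤⁿ`, where `C(f)` is the convex cone in `ℝⁿ` generated by the `w_j`. -/
def latticeCone {n : ℕ} (w : Fin n → Fin n → ℤ) : Set (Fin n → ℤ) :=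
  {u | toReal u ∈ PointedCone.hull ℝ (Set.range fun j => toReal (w j))}

/-- The coordinates `(r₁, …, rₙ)` in `u = r₁ w₁ + ⋯ + rₙ wₙ` (see `sum_coord` and `coord_unique`). -/
def coord {n : ℕ} (w : Fin n → Fin n → ℤ) (u : Fin n → ℤ) : Fin n → ℝ :=
  Matrix.vecMul (toReal u) ((expMatrix w).map (Int.cast : ℤ → ℝ))⁻¹

theorem coord_vecMul {n : ℕ} (w : Fin n → Fin n → ℤ) (r : Fin n → ℝ) :
    Matrix.vecMul r ((expMatrix w).map (Int.cast : ℤ → ℝ)) = ∑ i, r i • toReal (w i) := by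
  ext j
  simp [Matrix.vecMul, dotProduct, expMatrix, toReal]

theorem isUnit_det {n : ℕ} (w : Fin n → Fin n → ℤ) (h : (expMatrix w).det ≠ 0) :
    IsUnit ((expMatrix w).map (Int.cast : ℤ → ℝ)).det := by
  have : ((expMatrix w).map (Int.cast : ℤ → ℝ)).det = ((expMatrix w).det : ℝ) :=
    ((Int.castRingHom ℝ).map_det (expMatrix w)).symm
  rw [this, isUnit_iff_ne_zero]
  exact_mod_cast h

theorem sum_coord {n : ℕ} (w : Fin n → Fin n → ℤ) (h : (expMatrix w).det ≠ 0)
    (u : Fin n → ℤ) : ∑ i, coord w u i • toReal (w i) = toReal u := by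
  rw [← coord_vecMul, coord, Matrix.vecMul_vecMul, Matrix.nonsing_inv_mul _ (isUnit_det w h),
    Matrix.vecMul_one]

theorem coord_unique {n : ℕ} (w : Fin n → Fin n → ℤ) (h : (expMatrix w).det ≠ 0)
    (u : Fin n → ℤ) (r : Fin n → ℝ) (hr : ∑ i, r i • toReal (w i) = toReal u) :
    r = coord w u := by
  rw [← coord_vecMul] at hr
  rw [coord, ← hr, Matrix.vecMul_vecMul, Matrix.mul_nonsing_inv _ (isUnit_det w h),
    Matrix.vecMul_one]

/-- The weight `w(u) = r₁ + ⋯ + rₙ`. -/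
def weight {n : ℕ} (w : Fin n → Fin n → ℤ) (u : Fin n → ℤ) : ℝ := ∑ i, coord w u i

/-- The fundamental domain `S(Δ)`: the `u ∈ M(f)` all of whose coordinates lie in `[0, 1)`. -/
def fundDomain {n : ℕ} (w : Fin n → Fin n → ℤ) : Set (Fin n → ℤ) :=
  {u | u ∈ latticeCone w ∧ ∀ i, 0 ≤ coord w u i ∧ coord w u i < 1}

/-- The `p`-action `p.u = {p r₁} w₁ + ⋯ + {p rₙ} wₙ`, as a vector of `ℝⁿ`. -/
def pAct (p : ℕ) {n : ℕ} (w : Fin n → Fin n → ℤ) (u : Fin n → ℤ) : Fin n → ℝ :=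
  ∑ i, Int.fract ((p : ℝ) * coord w u i) • toReal (w i)

/-! ### Formal Laurent series: `ξ : (Fin n → ℤ) → K` stands for `∑ ξ(u) x^u` -/

/-- Formal (two-sided) Laurent series in `n` variables. -/
abbrev Laurent (n : ℕ) (K : Type*) : Type _ := (Fin n → ℤ) → K

/-- The monomial `x^u`. -/
def mono {n : ℕ} (K : Type*) [Field K] (u : Fin n → ℤ) : Laurent n K := Pi.single u 1

/-- The Cauchy product. It is only applied to series supported in the lattice cone of linearly
independent vectors, where every coefficient is a finite sum. -/
def mul {n : ℕ} {K : Type*} [Field K] (a b : Laurent n K) : Laurent n K :=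
  fun v => ∑ᶠ t, a t * b (v - t)

/-- The series `g(x^v)` obtained by substituting a monomial in the one-variable power series `g`
(only used for `v ≠ 0`). -/
def evalMono {n : ℕ} {K : Type*} [Field K] (g : PowerSeries K) (v : Fin n → ℤ) : Laurent n K :=
  fun u => ∑ᶠ k ∈ {k : ℕ | k • v = u}, PowerSeries.coeff k g

/-- The operator `E_i = x_i ∂/∂x_i`. -/
def euler {n : ℕ} {K : Type*} [Field K] (i : Fin n) (ξ : Laurent n K) : Laurent n K :=
  fun u => (u i : K) * ξ u

/-- The operator `ψ(∑ a_u x^u) = ∑ a_{pu} x^u`. -/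
def psi (p : ℕ) {n : ℕ} {K : Type*} [Field K] (ξ : Laurent n K) : Laurent n K :=
  fun u => ξ (p • u)

/-! ### Dwork's series -/

/-- The Artin-Hasse exponential `E(t) = exp(∑ t^{p^i} / p^i)`. -/
def artinHasse (p : ℕ) : PowerSeries ℚ :=
  (PowerSeries.exp ℚ).subst
    (PowerSeries.mk fun m => open Classical in if ∃ i : ℕ, m = p ^ i then (1 / m : ℚ) else 0)

/-- The splitting function `θ(t) = E(γ t)`. -/
def theta (p : ℕ) {K : Type*} [Field K] [CharZero K] (γ : K) : PowerSeries K :=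
  PowerSeries.rescale γ (PowerSeries.map (algebraMap ℚ K) (artinHasse p))

/-- `γ_l = ∑_{i ≤ l} γ^{p^i} / p^i`. -/
def gammaSum (p : ℕ) {K : Type*} [Field K] (γ : K) (l : ℕ) : K :=
  ∑ i ∈ Finset.range (l + 1), γ ^ p ^ i / (p : K) ^ i

/-- `h(t) = ∑ γ_l t^{p^l}`. -/
def hSeries (p : ℕ) {K : Type*} [Field K] (γ : K) : PowerSeries K :=
  PowerSeries.mk fun m => ∑ᶠ l ∈ {l : ℕ | p ^ l = m}, gammaSum p γ l

/-- `H(x) = ∑_j h(x^{w_j})`. -/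
def bigH (p : ℕ) {n : ℕ} {K : Type*} [Field K] (w : Fin n → Fin n → ℤ) (γ : K) : Laurent n K :=
  ∑ j, evalMono (hSeries p γ) (w j)

/-- `F₀(x) = ∏_i θ(x^{w_i})`, expanded: if `θ(t) = ∑ c_k t^k`, the coefficient of `x^v` is the sum of
`c_{k₁} ⋯ c_{kₙ}` over all `k ∈ ℕⁿ` with `k₁ w₁ + ⋯ + kₙ wₙ = v` (at most one such `k` when the
`w_i` are linearly independent). -/
def bigF (p : ℕ) {n : ℕ} {K : Type*} [Field K] [CharZero K] (w : Fin n → Fin n → ℤ) (γ : K) :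
    Laurent n K :=
  fun v => ∑ᶠ k ∈ {k : Fin n → ℕ | ∑ i, k i • w i = v},
    ∏ i, PowerSeries.coeff (k i) (theta p γ)

/-- Dwork's operator `α = ψ ∘ F₀`. -/
def alpha (p : ℕ) {n : ℕ} {K : Type*} [Field K] [CharZero K] (w : Fin n → Fin n → ℤ) (γ : K)
    (ξ : Laurent n K) : Laurent n K :=
  psi p (mul (bigF p w γ) ξ)

/-- The operator `D̂_i = E_i + E_i(H)`. -/
def Dhat (p : ℕ) {n : ℕ} {K : Type*} [Field K] (w : Fin n → Fin n → ℤ) (γ : K)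
    (i : Fin n) (ξ : Laurent n K) : Laurent n K :=
  euler i ξ + mul (euler i (bigH p w γ)) ξ

/-! ### The Banach space `B` and the quotient -/

/-- The space `B` of series `∑_{u ∈ M(f)} A_u π^{M w(u)} x^u` with `A_u ∈ K`, `A_u → 0` as `u → ∞`.
Here `M w(u)` is a natural number for `u ∈ M(f)`, by the choice of `M`. -/
def spaceB {n : ℕ} {K : Type*} [NormedField K] (w : Fin n → Fin n → ℤ) (M : ℕ) (π : K) :
    Submodule K (Laurent n K) where
  carrier := {ξ | ∃ A : (Fin n → ℤ) → K, (∀ u, u ∉ latticeCone w → A u = 0) ∧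
    Filter.Tendsto A Filter.cofinite (nhds 0) ∧
    ∀ u, ξ u = A u * π ^ ⌊(M : ℝ) * weight w u⌋₊}
  zero_mem' := ⟨0, by simp, tendsto_const_nhds, by simp⟩
  add_mem' := by
    rintro a b ⟨A, hA, hA', ha⟩ ⟨C, hC, hC', hb⟩
    refine ⟨A + C, fun u hu => by simp [hA u hu, hC u hu], ?_, fun u => ?_⟩
    · have := hA'.add hC'
      rwa [add_zero] at this
    · simp [ha u, hb u, add_mul]
  smul_mem' := by
    rintro c a ⟨A, hA, hA', ha⟩
    refine ⟨fun u => c * A u, fun u hu => by simp [hA u hu], ?_, fun u => ?_⟩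
    · simpa using hA'.const_mul c
    · simp [ha u, mul_assoc]

/-- The subspace `∑_i D̂_i B` of `B` (each `D̂_i` maps `B` to itself), where `γ = π^M`. -/
def imageD (p : ℕ) {n : ℕ} {K : Type*} [NormedField K] (w : Fin n → Fin n → ℤ) (M : ℕ) (π : K) :
    Submodule K (spaceB w M π) :=
  Submodule.span K {η | ∃ (i : Fin n) (ξ : spaceB w M π),
    (η : Laurent n K) = Dhat p w (π ^ M) i (ξ : Laurent n K)}

/-- The quotient space `B / ∑_i D̂_i B`. -/
def QuotB (p : ℕ) {n : ℕ} {K : Type*} [NormedField K] (w : Fin n → Fin n → ℤ) (M : ℕ) (π : K) :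
    Type _ :=
  spaceB w M π ⧸ imageD p w M π

instance (p : ℕ) {n : ℕ} {K : Type*} [NormedField K] (w : Fin n → Fin n → ℤ) (M : ℕ) (π : K) :
    AddCommGroup (QuotB p w M π) :=
  inferInstanceAs (AddCommGroup (spaceB w M π ⧸ imageD p w M π))

instance (p : ℕ) {n : ℕ} {K : Type*} [NormedField K] (w : Fin n → Fin n → ℤ) (M : ℕ) (π : K) :
    Module K (QuotB p w M π) :=
  inferInstanceAs (Module K (spaceB w M π ⧸ imageD p w M π))

/-- The projection `B → B / ∑_i D̂_i B`. -/
def toQuotB (p : ℕ) {n : ℕ} {K : Type*} [NormedField K] (w : Fin n → Fin n → ℤ) (M : ℕ) (π : K) :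
    spaceB w M π →ₗ[K] QuotB p w M π :=
  (imageD p w M π).mkQ

/-! ### The coefficient field -/

/-- The field `K = ℚ_p(π) ⊆ ℂ_p`, with the norm of `ℂ_p`. -/
def BaseField (p : ℕ) [Fact p.Prime] (π : ℂ_[p]) : Type :=
  IntermediateField.adjoin ℚ_[p] {π}

instance (p : ℕ) [Fact p.Prime] (π : ℂ_[p]) : NormedField (BaseField p π) :=
  inferInstanceAs (NormedField (IntermediateField.adjoin ℚ_[p] {π}))

instance (p : ℕ) [Fact p.Prime] (π : ℂ_[p]) : NormedAlgebra ℚ_[p] (BaseField p π) :=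
  inferInstanceAs (NormedAlgebra ℚ_[p] (IntermediateField.adjoin ℚ_[p] {π}))

instance (p : ℕ) [Fact p.Prime] (π : ℂ_[p]) : CharZero (BaseField p π) :=
  inferInstanceAs (CharZero (IntermediateField.adjoin ℚ_[p] {π}))

/-- The inclusion of `ℚ_p(π)` in `ℂ_p`. -/
def BaseField.incl (p : ℕ) [Fact p.Prime] (π : ℂ_[p]) : BaseField p π →+* ℂ_[p] :=
  (IntermediateField.adjoin ℚ_[p] {π}).val.toRingHom

/-- The element `π` of the field `ℚ_p(π)`. -/
def gen (p : ℕ) [Fact p.Prime] (π : ℂ_[p]) : BaseField p π :=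
  ⟨π, IntermediateField.mem_adjoin_simple_self ℚ_[p] π⟩

end

end DworkDiag

namespace DworkDiag

open Filter Topology

/-! ### Norm estimates for the terms of `∑ γ ^ p ^ i / p ^ i` -/

section RealEstimates

variable {p : ℕ} {ρ : ℝ}

/-! Since γ_l - γ_{l-1} = γ^{p^l}/p^l, formally θ(t) = exp(h(t) - h(t^p)). Hence D̂_i = e^{-H} ∘ E_i
∘ e^H and α = e^{-H} ∘ ψ ∘ e^H, and the relation ψ E_i = p E_i ψ becomes α D̂_i = p D̂_i α, so α
acts on the quotient. The rigorous version is the differential equation of θ (`mul_thetaCoeff`),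
which gives `alphaOp_diffOp`.

Every point of M(f) is uniquely s + ∑ k_i w_i with s ∈ S(Δ) and k ∈ ℕⁿ. Dividing coefficients by
γ^{|k|} identifies B with the null families on S(Δ) × ℕⁿ (`toSpaceB`). The D̂_i become invertible
K-linear combinations of operators D_j, one per vector w_j, with D_j x^{(s,k)} = (r_j + k_j)
x^{(s,k)} + x^{(s,k+e_j)} + ∑_{l≥1} ε_l x^{(s,k+p^l e_j)}. Here |r_j| ≤ 1 because det J is a p-adic
unit, and |ε_l| ≤ p^{-l} because γ_l is minus a tail of a series that vanishes at γ
(`norm_dworkEps_le`).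

Spanning: modulo p this relation trades x^{(s,k+e_j)} for a monomial of lower degree, so every
family of norm at most 1 is approximated modulo p by the D_j-images and the x^s; successive
approximation finishes (`spanMap_surjective`). Independence: for each s there is a continuous
functional that kills every image of D_j and is dual to x^s. It is built from products of
one-variable moments, obtained as fixed points of a contraction (`exists_bounded_solution`,
`functional_diffOp`).

The entry γ(u,u') is the functional of u' applied to α(x^u). It vanishes unless p.u' = u. In that
case its k = 0 term is ∏ θ_{m_j} with m_j = ⌊p r_j(u')⌋ < p. The Artin–Hasse coefficients of index
below p are units, so this term has norm |γ|^{∑ m_j}; the other terms are smaller by at least a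
factor 1/p (`norm_functional_alphaOp`). Finally ∑ m_j = p w(u') - w(u).

All limits are taken in K, so K has to be complete; this follows from γ being algebraic over ℚ_p
(`isIntegral_of_hasSum`). -/

theorem pow_pow_succ_eq (hp : 1 < p) (hρ : ρ ^ (p - 1) = (p : ℝ)⁻¹) (i : ℕ) :
    ρ ^ p ^ (i + 1) = ρ ^ p ^ i * ((p : ℝ)⁻¹) ^ p ^ i := by
  rw [← hρ, ← pow_mul, ← pow_add]
  congr 1
  obtain ⟨q, rfl⟩ : ∃ q, p = q + 1 := ⟨p - 1, by omega⟩
  simp only [Nat.add_sub_cancel]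
  ring

theorem inv_pow_mul_le (hp : 1 < p) {k : ℕ} (hk : 1 ≤ k) : ((p : ℝ)⁻¹) ^ k * p ≤ 1 := by
  have h0 : (0 : ℝ) < p := by positivity
  obtain ⟨j, rfl⟩ : ∃ j, k = j + 1 := ⟨k - 1, by omega⟩
  rw [pow_succ, mul_assoc, inv_mul_cancel₀ h0.ne', mul_one]
  exact pow_le_one₀ (by positivity) (inv_le_one_of_one_le₀ (by exact_mod_cast hp.le))

theorem antitone_pow_pow_mul_pow (hp : 1 < p) (hρ0 : 0 ≤ ρ) (hρ : ρ ^ (p - 1) = (p : ℝ)⁻¹) :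
    Antitone fun i : ℕ => ρ ^ p ^ i * (p : ℝ) ^ i := by
  refine antitone_nat_of_succ_le fun i => ?_
  rw [pow_pow_succ_eq hp hρ]
  calc ρ ^ p ^ i * ((p : ℝ)⁻¹) ^ p ^ i * (p : ℝ) ^ (i + 1)
      = (ρ ^ p ^ i * (p : ℝ) ^ i) * (((p : ℝ)⁻¹) ^ p ^ i * p) := by ring
    _ ≤ (ρ ^ p ^ i * (p : ℝ) ^ i) * 1 := by
        gcongr
        exact inv_pow_mul_le hp (Nat.one_le_pow _ _ (by omega))
    _ = _ := mul_one _

/-- The terms of index 0 and 1 of ∑ γ^{p^i}/p^i have equal norm, and each further term gains at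
least a factor 1/p. This is what isolates γ + γ^p/p as the dominant part. -/
theorem pow_pow_mul_pow_le (hp : 1 < p) (hρ0 : 0 ≤ ρ) (hρ : ρ ^ (p - 1) = (p : ℝ)⁻¹) (i : ℕ) :
    ρ ^ p ^ (i + 1) * (p : ℝ) ^ (i + 1) ≤ ρ * ((p : ℝ)⁻¹) ^ i := by
  have h0 : (0 : ℝ) < p := by positivity
  induction i with
  | zero =>
    rw [pow_pow_succ_eq hp hρ]
    simp [mul_assoc, inv_mul_cancel₀ h0.ne']
  | succ i ih =>
    rw [pow_pow_succ_eq hp hρ]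
    have hlt : 2 ≤ p ^ (i + 1) := hp.trans_le (Nat.le_self_pow (by omega) p)
    obtain ⟨k, hk⟩ : ∃ k, p ^ (i + 1) = k + 1 := ⟨p ^ (i + 1) - 1, by omega⟩
    calc ρ ^ p ^ (i + 1) * ((p : ℝ)⁻¹) ^ p ^ (i + 1) * (p : ℝ) ^ (i + 1 + 1)
        = (ρ ^ p ^ (i + 1) * (p : ℝ) ^ (i + 1)) * ((p : ℝ)⁻¹ * (((p : ℝ)⁻¹) ^ k * p)) := by
          rw [hk]; ring
      _ ≤ (ρ * ((p : ℝ)⁻¹) ^ i) * ((p : ℝ)⁻¹ * 1) := by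
          gcongr
          exact inv_pow_mul_le hp (by omega)
      _ = _ := by ring

end RealEstimates

theorem norm_pow_div {K : Type*} [NormedField K] {p : ℕ} (hp : ‖(p : K)‖ = (p : ℝ)⁻¹) (γ : K) (i : ℕ) :
    ‖γ ^ p ^ i / (p : K) ^ i‖ = ‖γ‖ ^ p ^ i * (p : ℝ) ^ i := by
  rw [norm_div, norm_pow, norm_pow, hp, inv_pow, div_inv_eq_mul]

/-! ### Ultrametric estimates -/

section Ultrametric

variable {K : Type*} [NormedField K] [IsUltrametricDist K]

theorem norm_add_le_of_le {E : Type*} [SeminormedAddCommGroup E] [IsUltrametricDist E] {x y : E}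
    {C : ℝ} (hx : ‖x‖ ≤ C) (hy : ‖y‖ ≤ C) : ‖x + y‖ ≤ C :=
  (IsUltrametricDist.norm_add_le_max x y).trans (max_le hx hy)

theorem norm_pow_sub_pow_le {x y : K} (hx : ‖x‖ ≤ 1) (hy : ‖y‖ ≤ 1) (n : ℕ) :
    ‖x ^ n - y ^ n‖ ≤ ‖x - y‖ := by
  rw [← Commute.geom_sum₂_mul (Commute.all x y), norm_mul]
  refine mul_le_of_le_one_left (norm_nonneg _) ?_
  refine IsUltrametricDist.norm_sum_le_of_forall_le_of_nonneg zero_le_one fun i _ => ?_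
  rw [norm_mul, norm_pow, norm_pow]
  exact mul_le_one₀ (pow_le_one₀ (norm_nonneg _) hx) (by positivity)
    (pow_le_one₀ (norm_nonneg _) hy)

/-- The cofactor ∑ x^i y^{n-1-i} of x - y is n x^{n-1} plus terms divisible by x - y. For n = p this
makes the p-th power map contracting on pairs at distance less than 1. -/
theorem norm_pow_sub_pow_le_mul {x y : K} (hx : ‖x‖ ≤ 1) (hy : ‖y‖ ≤ 1) (n : ℕ) :
    ‖x ^ n - y ^ n‖ ≤ max ‖(n : K)‖ ‖x - y‖ * ‖x - y‖ := by
  rw [← Commute.geom_sum₂_mul (Commute.all x y), norm_mul]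
  refine mul_le_mul_of_nonneg_right ?_ (norm_nonneg _)
  have hsplit : ∑ i ∈ Finset.range n, x ^ i * y ^ (n - 1 - i) =
      n * x ^ (n - 1) + ∑ i ∈ Finset.range n, x ^ i * (y ^ (n - 1 - i) - x ^ (n - 1 - i)) := by
    have hconst : (n : K) * x ^ (n - 1) = ∑ _i ∈ Finset.range n, x ^ (n - 1) := by simp
    rw [hconst, ← Finset.sum_add_distrib]
    refine Finset.sum_congr rfl fun i hi => ?_
    have hi' : i < n := by simpa using hi
    have : x ^ (n - 1) = x ^ i * x ^ (n - 1 - i) := by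
      rw [← pow_add]; congr 1; omega
    rw [this]; ring
  rw [hsplit]
  refine norm_add_le_of_le ?_ ?_
  · rw [norm_mul, norm_pow]
    exact (mul_le_of_le_one_right (norm_nonneg _) (pow_le_one₀ (norm_nonneg _) hx)).trans
      (le_max_left _ _)
  · refine IsUltrametricDist.norm_sum_le_of_forall_le_of_nonneg
      ((norm_nonneg _).trans (le_max_left _ _)) fun i _ => ?_
    rw [norm_mul, norm_pow]
    refine (mul_le_of_le_one_left (norm_nonneg _) (pow_le_one₀ (norm_nonneg _) hx)).trans ?_
    refine le_trans (norm_pow_sub_pow_le hy hx _) ?_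
    rw [norm_sub_rev]
    exact le_max_right _ _

end Ultrametric

/-! ### Zeros of `∑ t ^ p ^ i / p ^ i` of order `1 / (p - 1)` are algebraic -/

section Algebraic

variable {p : ℕ} [Fact p.Prime]

theorem norm_natCast_prime : ‖(p : ℂ_[p])‖ = (p : ℝ)⁻¹ := by
  have := PadicComplex.norm_extends' p (p : ℚ_[p])
  rw [Padic.norm_p] at this
  rw [← this]
  congr 1
  simp

theorem norm_pow_eq_of_ord {γ : ℂ_[p]}
    (h : ord p γ = ((1 / ((p : ℝ) - 1) : ℝ) : WithTop ℝ)) :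
    γ ≠ 0 ∧ ‖γ‖ ^ (p - 1) = (p : ℝ)⁻¹ := by
  have hp : 1 < p := (Fact.out : p.Prime).one_lt
  have hp' : (1 : ℝ) < p := by exact_mod_cast hp
  have h0 : γ ≠ 0 := by
    rintro rfl
    simp [ord] at h
  refine ⟨h0, ?_⟩
  rw [ord, if_neg h0, WithTop.coe_eq_coe] at h
  have hn : 0 < ‖γ‖ := norm_pos_iff.2 h0
  have h1 : Real.logb p ‖γ‖ = -(1 / ((p : ℝ) - 1)) := by linarith
  have h2 : ‖γ‖ = (p : ℝ) ^ (-(1 / ((p : ℝ) - 1))) := by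
    rw [← h1, Real.rpow_logb (by linarith) (by linarith) hn]
  rw [h2, ← Real.rpow_natCast, ← Real.rpow_mul (by linarith), Nat.cast_sub hp.le,
    ← Real.rpow_neg_one]
  congr 1
  have : (p : ℝ) - 1 ≠ 0 := by linarith
  push_cast
  field_simp

/-- The two leading terms of the series nearly cancel, so γ^{p-1} + p has norm below 1/p =
‖γ‖^{p-1}. It is also the product of the γ - ζ over the p - 1 roots ζ of X^{p-1} + p, so some factor
is smaller than ‖γ‖. -/
theorem exists_root_near {γ : ℂ_[p]} (h0 : γ ≠ 0) (hρ : ‖γ‖ ^ (p - 1) = (p : ℝ)⁻¹)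
    (hγ : HasSum (fun i : ℕ => γ ^ p ^ i / (p : ℂ_[p]) ^ i) 0) :
    ∃ ζ : ℂ_[p], ζ ^ (p - 1) = -p ∧ ‖γ - ζ‖ < ‖γ‖ := by
  have hp : 1 < p := (Fact.out : p.Prime).one_lt
  have hpR : (1 : ℝ) < p := by exact_mod_cast hp
  have hp0 : (p : ℂ_[p]) ≠ 0 := by exact_mod_cast (by omega : p ≠ 0)
  have hn : 0 < ‖γ‖ := norm_pos_iff.2 h0
  have hsum : γ + γ ^ p / p = -∑' i : ℕ, γ ^ p ^ (i + 2) / (p : ℂ_[p]) ^ (i + 2) := by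
    have := hγ.summable.sum_add_tsum_nat_add 2
    rw [hγ.tsum_eq] at this
    simp only [Finset.sum_range_succ, Finset.sum_range_zero, pow_zero, pow_one, div_one,
      zero_add] at this
    exact eq_neg_of_add_eq_zero_left this
  have hle : ‖γ + γ ^ p / p‖ ≤ ‖γ‖ * (p : ℝ)⁻¹ := by
    rw [hsum, norm_neg]
    refine IsUltrametricDist.norm_tsum_le_of_forall_le_of_nonneg (by positivity) fun i => ?_
    rw [norm_pow_div norm_natCast_prime]
    refine (antitone_pow_pow_mul_pow hp (norm_nonneg γ) hρ (by omega : 2 ≤ i + 2)).trans ?_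
    simpa using pow_pow_mul_pow_le hp (norm_nonneg γ) hρ 1
  have hlt : ‖γ ^ (p - 1) + p‖ < (p : ℝ)⁻¹ := by
    have h1 : γ ^ (p - 1) + p = p / γ * (γ + γ ^ p / p) := by
      have : γ ^ p = γ ^ (p - 1) * γ := by rw [← pow_succ]; congr 1; omega
      rw [this]; field_simp; ring
    rw [h1, norm_mul, norm_div, norm_natCast_prime]
    calc (p : ℝ)⁻¹ / ‖γ‖ * ‖γ + γ ^ p / p‖ ≤ (p : ℝ)⁻¹ / ‖γ‖ * (‖γ‖ * (p : ℝ)⁻¹) := by gcongr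
      _ = (p : ℝ)⁻¹ * (p : ℝ)⁻¹ := by field_simp
      _ < (p : ℝ)⁻¹ := mul_lt_of_lt_one_right (by positivity) (inv_lt_one_of_one_lt₀ hpR)
  by_contra! hcon
  let P : Polynomial ℂ_[p] := Polynomial.X ^ (p - 1) + Polynomial.C (p : ℂ_[p])
  have hdeg : P.natDegree = p - 1 := Polynomial.natDegree_X_pow_add_C
  have hmonic : P.Monic := Polynomial.monic_X_pow_add_C _ (by omega)
  have hsplit := IsAlgClosed.splits P
  have hcard : P.roots.card = p - 1 := by rw [← hdeg, hsplit.natDegree_eq_card_roots]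
  have heval : P.eval γ = (P.roots.map fun ζ => γ - ζ).prod := by
    conv_lhs => rw [hsplit.eq_prod_roots_of_monic hmonic]
    simp [Polynomial.eval_multiset_prod, Multiset.map_map]
  have hroots : ∀ ζ ∈ P.roots, ‖γ‖ ≤ ‖γ - ζ‖ := fun ζ hζ => by
    refine hcon ζ ?_
    have := (Polynomial.mem_roots'.1 hζ).2
    simp only [P, Polynomial.IsRoot.def, Polynomial.eval_add, Polynomial.eval_pow,
      Polynomial.eval_X, Polynomial.eval_C] at this
    exact eq_neg_of_add_eq_zero_left this
  have hprod : ∀ s : Multiset ℂ_[p], (∀ ζ ∈ s, ‖γ‖ ≤ ‖γ - ζ‖) →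
      ‖γ‖ ^ s.card ≤ ‖(s.map fun ζ => γ - ζ).prod‖ := by
    intro s
    induction s using Multiset.induction_on with
    | empty => simp
    | cons a s ih =>
      intro h
      rw [Multiset.card_cons, Multiset.map_cons, Multiset.prod_cons, norm_mul, pow_succ']
      exact mul_le_mul (h a (Multiset.mem_cons_self a s))
        (ih fun ζ hζ => h ζ (Multiset.mem_cons_of_mem hζ)) (by positivity) (norm_nonneg _)
  have := hprod _ hroots
  rw [hcard, ← heval, hρ] at this
  simp only [P, Polynomial.eval_add, Polynomial.eval_pow, Polynomial.eval_X,
    Polynomial.eval_C] at this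
  exact absurd hlt this.not_gt

/-- A Krasner-type argument: γ/ζ is the limit of an iteration that never leaves ℚ_p(ζ), and this
field is closed in ℂ_p because it is finite over ℚ_p. -/
theorem isIntegral_of_hasSum {γ : ℂ_[p]} (h0 : γ ≠ 0) (hρ : ‖γ‖ ^ (p - 1) = (p : ℝ)⁻¹)
    (hγ : HasSum (fun i : ℕ => γ ^ p ^ i / (p : ℂ_[p]) ^ i) 0) : IsIntegral ℚ_[p] γ := by
  have hp : 1 < p := (Fact.out : p.Prime).one_lt
  have hpR : (1 : ℝ) < p := by exact_mod_cast hp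
  have hp0 : (p : ℂ_[p]) ≠ 0 := by exact_mod_cast (by omega : p ≠ 0)
  have hn : 0 < ‖γ‖ := norm_pos_iff.2 h0
  obtain ⟨ζ, hζ, hζγ⟩ := exists_root_near h0 hρ hγ
  have hζnorm : ‖ζ‖ = ‖γ‖ := by
    by_contra hne
    have := IsUltrametricDist.norm_add_eq_max_of_norm_ne_norm (x := γ) (y := -ζ)
      (by rw [norm_neg]; exact Ne.symm hne)
    rw [← sub_eq_add_neg] at this
    rw [this] at hζγ
    exact absurd (le_max_left ‖γ‖ ‖-ζ‖) hζγ.not_ge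
  have hζ0 : ζ ≠ 0 := by rw [← norm_pos_iff, hζnorm]; exact hn
  have hζρ : ‖ζ‖ ^ (p - 1) = (p : ℝ)⁻¹ := by rw [hζnorm, hρ]
  have hζint : IsIntegral ℚ_[p] ζ := by
    refine IsIntegral.of_pow (n := p - 1) (by omega) ?_
    rw [hζ]
    have := (isIntegral_algebraMap (R := ℚ_[p]) (A := ℂ_[p]) (x := (p : ℚ_[p]))).neg
    rwa [map_natCast] at this
  let L := IntermediateField.adjoin ℚ_[p] {ζ}
  have hfin : FiniteDimensional ℚ_[p] L := IntermediateField.adjoin.finiteDimensional hζint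
  have hclosed : IsClosed (L : Set ℂ_[p]) := by
    have : FiniteDimensional ℚ_[p] (Subalgebra.toSubmodule L.toSubalgebra) := hfin
    exact Submodule.closed_of_finiteDimensional (Subalgebra.toSubmodule L.toSubalgebra)
  have hζL : ζ ∈ L := IntermediateField.mem_adjoin_simple_self _ _
  let b : ℕ → ℂ_[p] := fun i => ζ ^ p ^ i / (p : ℂ_[p]) ^ i / ζ
  have hbL : ∀ i, b i ∈ L := fun i =>
    div_mem (div_mem (pow_mem hζL _) (pow_mem (natCast_mem L p) _)) hζL
  have hbn : ∀ i, ‖b (i + 1)‖ ≤ ((p : ℝ)⁻¹) ^ i := fun i => by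
    simp only [b]
    rw [norm_div, norm_pow_div norm_natCast_prime, div_le_iff₀ (by rw [hζnorm]; exact hn), mul_comm _ ‖ζ‖]
    exact pow_pow_mul_pow_le hp (norm_nonneg ζ) hζρ i
  let s := γ / ζ
  have hs : ‖s‖ = 1 := by
    simp only [s]; rw [norm_div, hζnorm, div_self hn.ne']
  have hs1 : ‖s - 1‖ < 1 := by
    have : s - 1 = (γ - ζ) / ζ := by simp only [s]; field_simp
    rw [this, norm_div, hζnorm, div_lt_one hn]
    exact hζγ
  have hsumx : ∀ x : ℂ_[p], ‖x‖ ≤ 1 → Summable fun i => b (i + 2) * x ^ p ^ (i + 2) := by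
    intro x hx
    refine Summable.of_norm_bounded
      (summable_geometric_of_lt_one (inv_nonneg.2 (by positivity)) (inv_lt_one_of_one_lt₀ hpR))
      fun i => ?_
    rw [norm_mul, norm_pow]
    refine (mul_le_of_le_one_right (norm_nonneg _) (pow_le_one₀ (norm_nonneg _) hx)).trans ?_
    exact (hbn (i + 1)).trans
      (pow_le_pow_of_le_one (by positivity) (inv_le_one_of_one_le₀ hpR.le) (by omega))
  -- Divided by ζ, the equation for γ reads s - s^p + ∑_{i≥2} b_i s^{p^i} = 0, because b_0 = 1 and
  -- ζ^{p-1} = -p gives b_1 = -1. So s is a fixed point of Φ.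
  let Φ : ℂ_[p] → ℂ_[p] := fun x => x ^ p - ∑' i, b (i + 2) * x ^ p ^ (i + 2)
  have hΦs : Φ s = s := by
    have h1 : HasSum (fun i => b i * s ^ p ^ i) 0 := by
      have := hγ.div_const ζ
      rw [zero_div] at this
      refine this.congr_fun fun i => ?_
      simp only [b, s, div_pow]
      field_simp
    have h2 := h1.summable.sum_add_tsum_nat_add 2
    rw [h1.tsum_eq] at h2
    have hb0 : b 0 = 1 := by simp [b, hζ0]
    have hb1 : b 1 = -1 := by
      have : ζ ^ p = ζ ^ (p - 1) * ζ := by rw [← pow_succ]; congr 1; omega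
      simp only [b, pow_one]
      rw [this, hζ]; field_simp
    simp only [Finset.sum_range_succ, Finset.sum_range_zero, zero_add, hb0, hb1, pow_zero,
      pow_one] at h2
    simp only [Φ]
    linear_combination -h2
  have hΦL : ∀ x ∈ L, Φ x ∈ L := by
    intro x hx
    refine sub_mem (pow_mem hx _) ?_
    -- Where the series diverges, `tsum` is 0, which also lies in L; hence no bound on x is needed.
    by_cases hS : Summable fun i => b (i + 2) * x ^ p ^ (i + 2)
    · exact hclosed.mem_of_tendsto hS.hasSum
        (Eventually.of_forall fun t => sum_mem fun i _ => mul_mem (hbL _) (pow_mem hx _))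
    · rw [tsum_eq_zero_of_not_summable hS]; exact zero_mem L
  -- The constant serves twice: it bounds the distance from s to the starting point 1, and the
  -- contraction factor. The latter is at most max(1/p, ‖s - x‖) for x^p and 1/p for the series.
  let c : ℝ := max (p : ℝ)⁻¹ ‖s - 1‖
  have hc0 : 0 ≤ c := (norm_nonneg _).trans (le_max_right _ _)
  have hc1 : c < 1 := max_lt (inv_lt_one_of_one_lt₀ hpR) hs1
  have hcontr : ∀ x, ‖s - x‖ ≤ c → ‖s - Φ x‖ ≤ c * ‖s - x‖ := by
    intro x hx
    have hx1 : ‖x‖ ≤ 1 := by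
      have : x = s + -(s - x) := by ring
      rw [this]
      exact norm_add_le_of_le hs.le (by rw [norm_neg]; exact hx.trans hc1.le)
    have hdiff : s - Φ x = (s ^ p - x ^ p) +
        -∑' i, (b (i + 2) * s ^ p ^ (i + 2) - b (i + 2) * x ^ p ^ (i + 2)) := by
      rw [Summable.tsum_sub (hsumx s hs.le) (hsumx x hx1)]
      nth_rewrite 1 [← hΦs]
      simp only [Φ]; ring
    rw [hdiff]
    refine norm_add_le_of_le ?_ ?_
    · refine (norm_pow_sub_pow_le_mul hs.le hx1 p).trans ?_
      refine mul_le_mul_of_nonneg_right ?_ (norm_nonneg _)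
      rw [norm_natCast_prime]
      exact max_le (le_max_left _ _) hx
    · rw [norm_neg]
      refine IsUltrametricDist.norm_tsum_le_of_forall_le_of_nonneg (by positivity) fun i => ?_
      rw [← mul_sub, norm_mul]
      refine mul_le_mul ?_ (norm_pow_sub_pow_le hs.le hx1 _) (norm_nonneg _) hc0
      refine (hbn (i + 1)).trans (le_trans ?_ (le_max_left _ _))
      exact pow_le_of_le_one (by positivity) (inv_le_one_of_one_le₀ hpR.le) (by omega)
  have hiter : ∀ k : ℕ, Φ^[k] 1 ∈ L ∧ ‖s - Φ^[k] 1‖ ≤ c ^ (k + 1) := by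
    intro k
    induction k with
    | zero => exact ⟨one_mem L, by rw [zero_add, pow_one]; exact le_max_right _ _⟩
    | succ k ih =>
      rw [Function.iterate_succ_apply']
      refine ⟨hΦL _ ih.1, ?_⟩
      refine (hcontr _ (ih.2.trans (pow_le_of_le_one hc0 hc1.le (by omega)))).trans ?_
      rw [pow_succ']
      exact mul_le_mul_of_nonneg_left ih.2 hc0
  have hlim : Tendsto (fun k : ℕ => Φ^[k] 1) atTop (𝓝 s) := by
    rw [tendsto_iff_norm_sub_tendsto_zero]
    refine squeeze_zero (fun _ => norm_nonneg _) (fun k => ?_)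
      ((tendsto_pow_atTop_nhds_zero_of_lt_one hc0 hc1).comp (tendsto_add_atTop_nat 1))
    rw [norm_sub_rev]
    exact (hiter k).2
  have hsL : s ∈ L := hclosed.mem_of_tendsto hlim (Eventually.of_forall fun k => (hiter k).1)
  have hγL : γ ∈ L := by
    have : γ = s * ζ := by simp only [s]; field_simp
    rw [this]; exact mul_mem hsL hζL
  have := Algebra.IsIntegral.isIntegral (R := ℚ_[p]) (⟨γ, hγL⟩ : L)
  exact this.map L.val

theorem BaseField.completeSpace {π : ℂ_[p]} (hπ : IsIntegral ℚ_[p] π) :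
    CompleteSpace (BaseField p π) := by
  have : FiniteDimensional ℚ_[p] (IntermediateField.adjoin ℚ_[p] {π}) :=
    IntermediateField.adjoin.finiteDimensional hπ
  exact FiniteDimensional.complete ℚ_[p] (IntermediateField.adjoin ℚ_[p] {π})

end Algebraic

end DworkDiag

namespace DworkDiag

open PowerSeries

/-! ### The Artin–Hasse exponential -/

section ArtinHasse

/-- The exponent `∑ t ^ p ^ i / p ^ i` of the Artin–Hasse exponential. -/
noncomputable def artinHasseLog (p : ℕ) : PowerSeries ℚ :=
  PowerSeries.mk fun m => open Classical in if ∃ i : ℕ, m = p ^ i then (1 / m : ℚ) else 0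

theorem artinHasse_eq (p : ℕ) : artinHasse p = (exp ℚ).subst (artinHasseLog p) := rfl

theorem hasSubst_artinHasseLog {p : ℕ} :
     HasSubst (artinHasseLog p) := by
  refine HasSubst.of_constantCoeff_zero' ?_
  rw [← coeff_zero_eq_constantCoeff_apply, artinHasseLog, coeff_mk]
  simp

variable {p : ℕ}

theorem constantCoeff_artinHasse : constantCoeff (artinHasse p) = 1 := by
  have h0 : constantCoeff (artinHasseLog p) = 0 := by
    rw [← coeff_zero_eq_constantCoeff_apply, artinHasseLog, coeff_mk]
    simp
  rw [artinHasse_eq, ← coeff_zero_eq_constantCoeff_apply, coeff_subst' hasSubst_artinHasseLog,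
    finsum_eq_single _ 0]
  · simp
  · intro d hd
    simp [h0, hd]

theorem derivative_artinHasse :
    d⁄dX ℚ (artinHasse p) = artinHasse p * d⁄dX ℚ (artinHasseLog p) := by
  rw [artinHasse_eq, derivative_subst hasSubst_artinHasseLog, derivative_exp]

variable [Fact p.Prime]

theorem artinHasseLog_eq :
    artinHasseLog p = X + C ((p : ℚ)⁻¹) * expand p (Fact.out : p.Prime).ne_zero (artinHasseLog p) := by
  have hp : p.Prime := Fact.out
  have hp0 : (p : ℚ) ≠ 0 := by exact_mod_cast hp.ne_zero
  ext m
  rw [map_add, coeff_C_mul, coeff_expand, coeff_X, artinHasseLog, coeff_mk]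
  by_cases hm : p ∣ m
  · obtain ⟨k, rfl⟩ := hm
    have h1 : p * k ≠ 1 := fun h => hp.one_lt.ne' (Nat.eq_one_of_mul_eq_one_right h)
    have h2 : (∃ i, p * k = p ^ i) ↔ ∃ i, k = p ^ i := by
      constructor
      · rintro ⟨i, hi⟩
        obtain _ | i := i
        · exact absurd (by simpa using hi) h1
        · exact ⟨i, Nat.eq_of_mul_eq_mul_left hp.pos (by rw [hi, pow_succ'])⟩
      · rintro ⟨i, rfl⟩
        exact ⟨i + 1, by rw [pow_succ']⟩
    rw [if_neg h1, if_pos (dvd_mul_right p k), Nat.mul_div_cancel_left k hp.pos, coeff_mk]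
    by_cases h : ∃ i, k = p ^ i
    · rw [if_pos (h2.2 h), if_pos h]
      push_cast
      rw [one_div, mul_inv, zero_add, one_div]
    · rw [if_neg (h2.not.2 h), if_neg h]
      simp
  · have h2 : (∃ i, m = p ^ i) ↔ m = 1 := by
      constructor
      · rintro ⟨i, rfl⟩
        obtain _ | i := i
        · simp
        · exact absurd (dvd_pow_self p (by omega)) hm
      · rintro rfl
        exact ⟨0, by simp⟩
    rw [if_neg hm]
    by_cases h : m = 1
    · rw [if_pos (h2.2 h), if_pos h]
      simp [h]
    · rw [if_neg (h2.not.2 h), if_neg h]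
      simp

/-- The quotient F/G has derivative zero and constant term 1. -/
theorem eq_of_derivative_eq_mul {F G R : PowerSeries ℚ} (hF : d⁄dX ℚ F = F * R)
    (hG : d⁄dX ℚ G = G * R) (hF1 : constantCoeff F = 1) (hG1 : constantCoeff G = 1) : F = G := by
  have hG0 : constantCoeff G ≠ 0 := by rw [hG1]; exact one_ne_zero
  have hGG : G * G⁻¹ = 1 := PowerSeries.mul_inv_cancel G hG0
  have h : F * G⁻¹ = 1 := by
    refine derivative.ext ?_ (by simp [hF1, hG1])
    rw [Derivation.leibniz, derivative_inv', hF, hG, derivative_one, smul_eq_mul, smul_eq_mul]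
    linear_combination (-F * R * G⁻¹) * hGG
  calc F = F * G⁻¹ * G := by rw [mul_assoc, mul_comm G⁻¹, hGG, mul_one]
    _ = G := by rw [h, one_mul]

/-- With L the exponent of E, the identity L(t) = t + L(t^p)/p shows that both sides solve F' = F ·
pL' with constant term 1. This is the hypothesis of Dwork's integrality criterion, with u = exp(pt).
-/
theorem artinHasse_pow :
    artinHasse p ^ p = expand p (Fact.out : p.Prime).ne_zero (artinHasse p) * exp ℚ ^ p := by
  have hp : p.Prime := Fact.out
  have hp0 : (p : ℚ) ≠ 0 := by exact_mod_cast hp.ne_zero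
  have hCp : C ((p : ℚ)⁻¹) * (p : PowerSeries ℚ) = 1 := by
    rw [← map_natCast (C : ℚ →+* PowerSeries ℚ), ← map_mul, inv_mul_cancel₀ hp0, map_one]
  have hexp : ∀ f : PowerSeries ℚ, d⁄dX ℚ (expand p hp.ne_zero f) =
      expand p hp.ne_zero (d⁄dX ℚ f) * ((p : PowerSeries ℚ) * X ^ (p - 1)) := by
    intro f
    rw [expand_apply, expand_apply, derivative_subst (HasSubst.X_pow hp.ne_zero), derivative_pow,
      derivative_X, mul_one]
  have hpow : ∀ (f r : PowerSeries ℚ), d⁄dX ℚ f = f * r → d⁄dX ℚ (f ^ p) = f ^ p * ((p : PowerSeries ℚ) * r) := by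
    intro f r h
    have : f ^ p = f ^ (p - 1) * f := by rw [← pow_succ, Nat.sub_add_cancel hp.pos]
    rw [derivative_pow, h, this]; ring
  refine eq_of_derivative_eq_mul (hpow _ _ derivative_artinHasse) ?_ ?_ ?_
  · rw [Derivation.leibniz, hexp, derivative_artinHasse, hpow (exp ℚ) 1 (by
      rw [derivative_exp, mul_one]), map_mul, smul_eq_mul, smul_eq_mul]
    have hL : d⁄dX ℚ (artinHasseLog p) = 1 +
        expand p hp.ne_zero (d⁄dX ℚ (artinHasseLog p)) * X ^ (p - 1) := by
      conv_lhs => rw [artinHasseLog_eq]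
      rw [map_add, derivative_X, Derivation.leibniz, hexp, derivative_C, smul_zero, add_zero,
        smul_eq_mul]
      linear_combination (expand p hp.ne_zero (d⁄dX ℚ (artinHasseLog p)) * X ^ (p - 1)) * hCp
    linear_combination (-expand p hp.ne_zero (artinHasse p) * exp ℚ ^ p * (p : PowerSeries ℚ)) * hL
  · simp [constantCoeff_artinHasse]
  · simp [constantCoeff_artinHasse]

/-- Legendre's bound v_p(j!) < j; it says that exp(pt) ≡ 1 modulo p. -/
theorem norm_pow_div_factorial_le {j : ℕ} (hj : j ≠ 0) :
    ‖((p : ℚ_[p]) ^ j / (j.factorial : ℚ_[p]))‖ ≤ (p : ℝ)⁻¹ := by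
  have hp : p.Prime := Fact.out
  have hp1 : (1 : ℝ) < p := by exact_mod_cast hp.one_lt
  have h0 : (j.factorial : ℚ_[p]) ≠ 0 := by exact_mod_cast j.factorial_ne_zero
  have hlt : padicValNat p j.factorial < j := padicValNat_factorial_lt_of_ne_zero p hj
  rw [norm_div, norm_pow, Padic.norm_p, Padic.norm_eq_zpow_neg_valuation h0,
    Padic.valuation_natCast, ← zpow_natCast, inv_zpow', ← zpow_sub₀ (by linarith),
    ← zpow_neg_one]
  exact zpow_le_zpow_right₀ hp1.le (by omega)

/-- Dwork's criterion for the integrality of a power series over `ℚ_p`. -/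
theorem norm_coeff_le_one_of_pow_eq {f u : PowerSeries ℚ_[p]} (hf : constantCoeff f = 1)
    (hu : constantCoeff u = 1) (hun : ∀ j ≠ 0, ‖coeff j u‖ ≤ (p : ℝ)⁻¹)
    (h : f ^ p = expand p (Fact.out : p.Prime).ne_zero f * u) (k : ℕ) : ‖coeff k f‖ ≤ 1 := by
  have hp : p.Prime := Fact.out
  have hpinv : ‖(p : ℚ_[p])‖ = (p : ℝ)⁻¹ := Padic.norm_p
  induction k using Nat.strong_induction_on with
  | _ k ih =>
  obtain rfl | hk := Nat.eq_zero_or_pos k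
  · rw [coeff_zero_eq_constantCoeff_apply, hf, norm_one]
  have hlift : ∀ j, ∃ a : ℤ_[p], (a : ℚ_[p]) = if j < k then coeff j f else 0 := fun j => by
    split_ifs with hj
    · exact ⟨⟨coeff j f, ih j hj⟩, rfl⟩
    · exact ⟨0, rfl⟩
  choose a ha using hlift
  -- The truncation of f below degree k, lifted to ℤ_p by the induction hypothesis so that it can be
  -- reduced modulo p.
  let G : Polynomial ℤ_[p] := ∑ j ∈ Finset.range k, Polynomial.monomial j (a j)
  let ι : ℤ_[p] →+* ℚ_[p] := PadicInt.Coe.ringHom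
  let g : PowerSeries ℚ_[p] := ((G.map ι : Polynomial ℚ_[p]) : PowerSeries ℚ_[p])
  have hg : ∀ j, coeff j g = if j < k then coeff j f else 0 := by
    intro j
    have hιa : ∀ j, ι (a j) = if j < k then coeff j f else 0 := ha
    simp only [g, G, Polynomial.coeff_coe, Polynomial.coeff_map, Polynomial.finsetSum_coeff,
      Polynomial.coeff_monomial, Finset.sum_ite_eq', Finset.mem_range]
    split_ifs with hj
    · rw [hιa, if_pos hj]
    · exact map_zero ι
  have hfact : ∃ r : PowerSeries ℚ_[p], f = g + X ^ k * r ∧ constantCoeff r = coeff k f := by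
    refine ⟨mk fun j => coeff (j + k) f, ?_, ?_⟩
    · ext j
      rw [map_add, hg, coeff_X_pow_mul']
      split_ifs with h1 h2 h2
      · omega
      · simp
      · rw [coeff_mk, Nat.sub_add_cancel h2, zero_add]
      · omega
    · rw [← coeff_zero_eq_constantCoeff_apply, coeff_mk, zero_add]
  obtain ⟨r, hr, hr0⟩ := hfact
  have hg0 : constantCoeff g = 1 := by
    rw [← coeff_zero_eq_constantCoeff_apply, hg, if_pos hk, coeff_zero_eq_constantCoeff_apply, hf]
  -- In (g + X^k r)^p only the linear term p g^{p-1} X^k r reaches degree k; the quadratic remainder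
  -- starts at degree 2k > k.
  have hL : coeff k (f ^ p) = coeff k (g ^ p) + p * coeff k f := by
    obtain ⟨q, hq⟩ := Polynomial.powAddExpansion g (X ^ k * r) p
    rw [hr, hq, map_add, map_add, ← hr]
    have e1 : (p : PowerSeries ℚ_[p]) * g ^ (p - 1) * (X ^ k * r) =
        X ^ k * (C (p : ℚ_[p]) * g ^ (p - 1) * r) := by rw [map_natCast]; ring
    have e2 : q * (X ^ k * r) ^ 2 = X ^ (k + 1) * (X ^ (k - 1) * q * r ^ 2) := by
      have : (X : PowerSeries ℚ_[p]) ^ (k + 1) * X ^ (k - 1) = (X ^ k) ^ 2 := by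
        rw [← pow_add, ← pow_mul]; congr 1; omega
      linear_combination (-q * r ^ 2) * this
    rw [e1, e2, coeff_X_pow_mul', if_pos le_rfl, coeff_X_pow_mul', if_neg (by omega),
      Nat.sub_self, coeff_zero_eq_constantCoeff_apply]
    simp [hg0, hr0]
  -- Frobenius in characteristic p: G(t^p) ≡ G(t)^p modulo p.
  have hmod : ‖coeff k (expand p hp.ne_zero g) - coeff k (g ^ p)‖ ≤ (p : ℝ)⁻¹ := by
    have h1 : coeff k (expand p hp.ne_zero g) - coeff k (g ^ p) =
        ι ((Polynomial.expand ℤ_[p] p G - G ^ p).coeff k) := by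
      rw [Polynomial.coeff_sub, map_sub]
      congr 1
      · rw [coeff_expand, Polynomial.coeff_expand hp.pos]
        simp only [g, Polynomial.coeff_coe, Polynomial.coeff_map]
        split_ifs <;> simp
      · simp only [g]
        rw [← Polynomial.coe_pow, Polynomial.coeff_coe, ← Polynomial.map_pow, Polynomial.coeff_map]
    have h2 : PadicInt.toZMod ((Polynomial.expand ℤ_[p] p G - G ^ p).coeff k) = 0 := by
      rw [← Polynomial.coeff_map, Polynomial.map_sub, Polynomial.map_expand, Polynomial.map_pow,
        ZMod.expand_card, sub_self, Polynomial.coeff_zero]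
    have h3 : (p : ℤ_[p]) ∣ (Polynomial.expand ℤ_[p] p G - G ^ p).coeff k := by
      rwa [← RingHom.mem_ker, PadicInt.ker_toZMod, PadicInt.maximalIdeal_eq_span_p,
        Ideal.mem_span_singleton] at h2
    obtain ⟨c, hc⟩ := h3
    rw [h1, hc, map_mul, norm_mul, map_natCast, hpinv]
    exact mul_le_of_le_one_right (by positivity) c.2
  -- Up to degree k, f(t^p) involves only coefficients of index at most k/p < k, where f and g agree
  -- and are integral; the factor u is 1 modulo p.
  have hR : ‖coeff k (expand p hp.ne_zero f * u) - coeff k (expand p hp.ne_zero g)‖ ≤ (p : ℝ)⁻¹ := by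
    have hexp : ∀ j ≤ k, coeff j (expand p hp.ne_zero f) = coeff j (expand p hp.ne_zero g) ∧
        ‖coeff j (expand p hp.ne_zero f)‖ ≤ 1 := by
      intro j hj
      rw [coeff_expand, coeff_expand, hg]
      have hlt : j / p < k := by
        obtain rfl | h0 := Nat.eq_zero_or_pos j
        · simpa using hk
        · exact (Nat.div_lt_self h0 hp.one_lt).trans_le hj
      rw [if_pos hlt]
      refine ⟨rfl, ?_⟩
      split_ifs
      · exact ih _ hlt
      · simp
    rw [coeff_mul, Finset.Nat.sum_antidiagonal_eq_sum_range_succ_mk, Finset.sum_range_succ,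
      Nat.sub_self, coeff_zero_eq_constantCoeff_apply, hu, mul_one, (hexp k le_rfl).1,
      add_sub_cancel_right]
    refine IsUltrametricDist.norm_sum_le_of_forall_le_of_nonneg (by positivity) fun i hi => ?_
    have hi' : i < k := by simpa using hi
    rw [norm_mul]
    refine (mul_le_of_le_one_left (norm_nonneg _) (hexp i hi'.le).2).trans (hun _ (by omega))
  have hfin : (p : ℚ_[p]) * coeff k f =
      (coeff k (expand p hp.ne_zero f * u) - coeff k (expand p hp.ne_zero g)) +
      (coeff k (expand p hp.ne_zero g) - coeff k (g ^ p)) := by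
    rw [← h, hL]; ring
  have hle : ‖(p : ℚ_[p]) * coeff k f‖ ≤ (p : ℝ)⁻¹ := by
    rw [hfin]; exact norm_add_le_of_le hR hmod
  rw [norm_mul, hpinv] at hle
  have hp0 : (0 : ℝ) < (p : ℝ)⁻¹ := inv_pos.2 (by exact_mod_cast hp.pos)
  exact le_of_mul_le_mul_left (by simpa using hle) hp0

theorem norm_coeff_artinHasse_le_one (k : ℕ) : ‖((coeff k (artinHasse p) : ℚ) : ℚ_[p])‖ ≤ 1 := by
  have hp : p.Prime := Fact.out
  let φ : ℚ →+* ℚ_[p] := Rat.castHom ℚ_[p]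
  have := norm_coeff_le_one_of_pow_eq (p := p) (f := map φ (artinHasse p))
    (u := map φ (exp ℚ ^ p)) ?_ ?_ ?_ ?_ k
  · simpa [φ] using this
  · rw [← coeff_zero_eq_constantCoeff_apply, coeff_map, coeff_zero_eq_constantCoeff_apply,
      constantCoeff_artinHasse, map_one]
  · rw [← coeff_zero_eq_constantCoeff_apply, coeff_map, coeff_zero_eq_constantCoeff_apply]
    simp
  · intro j hj
    rw [coeff_map, exp_pow_eq_rescale_exp, coeff_rescale, coeff_exp]
    have := norm_pow_div_factorial_le (p := p) hj
    simpa [φ, div_eq_mul_inv] using this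
  · rw [← map_pow, artinHasse_pow, map_mul]
    congr 1
    ext m
    rw [coeff_map, coeff_expand, coeff_expand]
    split_ifs <;> simp

/-- This is t E' = E · ∑ t^{p^l} read off in degree k. The range l ≤ k loses nothing, because l <
p^l. -/
theorem coeff_artinHasse_mul (k : ℕ) :
    (k : ℚ) * coeff k (artinHasse p) = ∑ l ∈ Finset.range (k + 1),
      if p ^ l ≤ k then coeff (k - p ^ l) (artinHasse p) else 0 := by
  classical
  have hp : p.Prime := Fact.out
  obtain rfl | hk := Nat.eq_zero_or_pos k
  · simp
  obtain ⟨m, rfl⟩ : ∃ m, k = m + 1 := ⟨k - 1, by omega⟩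
  have hcoeff : ∀ j, coeff j (d⁄dX ℚ (artinHasseLog p)) = if ∃ i, j + 1 = p ^ i then 1 else 0 := by
    intro j
    rw [coeff_derivative, artinHasseLog, coeff_mk]
    have : (j : ℚ) + 1 ≠ 0 := by positivity
    split_ifs
    · push_cast; field_simp
    · simp
  have h := congrArg (coeff m) (derivative_artinHasse (p := p))
  rw [coeff_derivative, mul_comm (artinHasse p), coeff_mul,
    Finset.Nat.sum_antidiagonal_eq_sum_range_succ_mk] at h
  push_cast
  rw [mul_comm, h, ← Finset.sum_filter]
  simp only [hcoeff, ite_mul, one_mul, zero_mul]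
  rw [← Finset.sum_filter]
  refine (Finset.sum_nbij (fun l => p ^ l - 1) ?_ ?_ ?_ ?_).symm
  · intro l hl
    have h1 : 0 < p ^ l := pow_pos hp.pos l
    simp only [Finset.mem_filter, Finset.mem_range] at hl ⊢
    exact ⟨by omega, l, by omega⟩
  · intro a _ b _ hab
    have h1 : 0 < p ^ a := pow_pos hp.pos a
    have h2 : 0 < p ^ b := pow_pos hp.pos b
    exact Nat.pow_right_injective hp.two_le (by simp only at hab ⊢; omega)
  · rintro j hj
    simp only [Finset.coe_filter, Finset.mem_range, Set.mem_ofPred_eq] at hj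
    obtain ⟨hj, i, hi⟩ := hj
    have : i < p ^ i := Nat.lt_pow_self hp.one_lt
    refine ⟨i, ?_, by simp only; omega⟩
    simp only [Finset.coe_filter, Finset.mem_range, Set.mem_ofPred_eq]
    omega
  · intro l hl
    have h1 : 0 < p ^ l := pow_pos hp.pos l
    congr 1
    congr 1
    omega

/-- Below p only l = 0 contributes to the recurrence, so k e_k = e_{k-1} with k a p-adic unit. This
exactness is the source of the equality in the final order formula. -/
theorem norm_coeff_artinHasse_eq_one {k : ℕ} (hk : k < p) :
    ‖((coeff k (artinHasse p) : ℚ) : ℚ_[p])‖ = 1 := by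
  have hp : p.Prime := Fact.out
  induction k with
  | zero => simp [constantCoeff_artinHasse]
  | succ k ih =>
    have h := coeff_artinHasse_mul (p := p) (k + 1)
    rw [Finset.sum_eq_single 0] at h
    · rw [pow_zero, if_pos (by omega), Nat.add_sub_cancel] at h
      have h2 := ih (by omega)
      rw [← h] at h2
      push_cast at h2
      rw [norm_mul] at h2
      have h3 : ‖((k + 1 : ℕ) : ℚ_[p])‖ = 1 := by
        rw [Padic.norm_natCast_eq_one_iff]
        exact (Nat.Prime.coprime_iff_not_dvd hp).2 fun hd => by
          have := Nat.le_of_dvd (by omega) hd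
          omega
      push_cast at h3
      rwa [h3, one_mul] at h2
    · intro l _ hl
      rw [if_neg]
      have := Nat.le_self_pow hl p
      omega
    · simp

end ArtinHasse

end DworkDiag

namespace DworkDiag

open Filter Topology

/-! ### The coefficients of `θ` and of `h` -/

section Coefficients

variable {p : ℕ} [Fact p.Prime] {K : Type*} [NormedField K] [NormedAlgebra ℚ_[p] K]

theorem norm_prime_cast : ‖(p : K)‖ = (p : ℝ)⁻¹ := by
  rw [← map_natCast (algebraMap ℚ_[p] K), norm_algebraMap', Padic.norm_p]

theorem prime_cast_ne_zero : (p : K) ≠ 0 := by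
  rw [← norm_pos_iff, norm_prime_cast (p := p)]
  exact inv_pos.2 (by exact_mod_cast (Fact.out : p.Prime).pos)

/-- As the whole series vanishes at γ, the partial sum is minus the tail, and the tail is bounded by
its first term. -/
theorem norm_gammaSum_le [IsUltrametricDist K] {γ : K} (hρ : ‖γ‖ ^ (p - 1) = (p : ℝ)⁻¹)
    (hγ : HasSum (fun i : ℕ => γ ^ p ^ i / (p : K) ^ i) 0) (l : ℕ) :
    ‖gammaSum p γ l‖ ≤ ‖γ‖ ^ p ^ (l + 1) * (p : ℝ) ^ (l + 1) := by
  have hp : 1 < p := (Fact.out : p.Prime).one_lt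
  have h := hγ.summable.sum_add_tsum_nat_add (l + 1)
  rw [hγ.tsum_eq] at h
  rw [gammaSum, eq_neg_of_add_eq_zero_left h, norm_neg]
  refine IsUltrametricDist.norm_tsum_le_of_forall_le_of_nonneg (by positivity) fun i => ?_
  rw [norm_pow_div norm_prime_cast]
  exact antitone_pow_pow_mul_pow hp (norm_nonneg γ) hρ (by omega)

/-- The normalized coefficients `p ^ l γ_l / γ ^ p ^ l` of the series `t h'(t)`. -/
def dworkEps (p : ℕ) {K : Type*} [Field K] (γ : K) (l : ℕ) : K :=
  (p : K) ^ l * gammaSum p γ l / γ ^ p ^ l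

theorem dworkEps_zero {p : ℕ} {K : Type*} [Field K] {γ : K} (h0 : γ ≠ 0) : dworkEps p γ 0 = 1 := by
  simp [dworkEps, gammaSum, h0]

/-- The tail bound gives p^{-l} · p^{l+1} · p^{-p^l} = p^{1-p^l}, and p^l ≥ l + 1. -/
theorem norm_dworkEps_le [IsUltrametricDist K] {γ : K} (h0 : γ ≠ 0)
    (hρ : ‖γ‖ ^ (p - 1) = (p : ℝ)⁻¹)
    (hγ : HasSum (fun i : ℕ => γ ^ p ^ i / (p : K) ^ i) 0) (l : ℕ) :
    ‖dworkEps p γ l‖ ≤ ((p : ℝ)⁻¹) ^ l := by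
  have hp : 1 < p := (Fact.out : p.Prime).one_lt
  have hpR : (1 : ℝ) < p := by exact_mod_cast hp
  have hn : 0 < ‖γ‖ := norm_pos_iff.2 h0
  rw [dworkEps, norm_div, norm_mul, norm_pow, norm_pow, norm_prime_cast (p := p),
    div_le_iff₀ (by positivity)]
  calc ((p : ℝ)⁻¹) ^ l * ‖gammaSum p γ l‖
      ≤ ((p : ℝ)⁻¹) ^ l * (‖γ‖ ^ p ^ (l + 1) * (p : ℝ) ^ (l + 1)) := by
        gcongr; exact norm_gammaSum_le hρ hγ l
    _ = ((p : ℝ)⁻¹ ^ l * (p : ℝ) ^ l) * (((p : ℝ)⁻¹) ^ p ^ l * p) * ‖γ‖ ^ p ^ l := by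
        rw [pow_pow_succ_eq hp hρ]; ring
    _ = (((p : ℝ)⁻¹) ^ p ^ l * p) * ‖γ‖ ^ p ^ l := by
        rw [← mul_pow, inv_mul_cancel₀ (by positivity), one_pow, one_mul]
    _ ≤ ((p : ℝ)⁻¹) ^ l * ‖γ‖ ^ p ^ l := by
        gcongr
        have hl : l + 1 ≤ p ^ l := Nat.lt_pow_self hp
        calc ((p : ℝ)⁻¹) ^ p ^ l * p ≤ ((p : ℝ)⁻¹) ^ (l + 1) * p := by
              gcongr ?_ * _
              exact pow_le_pow_of_le_one (by positivity) (inv_le_one_of_one_le₀ hpR.le) hl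
          _ = ((p : ℝ)⁻¹) ^ l := by
              rw [pow_succ, mul_assoc, inv_mul_cancel₀ (by positivity), mul_one]

/-- The coefficients of `θ`, extended by zero to negative indices. -/
noncomputable def thetaCoeff (p : ℕ) {K : Type*} [Field K] [CharZero K] (γ : K) (z : ℤ) : K :=
  if 0 ≤ z then PowerSeries.coeff z.toNat (theta p γ) else 0

variable [CharZero K]

theorem thetaCoeff_natCast {p : ℕ} {K : Type*} [Field K] [CharZero K] (γ : K) (k : ℕ) :
    thetaCoeff p γ k = PowerSeries.coeff k (theta p γ) := by
  simp [thetaCoeff]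

theorem thetaCoeff_of_neg {p : ℕ} {K : Type*} [Field K] [CharZero K] (γ : K) {z : ℤ} (hz : z < 0) : thetaCoeff p γ z = 0 :=
  if_neg (by omega)

theorem coeff_theta {p : ℕ} {K : Type*} [Field K] [CharZero K] (γ : K) (k : ℕ) :
    PowerSeries.coeff k (theta p γ) =
      γ ^ k * ((PowerSeries.coeff k (artinHasse p) : ℚ) : K) := by
  rw [theta, PowerSeries.coeff_rescale, PowerSeries.coeff_map, eq_ratCast]

theorem norm_ratCast_eq {p : ℕ} [Fact p.Prime] {K : Type*} [NormedField K] [NormedAlgebra ℚ_[p] K] (q : ℚ) : ‖(q : K)‖ = ‖(q : ℚ_[p])‖ := by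
  rw [← map_ratCast (algebraMap ℚ_[p] K), norm_algebraMap']

theorem norm_coeff_theta_le (γ : K) (k : ℕ) :
    ‖PowerSeries.coeff k (theta p γ)‖ ≤ ‖γ‖ ^ k := by
  rw [coeff_theta, norm_mul, norm_pow, norm_ratCast_eq (p := p)]
  exact mul_le_of_le_one_right (by positivity) (norm_coeff_artinHasse_le_one k)

theorem norm_coeff_theta_eq (γ : K) {k : ℕ} (hk : k < p) :
    ‖PowerSeries.coeff k (theta p γ)‖ = ‖γ‖ ^ k := by
  rw [coeff_theta, norm_mul, norm_pow, norm_ratCast_eq (p := p), norm_coeff_artinHasse_eq_one hk,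
    mul_one]

theorem norm_thetaCoeff_sub_le (γ : K) (a k : ℕ) :
    ‖γ‖ ^ k * ‖thetaCoeff p γ ((a : ℤ) - k)‖ ≤ ‖γ‖ ^ a := by
  obtain h | h := le_or_gt k a
  · obtain ⟨j, rfl⟩ := Nat.exists_eq_add_of_le h
    rw [show ((k + j : ℕ) : ℤ) - k = (j : ℕ) by push_cast; ring, thetaCoeff_natCast, pow_add]
    gcongr
    exact norm_coeff_theta_le γ j
  · rw [thetaCoeff_of_neg γ (by omega), norm_zero, mul_zero]
    positivity

theorem mul_coeff_theta {p : ℕ} [Fact p.Prime] {K : Type*} [Field K] [CharZero K] (γ : K) (k : ℕ) :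
    (k : K) * PowerSeries.coeff k (theta p γ) =
      ∑ l ∈ Finset.range (k + 1), γ ^ p ^ l * thetaCoeff p γ ((k : ℤ) - (p : ℤ) ^ l) := by
  have h := congrArg (fun q : ℚ => γ ^ k * (q : K)) (coeff_artinHasse_mul (p := p) k)
  push_cast at h
  rw [coeff_theta, mul_left_comm, h, Finset.mul_sum]
  refine Finset.sum_congr rfl fun l _ => ?_
  split_ifs with hl
  · obtain ⟨j, rfl⟩ := Nat.exists_eq_add_of_le hl
    rw [show ((p ^ l + j : ℕ) : ℤ) - (p : ℤ) ^ l = (j : ℕ) by push_cast; ring, thetaCoeff_natCast,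
      coeff_theta, Nat.add_sub_cancel_left, pow_add]
    ring
  · rw [thetaCoeff_of_neg]
    · simp
    · have : (k : ℤ) < ((p ^ l : ℕ) : ℤ) := by exact_mod_cast not_le.1 hl
      push_cast at this
      omega

/-- The coefficientwise form of `t θ'(t) = θ(t) (t h'(t) - t (h(t ^ p))')`. -/
theorem mul_thetaCoeff (γ : K) (z : ℤ) :
    (z : K) * thetaCoeff p γ z =
      ∑' l : ℕ, (p : K) ^ l * gammaSum p γ l * thetaCoeff p γ (z - (p : ℤ) ^ l) -
      ∑' l : ℕ, (p : K) ^ (l + 1) * gammaSum p γ l * thetaCoeff p γ (z - (p : ℤ) ^ (l + 1)) := by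
  have hp : 1 < p := (Fact.out : p.Prime).one_lt
  obtain hz | hz := lt_or_ge z 0
  · have h0 : ∀ l : ℕ, thetaCoeff p γ (z - (p : ℤ) ^ l) = 0 := fun l =>
      thetaCoeff_of_neg γ (by have : (0 : ℤ) ≤ (p : ℤ) ^ l := by positivity
                              omega)
    simp [h0, thetaCoeff_of_neg γ hz]
  · obtain ⟨k, rfl⟩ := Int.eq_ofNat_of_zero_le hz
    have h0 : ∀ l : ℕ, k < l → thetaCoeff p γ ((k : ℤ) - (p : ℤ) ^ l) = 0 := fun l hl =>
      thetaCoeff_of_neg γ (by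
        have : (l : ℤ) < ((p ^ l : ℕ) : ℤ) := by exact_mod_cast Nat.lt_pow_self hp
        push_cast at this
        omega)
    -- The lengths k + 2 and k + 1 pair the term l + 1 of the first sum with the term l of the
    -- second, leaving the term l = 0 on its own.
    rw [tsum_eq_sum (s := Finset.range (k + 2)) fun l hl => by
        rw [h0 l (by simp at hl; omega), mul_zero],
      tsum_eq_sum (s := Finset.range (k + 1)) fun l hl => by
        rw [h0 (l + 1) (by simp at hl; omega), mul_zero],
      Finset.sum_range_succ' _ (k + 1), add_sub_right_comm, ← Finset.sum_sub_distrib,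
      Int.cast_natCast, thetaCoeff_natCast, mul_coeff_theta]
    have hext : ∑ l ∈ Finset.range (k + 1), γ ^ p ^ l * thetaCoeff p γ ((k : ℤ) - (p : ℤ) ^ l) =
        ∑ l ∈ Finset.range (k + 2), γ ^ p ^ l * thetaCoeff p γ ((k : ℤ) - (p : ℤ) ^ l) := by
      rw [Finset.sum_range_succ _ (k + 1), h0 (k + 1) (by omega), mul_zero, add_zero]
    rw [hext, Finset.sum_range_succ' _ (k + 1)]
    congr 1
    · refine Finset.sum_congr rfl fun l _ => ?_
      have hp0 : (p : K) ≠ 0 := prime_cast_ne_zero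
      -- The paired terms differ by p^{l+1}(γ_{l+1} - γ_l) = γ^{p^{l+1}}, which is the coefficient
      -- in the recurrence for θ.
      have hg : gammaSum p γ (l + 1) = gammaSum p γ l + γ ^ p ^ (l + 1) / (p : K) ^ (l + 1) := by
        rw [gammaSum, Finset.sum_range_succ, gammaSum]
      rw [hg]
      field_simp
      ring
    · simp [gammaSum]

end Coefficients

end DworkDiag

namespace DworkDiag

open Filter Topology ZeroAtInfty

/-! ### Null families indexed by a discrete type -/

section NullFamilies

theorem tendsto_cofinite_zero_iff {I E : Type*} [SeminormedAddCommGroup E] {f : I → E} :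
    Tendsto f cofinite (𝓝 0) ↔ ∀ δ > 0, {v | δ ≤ ‖f v‖}.Finite := by
  rw [Metric.tendsto_nhds]
  refine forall₂_congr fun δ _ => ?_
  rw [eventually_cofinite]
  simp only [dist_zero_right, not_lt]

variable {I K : Type*} [TopologicalSpace I] [NormedField K]

theorem norm_apply_le (A : C₀(I, K)) (v : I) : ‖A v‖ ≤ ‖A‖ := by
  rw [← ZeroAtInftyContinuousMap.norm_toBCF_eq_norm]
  exact A.toBCF.norm_coe_le_norm v

theorem norm_le_of_forall_le {A : C₀(I, K)} {C : ℝ} (hC : 0 ≤ C) (h : ∀ v, ‖A v‖ ≤ C) :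
    ‖A‖ ≤ C := by
  rw [← ZeroAtInftyContinuousMap.norm_toBCF_eq_norm]
  exact (BoundedContinuousFunction.norm_le hC).2 h

instance [IsUltrametricDist K] : IsUltrametricDist C₀(I, K) :=
  IsUltrametricDist.isUltrametricDist_of_forall_norm_add_le_max_norm fun A B =>
    norm_le_of_forall_le ((norm_nonneg A).trans (le_max_left _ _)) fun v =>
      (IsUltrametricDist.norm_add_le_max _ _).trans
        (max_le_max (norm_apply_le A v) (norm_apply_le B v))

/-- Evaluation at a point of `I`. -/
noncomputable def evalCLM (v : I) : C₀(I, K) →L[K] K :=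
  LinearMap.mkContinuous
    { toFun := fun A => A v
      map_add' := fun _ _ => rfl
      map_smul' := fun _ _ => rfl } 1 fun A => by simpa using norm_apply_le A v

@[simp]
theorem evalCLM_apply (v : I) (A : C₀(I, K)) : evalCLM v A = A v := rfl

variable [DiscreteTopology I]

/-- The element of `C₀(I, K)` given by a family tending to zero along the cofinite filter. -/
def ofTendsto (f : I → K) (hf : Tendsto f cofinite (𝓝 0)) : C₀(I, K) where
  toFun := f
  continuous_toFun := continuous_of_discreteTopology
  zero_at_infty' := by rwa [cocompact_eq_cofinite]

@[simp]
theorem ofTendsto_apply (f : I → K) (hf : Tendsto f cofinite (𝓝 0)) (v : I) :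
    ofTendsto f hf v = f v := rfl

theorem tendsto_apply (A : C₀(I, K)) : Tendsto A cofinite (𝓝 0) := by
  rw [← cocompact_eq_cofinite]
  exact A.zero_at_infty'

open Classical in
/-- The family supported at `u` with value `1`. -/
noncomputable def single (K : Type*) [NormedField K] (u : I) : C₀(I, K) :=
  ofTendsto (fun v => if v = u then 1 else 0) <| by
    refine tendsto_cofinite_zero_iff.2 fun δ hδ => (Set.finite_singleton u).subset fun v hv => ?_
    by_contra h
    have h' : v ≠ u := h
    simp only [Set.mem_ofPred_eq, if_neg h', norm_zero] at hv
    exact hv.not_gt hδ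

open Classical in
theorem single_apply (u v : I) : single K u v = if v = u then 1 else 0 := rfl

theorem norm_single_le (u : I) : ‖single K u‖ ≤ 1 := by
  classical
  refine norm_le_of_forall_le zero_le_one fun v => ?_
  rw [single_apply]
  split_ifs <;> simp

theorem norm_sub_sum_single_le (A : C₀(I, K)) {δ : ℝ} (hδ : 0 ≤ δ) {F : Finset I}
    (hF : ∀ v, δ < ‖A v‖ → v ∈ F) : ‖A - ∑ u ∈ F, A u • single K u‖ ≤ δ := by
  classical
  refine norm_le_of_forall_le hδ fun v => ?_
  have hsum : (∑ u ∈ F, A u • single K u) v = ∑ u ∈ F, A u * (if v = u then 1 else 0) := by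
    rw [← evalCLM_apply (K := K), map_sum]
    rfl
  rw [ZeroAtInftyContinuousMap.sub_apply, hsum]
  simp only [mul_ite, mul_one, mul_zero, Finset.sum_ite_eq]
  split_ifs with hv
  · simpa using hδ
  · rw [sub_zero]
    exact not_lt.1 fun h => hv (hF v h)

theorem exists_norm_sub_sum_single_le (A : C₀(I, K)) {δ : ℝ} (hδ : 0 < δ) :
    ∃ F : Finset I, ‖A - ∑ u ∈ F, A u • single K u‖ ≤ δ :=
  ⟨(tendsto_cofinite_zero_iff.1 (tendsto_apply A) δ hδ).toFinset,
    norm_sub_sum_single_le A hδ.le fun v hv => by simpa using hv.le⟩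

/-- Finite combinations of the `single` families are dense. Operator identities therefore only need
to be checked on monomials. -/
theorem clm_ext {E : Type*} [NormedAddCommGroup E] [NormedSpace K E] {T T' : C₀(I, K) →L[K] E}
    (h : ∀ u, T (single K u) = T' (single K u)) : T = T' := by
  refine ContinuousLinearMap.ext fun A => ?_
  have hclosed : IsClosed {B | T B = T' B} := isClosed_eq T.continuous T'.continuous
  refine hclosed.closure_subset (Metric.mem_closure_iff.2 fun δ hδ => ?_)
  obtain ⟨F, hF⟩ := exists_norm_sub_sum_single_le A (half_pos hδ)
  refine ⟨_, ?_, by rw [dist_eq_norm]; exact hF.trans_lt (half_lt_self hδ)⟩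
  simp only [Set.mem_ofPred_eq, map_sum, map_smul, h]

end NullFamilies

end DworkDiag

namespace DworkDiag

open Filter Topology ZeroAtInfty

/-! ### Dwork's operators on normalized coordinates -/

/-- The data that determine Dwork's operators in normalized coordinates: a zero `γ` of
`∑ t ^ p ^ i / p ^ i`, and a finite set `S` of points with coordinates `r s` and a map `σ` with
`p r s = r (σ s) + m s`. -/
structure DworkData (p n : ℕ) (S K : Type*) [NormedField K] where
  γ : K
  γ_ne_zero : γ ≠ 0
  norm_γ_pow : ‖γ‖ ^ (p - 1) = (p : ℝ)⁻¹
  hasSum_γ : HasSum (fun i : ℕ => γ ^ p ^ i / (p : K) ^ i) 0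
  r : S → Fin n → K
  norm_r_le : ∀ s j, ‖r s j‖ ≤ 1
  σ : S → S
  m : S → Fin n → ℕ
  m_lt : ∀ s j, m s j < p
  mul_r : ∀ s j, (p : K) * r s j = r (σ s) j + m s j

/-! ### Translations of the index set S × ℕⁿ -/

section Translation

variable {S : Type*} {n : ℕ}

/-- Translation by `t` in the direction `j`. -/
def translate (j : Fin n) (t : ℕ) (v : S × (Fin n → ℕ)) : S × (Fin n → ℕ) :=
  (v.1, v.2 + Pi.single j t)

theorem translate_sub {j : Fin n} {t : ℕ} {v : S × (Fin n → ℕ)} (h : t ≤ v.2 j) :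
    translate j t (v.1, v.2 - Pi.single j t) = v := by
  have hle : Pi.single j t ≤ v.2 := by
    intro i
    obtain rfl | hi := eq_or_ne i j
    · simpa using h
    · simp [hi]
  exact Prod.ext rfl (tsub_add_cancel_of_le hle)

theorem eq_translate_iff {j : Fin n} {t : ℕ} {u v : S × (Fin n → ℕ)} :
    v = translate j t u ↔ t ≤ v.2 j ∧ (v.1, v.2 - Pi.single j t) = u := by
  constructor
  · rintro rfl
    exact ⟨by simp [translate], by simp [translate]⟩
  · rintro ⟨h, rfl⟩
    exact (translate_sub h).symm

theorem tendsto_sum_snd [Finite S] :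
    Tendsto (fun v : S × (Fin n → ℕ) => ∑ j, v.2 j) cofinite atTop := by
  refine tendsto_atTop.2 fun N => ?_
  rw [eventually_cofinite]
  refine ((Set.finite_univ (α := S)).prod (Set.finite_Iic fun _ : Fin n => N)).subset ?_
  rintro ⟨s, k⟩ h
  simp only [Set.mem_ofPred_eq, not_le] at h
  exact ⟨trivial, fun j => (Finset.single_le_sum (fun _ _ => Nat.zero_le _)
    (Finset.mem_univ j)).trans h.le⟩

end Translation

namespace DworkData

set_option linter.unusedSectionVars false

variable {p : ℕ} [Fact p.Prime] {n : ℕ} {S : Type*} {K : Type*}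
  [NormedField K] [NormedAlgebra ℚ_[p] K] [IsUltrametricDist K] [CompleteSpace K]

theorem inv_prime_nonneg : (0 : ℝ) ≤ (p : ℝ)⁻¹ := by positivity

theorem inv_prime_lt_one : (p : ℝ)⁻¹ < 1 :=
  inv_lt_one_of_one_lt₀ (by exact_mod_cast (Fact.out : p.Prime).one_lt)

variable (d : DworkData p n S K)

theorem norm_eps_le (l : ℕ) : ‖dworkEps p d.γ l‖ ≤ ((p : ℝ)⁻¹) ^ l :=
  norm_dworkEps_le d.γ_ne_zero d.norm_γ_pow d.hasSum_γ l

theorem norm_eps_le_one (l : ℕ) : ‖dworkEps p d.γ l‖ ≤ 1 :=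
  (d.norm_eps_le l).trans (pow_le_one₀ inv_prime_nonneg inv_prime_lt_one.le)

theorem norm_eps_succ_le (l : ℕ) : ‖dworkEps p d.γ (l + 1)‖ ≤ (p : ℝ)⁻¹ :=
  (d.norm_eps_le (l + 1)).trans
    (pow_le_of_le_one inv_prime_nonneg inv_prime_lt_one.le (by omega))

theorem norm_γ_le_one : ‖d.γ‖ ≤ 1 := by
  by_contra! h
  have := one_le_pow₀ (n := p - 1) h.le
  rw [d.norm_γ_pow] at this
  exact this.not_gt inv_prime_lt_one

theorem norm_r_add_le (s : S) (j : Fin n) (k : ℕ) : ‖d.r s j + k‖ ≤ 1 :=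
  norm_add_le_of_le (d.norm_r_le s j) (IsUltrametricDist.norm_natCast_le_one K k)

/-- The terms of the operator of multiplication by `E_j H`. -/
noncomputable def diffTerm (j : Fin n) (A : S × (Fin n → ℕ) → K) (v : S × (Fin n → ℕ)) (l : ℕ) : K :=
  if p ^ l ≤ v.2 j then dworkEps p d.γ l * A (v.1, v.2 - Pi.single j (p ^ l)) else 0

/-- The operator `E_j + E_j H`, where `E_j` is dual to the basis `w`, in coordinates. -/
noncomputable def diffFun (j : Fin n) (A : S × (Fin n → ℕ) → K) (v : S × (Fin n → ℕ)) : K :=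
  (d.r v.1 j + v.2 j) * A v + ∑' l, d.diffTerm j A v l

theorem summable_diffTerm (j : Fin n) (A : S × (Fin n → ℕ) → K) (v : S × (Fin n → ℕ)) :
    Summable (d.diffTerm j A v) := by
  refine summable_of_ne_finset_zero (s := Finset.range (v.2 j)) fun l hl => if_neg fun h => ?_
  have : l < p ^ l := Nat.lt_pow_self (Fact.out : p.Prime).one_lt
  simp at hl
  omega

variable [TopologicalSpace S] [DiscreteTopology S]

theorem norm_diffTerm_le (j : Fin n) (A : C₀(S × (Fin n → ℕ), K)) (v : S × (Fin n → ℕ)) (l : ℕ) :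
    ‖d.diffTerm j A v l‖ ≤ ((p : ℝ)⁻¹) ^ l * ‖A‖ := by
  rw [diffTerm]
  split_ifs
  · rw [norm_mul]
    exact mul_le_mul (d.norm_eps_le l) (norm_apply_le _ _) (norm_nonneg _)
      (pow_nonneg inv_prime_nonneg _)
  · rw [norm_zero]
    exact mul_nonneg (pow_nonneg inv_prime_nonneg _) (norm_nonneg _)

theorem tendsto_diffTerm (j : Fin n) (A : C₀(S × (Fin n → ℕ), K)) (l : ℕ) :
    Tendsto (fun v => d.diffTerm j A v l) cofinite (𝓝 0) := by
  refine tendsto_cofinite_zero_iff.2 fun δ hδ => ?_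
  refine (((tendsto_cofinite_zero_iff.1 (tendsto_apply A) δ hδ)).image
    (translate j (p ^ l))).subset fun v hv => ?_
  simp only [Set.mem_ofPred_eq, diffTerm] at hv
  split_ifs at hv with h
  · refine ⟨(v.1, v.2 - Pi.single j (p ^ l)), ?_, translate_sub h⟩
    refine hv.trans ?_
    rw [norm_mul]
    exact mul_le_of_le_one_left (norm_nonneg _) (d.norm_eps_le_one l)
  · rw [norm_zero] at hv
    exact absurd hδ hv.not_gt

/-- For fixed l the term is a bounded multiple of a translate of A, hence null; the geometric bound
in l allows the limit to pass through the sum. -/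
theorem tendsto_diffFun (j : Fin n) (A : C₀(S × (Fin n → ℕ), K)) :
    Tendsto (d.diffFun j A) cofinite (𝓝 0) := by
  rw [← add_zero (0 : K)]
  refine Tendsto.add ?_ ?_
  · refine squeeze_zero_norm (fun v => ?_) (by simpa using (tendsto_apply A).norm)
    rw [norm_mul]
    exact mul_le_of_le_one_left (norm_nonneg _) (d.norm_r_add_le _ _ _)
  · have := tendsto_tsum_of_dominated_convergence (𝓕 := cofinite)
      (f := fun (v : S × (Fin n → ℕ)) l => d.diffTerm j A v l) (g := fun _ => 0)
      ((summable_geometric_of_lt_one inv_prime_nonneg inv_prime_lt_one).mul_right ‖A‖)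
      (d.tendsto_diffTerm j A) (Eventually.of_forall fun v l => d.norm_diffTerm_le j A v l)
    simpa using this

theorem norm_diffFun_le (j : Fin n) (A : C₀(S × (Fin n → ℕ), K)) (v : S × (Fin n → ℕ)) :
    ‖d.diffFun j A v‖ ≤ ‖A‖ := by
  refine norm_add_le_of_le ?_ ?_
  · rw [norm_mul]
    exact (mul_le_of_le_one_left (norm_nonneg _) (d.norm_r_add_le _ _ _)).trans
      (norm_apply_le A v)
  · refine IsUltrametricDist.norm_tsum_le_of_forall_le_of_nonneg (norm_nonneg A) fun l => ?_
    exact (d.norm_diffTerm_le j A v l).trans (mul_le_of_le_one_left (norm_nonneg A)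
      (pow_le_one₀ inv_prime_nonneg inv_prime_lt_one.le))

/-- The operator `E_j + E_j H` on null families. -/
noncomputable def diffOp (j : Fin n) : C₀(S × (Fin n → ℕ), K) →L[K] C₀(S × (Fin n → ℕ), K) :=
  LinearMap.mkContinuous
    { toFun := fun A => ofTendsto _ (d.tendsto_diffFun j A)
      map_add' := fun A B => by
        ext v
        simp only [ofTendsto_apply, ZeroAtInftyContinuousMap.add_apply, diffFun]
        have : d.diffTerm j (A + B) v = fun l => d.diffTerm j A v l + d.diffTerm j B v l := by
          funext l
          simp only [diffTerm, Pi.add_apply]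
          split_ifs
          · ring
          · simp
        rw [ZeroAtInftyContinuousMap.coe_add, this,
          (d.summable_diffTerm j A v).tsum_add (d.summable_diffTerm j B v)]
        ring
      map_smul' := fun c A => by
        ext v
        simp only [ofTendsto_apply, ZeroAtInftyContinuousMap.smul_apply, diffFun]
        have : d.diffTerm j (c • A) v = fun l => c * d.diffTerm j A v l := by
          funext l
          simp only [diffTerm, Pi.smul_apply, smul_eq_mul]
          split_ifs
          · ring
          · simp
        rw [ZeroAtInftyContinuousMap.coe_smul, this, tsum_mul_left]
        simp only [smul_eq_mul, RingHom.id_apply]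
        ring } 1 fun A => by
      rw [one_mul]
      exact norm_le_of_forall_le (norm_nonneg A) (d.norm_diffFun_le j A)

theorem diffOp_apply (j : Fin n) (A : C₀(S × (Fin n → ℕ), K)) (v : S × (Fin n → ℕ)) :
    d.diffOp j A v = (d.r v.1 j + v.2 j) * A v + ∑' l, d.diffTerm j A v l := rfl

theorem summable_eps_single (j : Fin n) (u : S × (Fin n → ℕ)) :
    Summable fun l => dworkEps p d.γ l • single K (translate j (p ^ l) u) := by
  refine Summable.of_norm_bounded 
    (summable_geometric_of_lt_one (inv_prime_nonneg (p := p)) inv_prime_lt_one) fun l => ?_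
  rw [norm_smul]
  exact (mul_le_of_le_one_right (norm_nonneg _) (norm_single_le _)).trans (d.norm_eps_le l)

theorem diffOp_single (j : Fin n) (u : S × (Fin n → ℕ)) :
    d.diffOp j (single K u) = (d.r u.1 j + u.2 j) • single K u +
      ∑' l, dworkEps p d.γ l • single K (translate j (p ^ l) u) := by
  classical
  ext v
  rw [diffOp_apply, ZeroAtInftyContinuousMap.add_apply, ← evalCLM_apply v (∑' l, _),
    (evalCLM v).map_tsum (d.summable_eps_single j u)]
  congr 1
  · rw [ZeroAtInftyContinuousMap.smul_apply, smul_eq_mul, single_apply]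
    split_ifs with h
    · rw [h]
    · simp
  · refine tsum_congr fun l => ?_
    rw [map_smul, evalCLM_apply, smul_eq_mul, diffTerm, single_apply, single_apply]
    simp only [eq_translate_iff]
    by_cases h1 : p ^ l ≤ v.2 j <;> simp [h1]

theorem map_diffOp_single {E : Type*} [NormedAddCommGroup E] [NormedSpace K E]
    (T : C₀(S × (Fin n → ℕ), K) →L[K] E) (j : Fin n) (u : S × (Fin n → ℕ)) :
    T (d.diffOp j (single K u)) = (d.r u.1 j + u.2 j) • T (single K u) +
      ∑' l, dworkEps p d.γ l • T (single K (translate j (p ^ l) u)) := by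
  rw [diffOp_single, map_add, map_smul, T.map_tsum (d.summable_eps_single j u)]
  simp only [map_smul]

/-! ### The operator `α` -/

variable [CharZero K]

/-- The matrix coefficients of `α` in normalized coordinates. -/
noncomputable def alphaCoeff (v : S × (Fin n → ℕ)) (k : Fin n → ℕ) : K :=
  d.γ ^ (∑ i, k i) / d.γ ^ (∑ i, v.2 i) *
    ∏ i, thetaCoeff p d.γ (((d.m v.1 i + p * v.2 i : ℕ) : ℤ) - k i)

/-- The bound |θ_a| ≤ |γ|^a absorbs |γ|^{|k|} and leaves |γ|^{|m| + p|v|}. Dividing by |γ|^{|v|} and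
using |γ|^{p-1} = 1/p turns the excess (p-1)|v| into p^{-|v|}. This decay makes α preserve null
families and makes the k = 0 coefficient dominant. -/
theorem norm_alphaCoeff_le (v : S × (Fin n → ℕ)) (k : Fin n → ℕ) :
    ‖d.alphaCoeff v k‖ ≤ ‖d.γ‖ ^ (∑ i, d.m v.1 i) * ((p : ℝ)⁻¹) ^ (∑ i, v.2 i) := by
  have hn : 0 < ‖d.γ‖ := norm_pos_iff.2 d.γ_ne_zero
  have hp : 1 ≤ p := (Fact.out : p.Prime).one_le
  have h1 : ‖d.γ‖ ^ (∑ i, k i) * ‖∏ i, thetaCoeff p d.γ (((d.m v.1 i + p * v.2 i : ℕ) : ℤ) - k i)‖ ≤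
      ‖d.γ‖ ^ (∑ i, (d.m v.1 i + p * v.2 i)) := by
    rw [norm_prod, ← Finset.prod_pow_eq_pow_sum, ← Finset.prod_pow_eq_pow_sum,
      ← Finset.prod_mul_distrib]
    exact Finset.prod_le_prod (fun i _ => by positivity) fun i _ => norm_thetaCoeff_sub_le _ _ _
  rw [alphaCoeff, norm_mul, norm_div, norm_pow, norm_pow, div_mul_eq_mul_div,
    div_le_iff₀ (by positivity)]
  refine h1.trans_eq ?_
  rw [Finset.sum_add_distrib, pow_add, ← Finset.mul_sum, ← d.norm_γ_pow, ← pow_mul, mul_assoc,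
    ← pow_add]
  obtain ⟨q, rfl⟩ : ∃ q, p = q + 1 := ⟨p - 1, by omega⟩
  simp only [Nat.add_sub_cancel]
  ring

/-- The operator `α` in normalized coordinates. -/
noncomputable def alphaFun (A : S × (Fin n → ℕ) → K) (v : S × (Fin n → ℕ)) : K :=
  ∑ k ∈ Finset.Iic (fun i => d.m v.1 i + p * v.2 i), d.alphaCoeff v k * A (d.σ v.1, k)

theorem norm_alphaFun_le (A : C₀(S × (Fin n → ℕ), K)) (v : S × (Fin n → ℕ)) :
    ‖d.alphaFun A v‖ ≤ ((p : ℝ)⁻¹) ^ (∑ i, v.2 i) * ‖A‖ := by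
  refine IsUltrametricDist.norm_sum_le_of_forall_le_of_nonneg
    (mul_nonneg (pow_nonneg inv_prime_nonneg _) (norm_nonneg _)) fun k _ => ?_
  rw [norm_mul]
  refine mul_le_mul ((d.norm_alphaCoeff_le v k).trans ?_) (norm_apply_le _ _) (norm_nonneg _)
    (pow_nonneg inv_prime_nonneg _)
  exact mul_le_of_le_one_left (pow_nonneg inv_prime_nonneg _)
    (pow_le_one₀ (norm_nonneg _) d.norm_γ_le_one)

theorem tendsto_alphaFun [Finite S] (A : C₀(S × (Fin n → ℕ), K)) :
    Tendsto (d.alphaFun A) cofinite (𝓝 0) := by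
  refine squeeze_zero_norm (d.norm_alphaFun_le A) ?_
  rw [← zero_mul ‖A‖]
  exact ((tendsto_pow_atTop_nhds_zero_of_lt_one inv_prime_nonneg inv_prime_lt_one).comp
    tendsto_sum_snd).mul_const _

/-- The operator `α` on null families. -/
noncomputable def alphaOp [Finite S] : C₀(S × (Fin n → ℕ), K) →L[K] C₀(S × (Fin n → ℕ), K) :=
  LinearMap.mkContinuous
    { toFun := fun A => ofTendsto _ (d.tendsto_alphaFun A)
      map_add' := fun A B => by
        ext v
        simp only [ofTendsto_apply, ZeroAtInftyContinuousMap.add_apply, alphaFun, mul_add,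
          Finset.sum_add_distrib]
      map_smul' := fun c A => by
        ext v
        simp only [ofTendsto_apply, ZeroAtInftyContinuousMap.smul_apply, alphaFun, smul_eq_mul,
          Finset.mul_sum, RingHom.id_apply, mul_left_comm] } 1 fun A => by
      rw [one_mul]
      refine norm_le_of_forall_le (norm_nonneg A) fun v => (d.norm_alphaFun_le A v).trans ?_
      exact mul_le_of_le_one_left (norm_nonneg _)
        (pow_le_one₀ inv_prime_nonneg inv_prime_lt_one.le)

theorem alphaOp_apply [Finite S] (A : C₀(S × (Fin n → ℕ), K)) (v : S × (Fin n → ℕ)) :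
    d.alphaOp A v = d.alphaFun A v := rfl

open Classical in
theorem alphaOp_single_apply [Finite S] (u v : S × (Fin n → ℕ)) :
    d.alphaOp (single K u) v = if d.σ v.1 = u.1 then d.alphaCoeff v u.2 else 0 := by
  rw [alphaOp_apply, alphaFun]
  simp only [single_apply, Prod.ext_iff, mul_ite, mul_one, mul_zero]
  split_ifs with h
  · simp only [h, true_and, Finset.sum_ite_eq', Finset.mem_Iic]
    refine ite_eq_left_iff.2 fun hle => ?_
    simp only [Pi.le_def, not_forall, not_le] at hle
    obtain ⟨i, hi⟩ := hle
    rw [alphaCoeff, Finset.prod_eq_zero (Finset.mem_univ i), mul_zero]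
    exact thetaCoeff_of_neg _ (by omega)
  · simp [h]

end DworkData

end DworkDiag

namespace DworkDiag

open Filter Topology ZeroAtInfty

namespace DworkData

set_option linter.unusedSectionVars false

variable {p : ℕ} [Fact p.Prime] {n : ℕ} {S : Type*} {K : Type*}
  [NormedField K] [NormedAlgebra ℚ_[p] K] [IsUltrametricDist K] [CompleteSpace K]
  (d : DworkData p n S K) [TopologicalSpace S] [DiscreteTopology S]

/-! ### Commutation of `α` with the differential operators -/

section Commutation

variable [CharZero K]

theorem sum_add_single (k : Fin n → ℕ) (j : Fin n) (t : ℕ) :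
    ∑ i, (k + Pi.single j t : Fin n → ℕ) i = ∑ i, k i + t := by
  simp only [Pi.add_apply, Finset.sum_add_distrib, Finset.sum_pi_single', Finset.mem_univ, if_true]

/-- The coefficients of `α` without the factor in the direction `j`. -/
noncomputable def alphaCofactor (v : S × (Fin n → ℕ)) (k : Fin n → ℕ) (j : Fin n) : K :=
  d.γ ^ (∑ i, k i) / d.γ ^ (∑ i, v.2 i) *
    ∏ i ∈ Finset.univ.erase j, thetaCoeff p d.γ (((d.m v.1 i + p * v.2 i : ℕ) : ℤ) - k i)

theorem alphaCoeff_eq (v : S × (Fin n → ℕ)) (k : Fin n → ℕ) (j : Fin n) :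
    d.alphaCoeff v k = d.alphaCofactor v k j *
      thetaCoeff p d.γ (((d.m v.1 j + p * v.2 j : ℕ) : ℤ) - k j) := by
  rw [alphaCoeff, alphaCofactor, ← Finset.prod_erase_mul _ _ (Finset.mem_univ j), mul_assoc]

theorem alphaCoeff_add_single (v : S × (Fin n → ℕ)) (k : Fin n → ℕ) (j : Fin n) (t : ℕ) :
    d.alphaCoeff v (k + Pi.single j t) = d.alphaCofactor v k j * d.γ ^ t *
      thetaCoeff p d.γ (((d.m v.1 j + p * v.2 j : ℕ) : ℤ) - k j - t) := by
  rw [d.alphaCoeff_eq v _ j, alphaCofactor, alphaCofactor, sum_add_single, pow_add]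
  have h1 : ∏ i ∈ Finset.univ.erase j, thetaCoeff p d.γ
      (((d.m v.1 i + p * v.2 i : ℕ) : ℤ) - ((k + Pi.single j t : Fin n → ℕ) i : ℕ)) =
      ∏ i ∈ Finset.univ.erase j, thetaCoeff p d.γ (((d.m v.1 i + p * v.2 i : ℕ) : ℤ) - k i) :=
    Finset.prod_congr rfl fun i hi => by simp [Finset.ne_of_mem_erase hi]
  rw [h1]
  simp only [Pi.add_apply, Pi.single_eq_same, Nat.cast_add, sub_sub]
  ring

theorem alphaCoeff_sub_single (v : S × (Fin n → ℕ)) (k : Fin n → ℕ) (j : Fin n) {t : ℕ}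
    (ht : t ≤ v.2 j) :
    d.alphaCoeff (v.1, v.2 - Pi.single j t) k = d.alphaCofactor v k j * d.γ ^ t *
      thetaCoeff p d.γ (((d.m v.1 j + p * v.2 j : ℕ) : ℤ) - k j - p * t) := by
  have hle := translate_sub ht
  have hv : v.2 = (v.2 - Pi.single j t) + Pi.single j t := (congrArg Prod.snd hle).symm
  have hsum : ∑ i, v.2 i = ∑ i, (v.2 - Pi.single j t : Fin n → ℕ) i + t := by
    conv_lhs => rw [hv, sum_add_single]
  have hγ := d.γ_ne_zero
  rw [d.alphaCoeff_eq _ _ j, alphaCofactor, alphaCofactor, hsum, pow_add]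
  have h1 : ∏ i ∈ Finset.univ.erase j, thetaCoeff p d.γ
      (((d.m v.1 i + p * (v.2 - Pi.single j t : Fin n → ℕ) i : ℕ) : ℤ) - k i) =
      ∏ i ∈ Finset.univ.erase j, thetaCoeff p d.γ (((d.m v.1 i + p * v.2 i : ℕ) : ℤ) - k i) :=
    Finset.prod_congr rfl fun i hi => by simp [Finset.ne_of_mem_erase hi]
  have h2 : (((d.m v.1 j + p * (v.2 - Pi.single j t : Fin n → ℕ) j : ℕ) : ℤ) - k j) =
      ((d.m v.1 j + p * v.2 j : ℕ) : ℤ) - k j - p * t := by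
    simp only [Pi.sub_apply, Pi.single_eq_same]
    push_cast [Nat.cast_sub ht]
    ring
  simp only [h1, h2]
  field_simp

/-- On matrix coefficients only the factor in direction j varies, and there the identity is the
differential equation of θ together with p r_s = r_{σ s} + m_s. -/
theorem alphaOp_diffOp [Finite S] (j : Fin n) (A : C₀(S × (Fin n → ℕ), K)) :
    d.alphaOp (d.diffOp j A) = (p : K) • d.diffOp j (d.alphaOp A) := by
  classical
  have key : d.alphaOp ∘L d.diffOp j = (p : K) • (d.diffOp j ∘L d.alphaOp) := by
    refine clm_ext fun u => ?_
    ext v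
    have h := d.map_diffOp_single ((evalCLM v) ∘L d.alphaOp) j u
    simp only [ContinuousLinearMap.comp_apply, evalCLM_apply, smul_eq_mul] at h
    rw [ContinuousLinearMap.comp_apply, h, smul_apply,
      ContinuousLinearMap.comp_apply, ZeroAtInftyContinuousMap.smul_apply, diffOp_apply, smul_eq_mul]
    simp only [alphaOp_single_apply, translate, diffTerm]
    by_cases hs : d.σ v.1 = u.1
    · simp only [hs, if_true, alphaCoeff_add_single]
      set b : ℤ := ((d.m v.1 j + p * v.2 j : ℕ) : ℤ) - u.2 j with hb
      have hγ := d.γ_ne_zero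
      have e1 : ∀ l, dworkEps p d.γ l * (d.alphaCofactor v u.2 j * d.γ ^ p ^ l *
          thetaCoeff p d.γ (b - (p ^ l : ℕ))) = d.alphaCofactor v u.2 j *
          ((p : K) ^ l * gammaSum p d.γ l * thetaCoeff p d.γ (b - (p : ℤ) ^ l)) := by
        intro l
        rw [dworkEps, Nat.cast_pow]
        field_simp
      have e2 : ∀ l, (if p ^ l ≤ v.2 j then dworkEps p d.γ l *
          d.alphaCoeff (v.1, v.2 - Pi.single j (p ^ l)) u.2 else 0) * p =
          d.alphaCofactor v u.2 j *
          ((p : K) ^ (l + 1) * gammaSum p d.γ l * thetaCoeff p d.γ (b - (p : ℤ) ^ (l + 1))) := by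
        intro l
        split_ifs with hl
        · rw [d.alphaCoeff_sub_single v u.2 j hl, dworkEps, ← hb, Nat.cast_pow, ← pow_succ']
          field_simp
          ring
        -- Where the left side is cut off, the right side vanishes too: p^l > v_j and m_j < p give
        -- m_j + p v_j < p^{l+1}, so the index of θ is negative.
        · rw [thetaCoeff_of_neg]
          · simp
          · have h1 : v.2 j + 1 ≤ p ^ l := not_le.1 hl
            have h2 : p * (v.2 j + 1) ≤ p * p ^ l := Nat.mul_le_mul_left p h1
            have h3 := d.m_lt v.1 j
            have h4 : d.m v.1 j + p * v.2 j < p ^ (l + 1) := by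
              rw [pow_succ']
              rw [mul_add, mul_one] at h2
              omega
            have h5 : ((d.m v.1 j + p * v.2 j : ℕ) : ℤ) < ((p ^ (l + 1) : ℕ) : ℤ) := by
              exact_mod_cast h4
            rw [Nat.cast_pow] at h5
            omega
      rw [mul_add, mul_comm (p : K) (∑' _, _), ← tsum_mul_right, tsum_congr e1, tsum_congr e2,
        tsum_mul_left, tsum_mul_left, d.alphaCoeff_eq v u.2 j, ← hb]
      have h1 := mul_thetaCoeff (p := p) d.γ b
      have h2 : (b : K) = d.m v.1 j + p * v.2 j - u.2 j := by rw [hb]; push_cast; ring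
      have h3 := d.mul_r v.1 j
      rw [hs] at h3
      rw [h2] at h1
      linear_combination (-d.alphaCofactor v u.2 j) * h1 -
        d.alphaCofactor v u.2 j * thetaCoeff p d.γ b * h3
    · simp [hs]
  exact congrArg (fun T : C₀(S × (Fin n → ℕ), K) →L[K] _ => T A) key

end Commutation

/-! ### Functionals vanishing on the images of the differential operators -/

section Functionals

/-- The solution of `x (k + 1) = -(a k x k + g k)` with `x 0 = 1`. -/
def recSol {K : Type*} [Field K] (a g : ℕ → K) : ℕ → K
  | 0 => 1
  | k + 1 => -(a k * recSol a g k + g k)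

theorem norm_recSol_le {a g : ℕ → K} (ha : ∀ k, ‖a k‖ ≤ 1) {C : ℝ} (hC : 1 ≤ C)
    (hg : ∀ k, ‖g k‖ ≤ C) (k : ℕ) : ‖recSol a g k‖ ≤ C := by
  induction k with
  | zero => simpa [recSol] using hC
  | succ k ih =>
    rw [recSol, norm_neg]
    refine norm_add_le_of_le ?_ (hg k)
    rw [norm_mul]
    exact (mul_le_of_le_one_left (norm_nonneg _) (ha k)).trans ih

theorem norm_recSol_sub_le {a g g' : ℕ → K} (ha : ∀ k, ‖a k‖ ≤ 1) {C : ℝ} (hC : 0 ≤ C)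
    (hg : ∀ k, ‖g k - g' k‖ ≤ C) (k : ℕ) : ‖recSol a g k - recSol a g' k‖ ≤ C := by
  induction k with
  | zero => simpa [recSol] using hC
  | succ k ih =>
    have : recSol a g (k + 1) - recSol a g' (k + 1) =
        -(a k * (recSol a g k - recSol a g' k) + (g k - g' k)) := by
      simp only [recSol]; ring
    rw [this, norm_neg]
    refine norm_add_le_of_le ?_ (hg k)
    rw [norm_mul]
    exact (mul_le_of_le_one_left (norm_nonneg _) (ha k)).trans ih

/-- The sum involves later values of x, so this is not a forward recursion. It carries coefficients
of norm at most 1/p, however; treating it as a forcing term and solving the remaining first-order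
recursion with `recSol` defines a contraction of the bounded sequences. -/
theorem exists_bounded_solution {a e : ℕ → K} (ha : ∀ k, ‖a k‖ ≤ 1) (t : ℕ → ℕ)
    (he : ∀ l, ‖e l‖ ≤ ((p : ℝ)⁻¹) ^ (l + 1)) :
    ∃ x : ℕ → K, x 0 = 1 ∧ (∀ k, ‖x k‖ ≤ 1) ∧
      ∀ k, a k * x k + x (k + 1) + ∑' l, e l * x (k + t l) = 0 := by
  have hp0 : (0 : ℝ) ≤ (p : ℝ)⁻¹ := inv_prime_nonneg
  have hp1 : (p : ℝ)⁻¹ < 1 := inv_prime_lt_one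
  have hsum : ∀ (x : BoundedContinuousFunction ℕ K) (k : ℕ),
      Summable fun l => e l * x (k + t l) := fun x k => by
    refine Summable.of_norm_bounded
      (((summable_nat_add_iff 1).2 (summable_geometric_of_lt_one hp0 hp1)).mul_right ‖x‖) fun l => ?_
    rw [norm_mul]
    exact mul_le_mul (he l) (x.norm_coe_le_norm _) (norm_nonneg _) (by positivity)
  let g : BoundedContinuousFunction ℕ K → ℕ → K := fun x k => ∑' l, e l * x (k + t l)
  have hg : ∀ x y k, ‖g x k - g y k‖ ≤ (p : ℝ)⁻¹ * ‖x - y‖ := fun x y k => by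
    simp only [g]
    rw [← (hsum x k).tsum_sub (hsum y k)]
    refine IsUltrametricDist.norm_tsum_le_of_forall_le_of_nonneg (by positivity) fun l => ?_
    rw [← mul_sub, norm_mul]
    exact mul_le_mul ((he l).trans (pow_le_of_le_one hp0 hp1.le (by omega)))
      ((x - y).norm_coe_le_norm _) (norm_nonneg _) hp0
  have hg0 : ∀ x k, ‖g x k‖ ≤ (p : ℝ)⁻¹ * ‖x‖ := fun x k => by
    have := hg x 0 k
    simpa [g] using this
  let Ψ : BoundedContinuousFunction ℕ K → BoundedContinuousFunction ℕ K := fun x =>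
    BoundedContinuousFunction.ofNormedAddCommGroup (recSol a (g x)) continuous_of_discreteTopology
      (max 1 ((p : ℝ)⁻¹ * ‖x‖)) fun k =>
        norm_recSol_le ha (le_max_left _ _) (fun k => (hg0 x k).trans (le_max_right _ _)) k
  have hΨ : ContractingWith ⟨(p : ℝ)⁻¹, hp0⟩ Ψ := by
    refine ⟨by exact_mod_cast hp1, LipschitzWith.of_dist_le_mul fun x y => ?_⟩
    rw [dist_eq_norm, dist_eq_norm]
    refine (BoundedContinuousFunction.norm_le (by positivity)).2 fun k => ?_
    exact norm_recSol_sub_le ha (by positivity) (hg x y) k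
  let x := hΨ.fixedPoint Ψ
  have hfix : Ψ x = x := hΨ.fixedPoint_isFixedPt
  have hval : ∀ k, x k = recSol a (g x) k := fun k => congrArg (fun f => f k) hfix.symm
  refine ⟨x, by rw [hval 0]; rfl, ?_, fun k => ?_⟩
  -- Being fixed yields ‖x‖ ≤ max(1, ‖x‖/p), which forces ‖x‖ ≤ 1.
  · have hle : ‖x‖ ≤ max 1 ((p : ℝ)⁻¹ * ‖x‖) := by
      refine (BoundedContinuousFunction.norm_le (by positivity)).2 fun k => ?_
      rw [hval k]
      exact norm_recSol_le ha (le_max_left _ _) (fun k => (hg0 x k).trans (le_max_right _ _)) k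
    have hx1 : ‖x‖ ≤ 1 := by
      rcases le_max_iff.1 hle with h | h
      · exact h
      · nlinarith [norm_nonneg x]
    exact fun k => (x.norm_coe_le_norm k).trans hx1
  · rw [hval (k + 1), recSol, ← hval k]
    simp only [g]
    ring

/-- Since ε_0 = 1, the term l = 0 is x_{k+1} itself, and the terms l ≥ 1 are small enough for the
fixed-point argument. -/
theorem exists_moments (s : S) (j : Fin n) :
    ∃ x : ℕ → K, x 0 = 1 ∧ (∀ k, ‖x k‖ ≤ 1) ∧
      ∀ k : ℕ, (d.r s j + k) * x k + ∑' l, dworkEps p d.γ l * x (k + p ^ l) = 0 := by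
  obtain ⟨x, h0, h1, h2⟩ := exists_bounded_solution (p := p) (a := fun k : ℕ => d.r s j + k)
    (e := fun l => dworkEps p d.γ (l + 1)) (d.norm_r_add_le s j) (fun l => p ^ (l + 1))
    fun l => d.norm_eps_le (l + 1)
  refine ⟨x, h0, h1, fun k => ?_⟩
  have hs : Summable fun l => dworkEps p d.γ l * x (k + p ^ l) := by
    refine Summable.of_norm_bounded
      (summable_geometric_of_lt_one (inv_prime_nonneg (p := p)) inv_prime_lt_one) fun l => ?_
    rw [norm_mul]
    exact (mul_le_of_le_one_right (norm_nonneg _) (h1 _)).trans (d.norm_eps_le l)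
  rw [hs.tsum_eq_zero_add, dworkEps_zero d.γ_ne_zero, pow_zero, one_mul, ← add_assoc]
  exact h2 k

/-- The moments `∫ x ^ (r_j + k)` in normalized coordinates. -/
noncomputable def moment (s : S) (j : Fin n) : ℕ → K := (d.exists_moments s j).choose

theorem moment_zero (s : S) (j : Fin n) : d.moment s j 0 = 1 := (d.exists_moments s j).choose_spec.1

theorem norm_moment_le (s : S) (j : Fin n) (k : ℕ) : ‖d.moment s j k‖ ≤ 1 :=
  (d.exists_moments s j).choose_spec.2.1 k

theorem moment_rec (s : S) (j : Fin n) (k : ℕ) :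
    (d.r s j + k) * d.moment s j k + ∑' l, dworkEps p d.γ l * d.moment s j (k + p ^ l) = 0 :=
  (d.exists_moments s j).choose_spec.2.2 k

theorem norm_prod_moment_le (s : S) (k : Fin n → ℕ) : ‖∏ j, d.moment s j (k j)‖ ≤ 1 := by
  rw [norm_prod]
  exact Finset.prod_le_one (fun _ _ => norm_nonneg _) fun _ _ => d.norm_moment_le _ _ _

theorem summable_moment (s : S) (A : C₀(S × (Fin n → ℕ), K)) :
    Summable fun k : Fin n → ℕ => (∏ j, d.moment s j (k j)) * A (s, k) := by
  refine NonarchimedeanAddGroup.summable_of_tendsto_cofinite_zero ?_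
  have h : Tendsto (fun k : Fin n → ℕ => A (s, k)) cofinite (𝓝 0) :=
    (tendsto_apply A).comp (Prod.mk_right_injective s).tendsto_cofinite
  refine squeeze_zero_norm (fun k => ?_) (by simpa using h.norm)
  rw [norm_mul]
  exact mul_le_of_le_one_left (norm_nonneg _) (d.norm_prod_moment_le s k)

theorem norm_tsum_moment_le (s : S) (A : C₀(S × (Fin n → ℕ), K)) {C : ℝ} (hC : 0 ≤ C)
    (hA : ∀ k, ‖A (s, k)‖ ≤ C) :
    ‖∑' k : Fin n → ℕ, (∏ j, d.moment s j (k j)) * A (s, k)‖ ≤ C := by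
  refine IsUltrametricDist.norm_tsum_le_of_forall_le_of_nonneg hC fun k => ?_
  rw [norm_mul]
  exact (mul_le_of_le_one_left (norm_nonneg _) (d.norm_prod_moment_le s k)).trans (hA k)

/-- The functional dual to the basis element `s`. -/
noncomputable def functional (s : S) : C₀(S × (Fin n → ℕ), K) →L[K] K :=
  LinearMap.mkContinuous
    { toFun := fun A => ∑' k : Fin n → ℕ, (∏ j, d.moment s j (k j)) * A (s, k)
      map_add' := fun A B => by
        rw [← (d.summable_moment s A).tsum_add (d.summable_moment s B)]
        exact tsum_congr fun k => by rw [ZeroAtInftyContinuousMap.add_apply, mul_add]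
      map_smul' := fun c A => by
        rw [RingHom.id_apply, smul_eq_mul, ← tsum_mul_left]
        exact tsum_congr fun k => by
          rw [ZeroAtInftyContinuousMap.smul_apply, smul_eq_mul, mul_left_comm] } 1 fun A => by
      rw [one_mul]
      exact d.norm_tsum_moment_le s A (norm_nonneg A) fun k => norm_apply_le A _

theorem functional_apply (s : S) (A : C₀(S × (Fin n → ℕ), K)) :
    d.functional s A = ∑' k : Fin n → ℕ, (∏ j, d.moment s j (k j)) * A (s, k) := rfl

theorem norm_functional_le (s : S) (A : C₀(S × (Fin n → ℕ), K)) {C : ℝ} (hC : 0 ≤ C)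
    (hA : ∀ k, ‖A (s, k)‖ ≤ C) : ‖d.functional s A‖ ≤ C :=
  d.norm_tsum_moment_le s A hC hA

open Classical in
theorem functional_single (s : S) (u : S × (Fin n → ℕ)) :
    d.functional s (single K u) = if s = u.1 then ∏ j, d.moment s j (u.2 j) else 0 := by
  rw [functional_apply, tsum_eq_single u.2]
  · simp only [single_apply, Prod.ext_iff, and_true, mul_ite, mul_one, mul_zero]
  · intro k hk
    simp [single_apply, Prod.ext_iff, hk]

/-- On a monomial the value is the moment recurrence in direction j, multiplied by the moments in
the other directions. -/
theorem functional_diffOp (s : S) (j : Fin n) (A : C₀(S × (Fin n → ℕ), K)) :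
    d.functional s (d.diffOp j A) = 0 := by
  classical
  have key : d.functional s ∘L d.diffOp j = 0 := by
    refine clm_ext fun u => ?_
    rw [ContinuousLinearMap.comp_apply, d.map_diffOp_single, zero_apply]
    simp only [functional_single, translate, smul_eq_mul]
    by_cases hs : s = u.1
    · subst hs
      simp only [if_true]
      have h1 : ∀ t, ∏ i, d.moment u.1 i ((u.2 + Pi.single j t : Fin n → ℕ) i) =
          (∏ i ∈ Finset.univ.erase j, d.moment u.1 i (u.2 i)) * d.moment u.1 j (u.2 j + t) := by
        intro t
        rw [← Finset.prod_erase_mul _ _ (Finset.mem_univ j)]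
        congr 1
        · exact Finset.prod_congr rfl fun i hi => by simp [Finset.ne_of_mem_erase hi]
        · simp
      have h2 := d.moment_rec u.1 j (u.2 j)
      simp only [h1, mul_left_comm _ (∏ i ∈ Finset.univ.erase j, d.moment u.1 i (u.2 i)),
        tsum_mul_left]
      rw [← Finset.prod_erase_mul _ _ (Finset.mem_univ j)]
      linear_combination (∏ i ∈ Finset.univ.erase j, d.moment u.1 i (u.2 i)) * h2
    · simp [hs]
  exact congrArg (fun T : C₀(S × (Fin n → ℕ), K) →L[K] K => T A) key

open Classical in
theorem functional_single_zero (s s' : S) :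
    d.functional s (single K (s', 0)) = if s = s' then 1 else 0 := by
  rw [functional_single]
  simp [moment_zero]

end Functionals

/-! ### The matrix of `α` -/

section Matrix

variable [CharZero K] [Finite S]

theorem functional_alphaOp_of_ne {s s' : S} (h : d.σ s' ≠ s) :
    d.functional s' (d.alphaOp (single K (s, 0))) = 0 := by
  classical
  rw [functional_apply]
  simp [alphaOp_single_apply, h]

/-- The functional weights the coefficients of α(x^s) above s' by moments of norm at most 1. The k =
0 coefficient has moment 1 and exact norm |γ|^{|m|}, because all m_j < p; for k ≠ 0 there is an
extra factor at most 1/p, so the ultrametric inequality gives equality. -/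
theorem norm_functional_alphaOp {s s' : S} (h : d.σ s' = s) :
    ‖d.functional s' (d.alphaOp (single K (s, 0)))‖ = ‖d.γ‖ ^ (∑ j, d.m s' j) := by
  classical
  have hn : 0 < ‖d.γ‖ := norm_pos_iff.2 d.γ_ne_zero
  have hp0 : (0 : ℝ) ≤ (p : ℝ)⁻¹ := inv_prime_nonneg
  set A := d.alphaOp (single K (s, 0)) with hA
  have hval : ∀ k, A (s', k) = d.alphaCoeff (s', k) 0 := fun k => by
    rw [hA, alphaOp_single_apply, if_pos h]
  have h0 : ‖A (s', 0)‖ = ‖d.γ‖ ^ (∑ j, d.m s' j) := by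
    rw [hval, alphaCoeff]
    simp only [Pi.zero_apply, Finset.sum_const_zero, pow_zero, div_one, one_mul, mul_zero, add_zero,
      Nat.cast_zero, sub_zero]
    rw [norm_prod, ← Finset.prod_pow_eq_pow_sum]
    refine Finset.prod_congr rfl fun i _ => ?_
    rw [thetaCoeff_natCast, norm_coeff_theta_eq _ (d.m_lt s' i)]
  have hrest : ‖d.functional s' (A - A (s', 0) • single K (s', 0))‖ ≤
      ‖d.γ‖ ^ (∑ j, d.m s' j) * (p : ℝ)⁻¹ := by
    refine d.norm_functional_le _ _ (by positivity) fun k => ?_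
    rw [ZeroAtInftyContinuousMap.sub_apply, ZeroAtInftyContinuousMap.smul_apply, single_apply]
    by_cases hk : k = 0
    · subst hk
      simp only [if_true, smul_eq_mul, mul_one, sub_self, norm_zero]
      positivity
    · have hne : (s', k) ≠ (s', (0 : Fin n → ℕ)) := fun e => hk (Prod.ext_iff.1 e).2
      rw [if_neg hne, smul_zero, sub_zero, hval]
      refine (d.norm_alphaCoeff_le _ _).trans ?_
      gcongr
      refine pow_le_of_le_one hp0 inv_prime_lt_one.le fun hsum => hk ?_
      funext i
      exact Finset.sum_eq_zero_iff.1 hsum i (Finset.mem_univ i)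
  have hsplit : d.functional s' A = A (s', 0) + d.functional s' (A - A (s', 0) • single K (s', 0)) := by
    rw [map_sub, map_smul, functional_single_zero, if_pos rfl]
    simp
  have hlt : ‖d.functional s' (A - A (s', 0) • single K (s', 0))‖ < ‖A (s', 0)‖ := by
    rw [h0]
    exact hrest.trans_lt (mul_lt_of_lt_one_right (by positivity) inv_prime_lt_one)
  rw [hsplit, IsUltrametricDist.norm_add_eq_max_of_norm_ne_norm hlt.ne', max_eq_left hlt.le, h0]

end Matrix

end DworkData

end DworkDiag

namespace DworkDiag

open Filter Topology ZeroAtInfty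

/-! ### Surjectivity from approximate preimages -/

/-- Iterating the approximation expresses x as T of the convergent series ∑ c^i y_i, as in the proof
of the open mapping theorem. -/
theorem exists_preimage_of_approx {K Y X : Type*} [NormedField K]
    [NormedAddCommGroup Y] [NormedSpace K Y] [CompleteSpace Y]
    [NormedAddCommGroup X] [NormedSpace K X] (T : Y →L[K] X) {c : K} (hc : ‖c‖ < 1)
    (h : ∀ x : X, ‖x‖ ≤ 1 → ∃ (y : Y) (x' : X), ‖y‖ ≤ 1 ∧ ‖x'‖ ≤ 1 ∧ x = T y + c • x')
    {x : X} (hx : ‖x‖ ≤ 1) : ∃ y, T y = x := by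
  choose! f g hf hg hfg using h
  have hiter : ∀ k, ‖g^[k] x‖ ≤ 1 := fun k => by
    induction k with
    | zero => exact hx
    | succ k ih => rw [Function.iterate_succ_apply']; exact hg _ ih
  have hpart : ∀ k, x = T (∑ i ∈ Finset.range k, c ^ i • f (g^[i] x)) + c ^ k • g^[k] x := fun k => by
    induction k with
    | zero => simp
    | succ k ih =>
      rw [Finset.sum_range_succ, map_add, map_smul, Function.iterate_succ_apply', add_assoc,
        pow_succ, mul_smul, ← smul_add, ← hfg _ (hiter k)]
      exact ih
  have hbound : ∀ i, ‖c ^ i • f (g^[i] x)‖ ≤ ‖c‖ ^ i := fun i => by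
    rw [norm_smul, norm_pow]
    exact mul_le_of_le_one_right (by positivity) (hf _ (hiter i))
  have hsum : Summable fun i => c ^ i • f (g^[i] x) :=
    Summable.of_norm_bounded (summable_geometric_of_lt_one (norm_nonneg c) hc) hbound
  have hrest : Tendsto (fun k => c ^ k • g^[k] x) atTop (𝓝 0) := by
    refine squeeze_zero_norm (fun k => ?_) (tendsto_pow_atTop_nhds_zero_of_lt_one (norm_nonneg c) hc)
    rw [norm_smul, norm_pow]
    exact mul_le_of_le_one_right (by positivity) (hiter k)
  refine ⟨∑' i, c ^ i • f (g^[i] x), ?_⟩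
  have hlim := ((T.continuous.tendsto _).comp hsum.hasSum.tendsto_sum_nat).add hrest
  rw [add_zero] at hlim
  refine tendsto_nhds_unique hlim (tendsto_const_nhds.congr fun k => ?_)
  exact hpart k

namespace DworkData

set_option linter.unusedSectionVars false

variable {p : ℕ} [Fact p.Prime] {n : ℕ} {S : Type*} {K : Type*}
  [NormedField K] [NormedAlgebra ℚ_[p] K] [IsUltrametricDist K] [CompleteSpace K]
  (d : DworkData p n S K) [TopologicalSpace S] [DiscreteTopology S]

/-! ### The monomials x^s span modulo the images of the D_j -/

section Spanning

variable [Fintype S]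

/-- The map `(η, a) ↦ ∑ j, D_j η_j + ∑ s, a_s x ^ s`. -/
noncomputable def spanMap :
    ((Fin n → C₀(S × (Fin n → ℕ), K)) × (S → K)) →L[K] C₀(S × (Fin n → ℕ), K) :=
  (∑ j, d.diffOp j ∘L ContinuousLinearMap.proj j) ∘L ContinuousLinearMap.fst K _ _ +
    (∑ s, (ContinuousLinearMap.proj (R := K) (φ := fun _ : S => K) s).smulRight
      (single K (s, (0 : Fin n → ℕ)))) ∘L ContinuousLinearMap.snd K _ _

theorem spanMap_apply (y : (Fin n → C₀(S × (Fin n → ℕ), K)) × (S → K)) :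
    d.spanMap y = ∑ j, d.diffOp j (y.1 j) + ∑ s, y.2 s • single K (s, (0 : Fin n → ℕ)) := by
  simp [spanMap, sum_apply]

/-- `A` is approximated modulo `p` by the image of the unit ball under `spanMap`. -/
def HasApprox (A : C₀(S × (Fin n → ℕ), K)) : Prop :=
  ∃ y, ‖y‖ ≤ 1 ∧ ‖A - d.spanMap y‖ ≤ (p : ℝ)⁻¹

variable {d}

theorem HasApprox.add {A B : C₀(S × (Fin n → ℕ), K)} (hA : d.HasApprox A) (hB : d.HasApprox B) :
    d.HasApprox (A + B) := by
  obtain ⟨y, hy, hyA⟩ := hA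
  obtain ⟨z, hz, hzB⟩ := hB
  refine ⟨y + z, norm_prod_le_iff.2 ⟨norm_add_le_of_le ((norm_fst_le y).trans hy)
    ((norm_fst_le z).trans hz), norm_add_le_of_le ((norm_snd_le y).trans hy)
    ((norm_snd_le z).trans hz)⟩, ?_⟩
  rw [map_add, add_sub_add_comm]
  exact norm_add_le_of_le hyA hzB

theorem HasApprox.smul {A : C₀(S × (Fin n → ℕ), K)} (hA : d.HasApprox A) {c : K} (hc : ‖c‖ ≤ 1) :
    d.HasApprox (c • A) := by
  obtain ⟨y, hy, hyA⟩ := hA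
  refine ⟨c • y, ?_, ?_⟩
  · rw [norm_smul]
    exact mul_le_one₀ hc (norm_nonneg _) hy
  · have : c • A - d.spanMap (c • y) = c • (A - d.spanMap y) := by
      rw [map_smul]
      exact (smul_sub c A _).symm
    rw [this, norm_smul]
    exact (mul_le_of_le_one_left (norm_nonneg _) hc).trans hyA

theorem HasApprox.of_norm_le {A : C₀(S × (Fin n → ℕ), K)} (hA : ‖A‖ ≤ (p : ℝ)⁻¹) :
    d.HasApprox A := ⟨0, by simp, by simpa using hA⟩

theorem HasApprox.of_eq {A : C₀(S × (Fin n → ℕ), K)}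
    {y : (Fin n → C₀(S × (Fin n → ℕ), K)) × (S → K)} (hy : ‖y‖ ≤ 1) (h : d.spanMap y = A) :
    d.HasApprox A := ⟨y, hy, by rw [h, sub_self, norm_zero]; exact inv_prime_nonneg⟩

theorem HasApprox.sum {ι : Type*} (F : Finset ι) {A : ι → C₀(S × (Fin n → ℕ), K)}
    (h : ∀ i ∈ F, d.HasApprox (A i)) : d.HasApprox (∑ i ∈ F, A i) :=
  Finset.sum_induction A d.HasApprox (fun _ _ => HasApprox.add)
    (HasApprox.of_norm_le (by simp)) h

variable (d)

/-- Induction on the total degree: applying D_j to the monomial one step lower gives x^u, a scalar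
multiple of that lower monomial, and terms with |ε_l| ≤ 1/p for l ≥ 1. -/
theorem hasApprox_single (u : S × (Fin n → ℕ)) : d.HasApprox (single K u) := by
  classical
  obtain ⟨N, hN⟩ : ∃ N, ∑ j, u.2 j = N := ⟨_, rfl⟩
  induction N generalizing u with
  | zero =>
    have hu : u = (u.1, 0) := Prod.ext rfl (by
      funext i
      exact Finset.sum_eq_zero_iff.1 hN i (Finset.mem_univ i))
    rw [hu]
    refine HasApprox.of_eq (y := (0, Pi.single u.1 1)) ?_ ?_
    · refine norm_prod_le_iff.2 ⟨by simp, (pi_norm_le_iff_of_nonneg zero_le_one).2 fun s => ?_⟩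
      obtain rfl | hs := eq_or_ne s u.1
      · simp
      · simp [hs]
    · rw [spanMap_apply, Finset.sum_eq_single_of_mem u.1 (Finset.mem_univ _) fun s _ hs => by
        simp [hs]]
      simp
  | succ N ih =>
    obtain ⟨j, hj⟩ : ∃ j, 1 ≤ u.2 j := by
      by_contra! h
      have : ∑ j, u.2 j = 0 := Finset.sum_eq_zero fun j _ => by have := h j; omega
      omega
    set u' : S × (Fin n → ℕ) := (u.1, u.2 - Pi.single j 1) with hu'
    have htr : translate j 1 u' = u := translate_sub hj
    have hN' : ∑ i, u'.2 i = N := by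
      have h2 : u.2 = u'.2 + Pi.single j 1 := (congrArg Prod.snd htr).symm
      have h1 : ∑ i, u.2 i = ∑ i, u'.2 i + 1 := by rw [h2, sum_add_single]
      omega
    have hD := d.diffOp_single j u'
    rw [(d.summable_eps_single j u').tsum_eq_zero_add, dworkEps_zero d.γ_ne_zero, pow_zero, one_smul,
      htr] at hD
    have hsplit : single K u = d.diffOp j (single K u') +
        (-(d.r u'.1 j + u'.2 j)) • single K u' +
        (-∑' l, dworkEps p d.γ (l + 1) • single K (translate j (p ^ (l + 1)) u')) := by
      have hneg : (-(d.r u'.1 j + u'.2 j)) • single K u' = -((d.r u'.1 j + u'.2 j) • single K u') :=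
        ZeroAtInftyContinuousMap.ext fun v => neg_mul _ _
      rw [hD, hneg]
      abel
    rw [hsplit]
    refine (HasApprox.add ?_ ?_).add ?_
    · refine HasApprox.of_eq (y := (Pi.single j (single K u'), 0)) ?_ ?_
      · refine norm_prod_le_iff.2 ⟨(pi_norm_le_iff_of_nonneg zero_le_one).2 fun i => ?_, by simp⟩
        obtain rfl | hi := eq_or_ne i j
        · simpa using norm_single_le u'
        · simp [hi]
      · rw [spanMap_apply, Finset.sum_eq_single_of_mem j (Finset.mem_univ _) fun i _ hi => by
          simp [hi]]
        simp
    · exact (ih u' hN').smul (by rw [norm_neg]; exact d.norm_r_add_le _ _ _)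
    · refine HasApprox.of_norm_le ?_
      rw [norm_neg]
      refine IsUltrametricDist.norm_tsum_le_of_forall_le_of_nonneg inv_prime_nonneg fun l => ?_
      rw [norm_smul]
      exact (mul_le_of_le_one_right (norm_nonneg _) (norm_single_le _)).trans (d.norm_eps_succ_le l)

theorem hasApprox_of_norm_le_one {A : C₀(S × (Fin n → ℕ), K)} (hA : ‖A‖ ≤ 1) : d.HasApprox A := by
  have hp : (0 : ℝ) < (p : ℝ)⁻¹ := inv_pos.2 (by exact_mod_cast (Fact.out : p.Prime).pos)
  obtain ⟨F, hF⟩ := exists_norm_sub_sum_single_le A hp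
  have : A = ∑ u ∈ F, A u • single K u + (A - ∑ u ∈ F, A u • single K u) := by abel
  rw [this]
  exact (HasApprox.sum F fun u _ => (d.hasApprox_single u).smul
    ((norm_apply_le A u).trans hA)).add (HasApprox.of_norm_le hF)

theorem spanMap_surjective : Function.Surjective d.spanMap := by
  have hp0 : (p : K) ≠ 0 := prime_cast_ne_zero
  have hpn : ‖(p : K)‖ = (p : ℝ)⁻¹ := norm_prime_cast
  have hball : ∀ A : C₀(S × (Fin n → ℕ), K), ‖A‖ ≤ 1 → ∃ y, d.spanMap y = A := fun A hA => by
    refine exists_preimage_of_approx d.spanMap (c := (p : K)) (by rw [hpn]; exact inv_prime_lt_one)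
      (fun x hx => ?_) hA
    obtain ⟨y, hy, hyx⟩ := d.hasApprox_of_norm_le_one hx
    refine ⟨y, (p : K)⁻¹ • (x - d.spanMap y), hy, ?_, ?_⟩
    · rw [norm_smul, norm_inv, hpn]
      refine (mul_le_mul_of_nonneg_left hyx (by positivity)).trans_eq (inv_mul_cancel₀ ?_)
      rw [← hpn]
      exact norm_ne_zero_iff.2 hp0
    · rw [smul_smul, mul_inv_cancel₀ hp0, one_smul]
      abel
  intro A
  -- A power of p scales an arbitrary family into the unit ball.
  obtain ⟨N, hN⟩ := exists_pow_lt_of_lt_one (y := (p : ℝ)⁻¹) (x := (‖A‖ + 1)⁻¹) (by positivity)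
    inv_prime_lt_one
  have hle : ‖(p : K) ^ N • A‖ ≤ 1 := by
    rw [norm_smul, norm_pow, hpn]
    calc ((p : ℝ)⁻¹) ^ N * ‖A‖ ≤ (‖A‖ + 1)⁻¹ * (‖A‖ + 1) := by
          gcongr
          linarith
      _ = 1 := inv_mul_cancel₀ (by positivity)
  obtain ⟨y, hy⟩ := hball _ hle
  refine ⟨((p : K) ^ N)⁻¹ • y, ?_⟩
  rw [map_smul, hy, smul_smul, inv_mul_cancel₀ (pow_ne_zero N hp0), one_smul]

/-- In a representation of A by `spanMap`, the functionals read off the coefficients of the x^s,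
which must then vanish. -/
theorem eq_of_functional_eq_zero {A : C₀(S × (Fin n → ℕ), K)} (h : ∀ s, d.functional s A = 0) :
    ∃ η : Fin n → C₀(S × (Fin n → ℕ), K), A = ∑ j, d.diffOp j (η j) := by
  classical
  obtain ⟨y, rfl⟩ := d.spanMap_surjective A
  refine ⟨y.1, ?_⟩
  have hy : ∀ s, y.2 s = 0 := fun s => by
    have := h s
    rw [spanMap_apply, map_add, map_sum, map_sum, Finset.sum_eq_zero fun j _ =>
      d.functional_diffOp s j _, zero_add] at this
    simpa [functional_single_zero] using this
  simp [spanMap_apply, hy]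

end Spanning

end DworkData

end DworkDiag

namespace DworkDiag

open Filter Topology

/-! ### Coordinates with respect to `w` over a field of characteristic zero -/

section Coordinates

variable {n : ℕ} (w : Fin n → Fin n → ℤ)

/-- The coordinates of `u` with respect to the `w_i`, over a field `K`. -/
noncomputable def coordIn (K : Type*) [Field K] (u : Fin n → ℤ) : Fin n → K :=
  Matrix.vecMul (fun i => (u i : K)) ((expMatrix w).map (Int.cast : ℤ → K))⁻¹

theorem coord_eq_coordIn (u : Fin n → ℤ) : coord w u = coordIn w ℝ u := rfl

variable {K : Type*} [Field K]

theorem det_map_intCast : ((expMatrix w).map (Int.cast : ℤ → K)).det = ((expMatrix w).det : K) :=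
  ((Int.castRingHom K).map_det (expMatrix w)).symm

theorem isUnit_det_map [CharZero K] (h : (expMatrix w).det ≠ 0) :
    IsUnit ((expMatrix w).map (Int.cast : ℤ → K)).det := by
  rw [det_map_intCast, isUnit_iff_ne_zero]
  exact_mod_cast h

theorem coordIn_add (u v : Fin n → ℤ) : coordIn w K (u + v) = coordIn w K u + coordIn w K v := by
  rw [coordIn, coordIn, coordIn, ← Matrix.add_vecMul]
  congr 1
  funext i
  simp

theorem coordIn_sub (u v : Fin n → ℤ) : coordIn w K (u - v) = coordIn w K u - coordIn w K v := by
  rw [eq_sub_iff_add_eq, ← coordIn_add, sub_add_cancel]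

theorem coordIn_nsmul (m : ℕ) (u : Fin n → ℤ) : coordIn w K (m • u) = (m : K) • coordIn w K u := by
  rw [coordIn, coordIn, ← Matrix.smul_vecMul]
  congr 1
  funext i
  simp

theorem sum_coordIn_mul [CharZero K] (h : (expMatrix w).det ≠ 0) (u : Fin n → ℤ) (i : Fin n) :
    ∑ j, coordIn w K u j * (w j i : K) = (u i : K) := by
  have : Matrix.vecMul (coordIn w K u) ((expMatrix w).map (Int.cast : ℤ → K)) =
      fun i => (u i : K) := by
    rw [coordIn, Matrix.vecMul_vecMul, Matrix.nonsing_inv_mul _ (isUnit_det_map w h),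
      Matrix.vecMul_one]
  simpa [Matrix.vecMul, dotProduct, expMatrix] using congrFun this i

theorem coordIn_sum_nsmul [CharZero K] (h : (expMatrix w).det ≠ 0) (k : Fin n → ℕ) :
    coordIn w K (∑ i, k i • w i) = fun i => (k i : K) := by
  have : (fun j => ((∑ i, k i • w i) j : K)) =
      Matrix.vecMul (fun i => (k i : K)) ((expMatrix w).map (Int.cast : ℤ → K)) := by
    funext j
    simp [Matrix.vecMul, dotProduct, expMatrix]
  rw [coordIn, this, Matrix.vecMul_vecMul, Matrix.mul_nonsing_inv _ (isUnit_det_map w h),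
    Matrix.vecMul_one]

theorem det_ne_zero_of_isCoprime {p : ℕ} [Fact p.Prime] (h : IsCoprime (p : ℤ) (expMatrix w).det) :
    (expMatrix w).det ≠ 0 := by
  intro h0
  rw [h0, isCoprime_zero_right, Int.isUnit_iff] at h
  have := (Fact.out : p.Prime).one_lt
  omega

/-- By Cramer's rule the coordinates are integers divided by det J, which is a p-adic unit. -/
theorem norm_coordIn_le {p : ℕ} [Fact p.Prime] {K : Type*} [NormedField K] [NormedAlgebra ℚ_[p] K]
    [IsUltrametricDist K] (h : IsCoprime (p : ℤ) (expMatrix w).det) (u : Fin n → ℤ) (j : Fin n) :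
    ‖coordIn w K u j‖ ≤ 1 := by
  have hint : ∀ z : ℤ, ‖(z : K)‖ = ‖(z : ℚ_[p])‖ := fun z => by
    rw [← map_intCast (algebraMap ℚ_[p] K), norm_algebraMap']
  have hdet : ‖((expMatrix w).det : K)‖ = 1 := by
    rw [hint]
    refine le_antisymm (Padic.norm_int_le_one _) (not_lt.1 fun hlt => ?_)
    have hd := Padic.norm_intCast_lt_one_iff.1 hlt
    have hu := h.isUnit_of_dvd' dvd_rfl hd
    rw [Int.isUnit_iff] at hu
    have := (Fact.out : p.Prime).one_lt
    omega
  have hadj : ((expMatrix w).map (Int.cast : ℤ → K)).adjugate =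
      (expMatrix w).adjugate.map (Int.cast : ℤ → K) :=
    ((Int.castRingHom K).map_adjugate (expMatrix w)).symm
  have hval : coordIn w K u j =
      ((expMatrix w).det : K)⁻¹ * ((∑ i, u i * (expMatrix w).adjugate i j : ℤ) : K) := by
    rw [coordIn, Matrix.inv_def, Ring.inverse_eq_inv', det_map_intCast, hadj, Matrix.vecMul_smul]
    simp [Matrix.vecMul, dotProduct]
  rw [hval, norm_mul, norm_inv, hdet, inv_one, one_mul, hint]
  exact Padic.norm_int_le_one _

end Coordinates

/-! ### The lattice cone and its fundamental domain -/

section Cone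

variable {n : ℕ} {w : Fin n → Fin n → ℤ}

theorem mem_latticeCone_iff (h : (expMatrix w).det ≠ 0) (u : Fin n → ℤ) :
    u ∈ latticeCone w ↔ ∀ i, 0 ≤ coord w u i := by
  rw [latticeCone, Set.mem_ofPred_eq, PointedCone.hull, Submodule.mem_span_range_iff_exists_fun]
  constructor
  · rintro ⟨c, hc⟩ i
    rw [← coord_unique w h u (fun i => (c i : ℝ)) hc]
    exact (c i).2
  · intro hu
    exact ⟨fun i => ⟨coord w u i, hu i⟩, sum_coord w h u⟩

theorem nonneg_coord (h : (expMatrix w).det ≠ 0) {u : Fin n → ℤ} (hu : u ∈ latticeCone w)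
    (i : Fin n) : 0 ≤ coord w u i := (mem_latticeCone_iff h u).1 hu i

/-- The lattice point with fractional part `s` and integral part `k`. -/
def conePoint (w : Fin n → Fin n → ℤ) (v : fundDomain w × (Fin n → ℕ)) : Fin n → ℤ :=
  v.1 + ∑ i, v.2 i • w i

theorem coordIn_conePoint {K : Type*} [Field K] [CharZero K] (h : (expMatrix w).det ≠ 0)
    (v : fundDomain w × (Fin n → ℕ)) (i : Fin n) :
    coordIn w K (conePoint w v) i = coordIn w K v.1 i + v.2 i := by
  rw [conePoint, coordIn_add, coordIn_sum_nsmul w h]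
  rfl

theorem coord_conePoint (h : (expMatrix w).det ≠ 0) (v : fundDomain w × (Fin n → ℕ)) (i : Fin n) :
    coord w (conePoint w v) i = coord w v.1 i + v.2 i :=
  coordIn_conePoint h v i

theorem floor_coord_conePoint (h : (expMatrix w).det ≠ 0) (v : fundDomain w × (Fin n → ℕ))
    (i : Fin n) : ⌊coord w (conePoint w v) i⌋₊ = v.2 i := by
  obtain ⟨h0, h1⟩ := v.1.2.2 i
  rw [coord_conePoint h, Nat.floor_add_natCast h0, Nat.floor_eq_zero.2 h1, zero_add]

theorem conePoint_injective (h : (expMatrix w).det ≠ 0) : Function.Injective (conePoint w) := by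
  intro v v' hv
  have h2 : v.2 = v'.2 := by
    funext i
    rw [← floor_coord_conePoint h v i, hv, floor_coord_conePoint h v' i]
  refine Prod.ext (Subtype.ext ?_) h2
  rw [conePoint, conePoint, h2] at hv
  exact add_right_cancel hv

theorem conePoint_mem (h : (expMatrix w).det ≠ 0) (v : fundDomain w × (Fin n → ℕ)) :
    conePoint w v ∈ latticeCone w := by
  refine (mem_latticeCone_iff h _).2 fun i => ?_
  rw [coord_conePoint h]
  exact add_nonneg (v.1.2.2 i).1 (Nat.cast_nonneg _)

/-- The fractional part of a point of the lattice cone. -/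
noncomputable def conePart (w : Fin n → Fin n → ℤ) (u : Fin n → ℤ) : Fin n → ℤ :=
  u - ∑ i, ⌊coord w u i⌋₊ • w i

theorem coord_conePart (h : (expMatrix w).det ≠ 0) {u : Fin n → ℤ} (hu : u ∈ latticeCone w)
    (i : Fin n) : coord w (conePart w u) i = Int.fract (coord w u i) := by
  have := nonneg_coord h hu i
  rw [conePart, coord_eq_coordIn, coordIn_sub, coordIn_sum_nsmul w h, Pi.sub_apply,
    ← coord_eq_coordIn, Int.fract, natCast_floor_eq_intCast_floor this]

theorem conePart_mem (h : (expMatrix w).det ≠ 0) {u : Fin n → ℤ} (hu : u ∈ latticeCone w) :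
    conePart w u ∈ fundDomain w := by
  have hb : ∀ i, 0 ≤ coord w (conePart w u) i ∧ coord w (conePart w u) i < 1 := fun i => by
    rw [coord_conePart h hu]
    exact ⟨Int.fract_nonneg _, Int.fract_lt_one _⟩
  exact ⟨(mem_latticeCone_iff h _).2 fun i => (hb i).1, hb⟩

theorem exists_conePoint_eq (h : (expMatrix w).det ≠ 0) {u : Fin n → ℤ} (hu : u ∈ latticeCone w) :
    ∃ v, conePoint w v = u :=
  ⟨(⟨conePart w u, conePart_mem h hu⟩, fun i => ⌊coord w u i⌋₊), by simp [conePoint, conePart]⟩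

theorem range_conePoint (h : (expMatrix w).det ≠ 0) : Set.range (conePoint w) = latticeCone w :=
  Set.Subset.antisymm (Set.range_subset_iff.2 (conePoint_mem h)) fun _ hu =>
    exists_conePoint_eq h hu

/-- Coordinates in [0, 1) bound each entry of u by ∑_j |w_{ji}|. -/
theorem finite_fundDomain (h : (expMatrix w).det ≠ 0) : (fundDomain w).Finite := by
  refine (Set.finite_Icc (fun i => -∑ j, |w j i|) fun i => ∑ j, |w j i|).subset fun u hu => ?_
  have key : ∀ i, |u i| ≤ ∑ j, |w j i| := fun i => by
    have h1 := sum_coordIn_mul (K := ℝ) w h u i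
    have h2 : |(u i : ℝ)| ≤ ∑ j, |(w j i : ℝ)| := by
      rw [← h1]
      refine (Finset.abs_sum_le_sum_abs _ _).trans (Finset.sum_le_sum fun j _ => ?_)
      rw [abs_mul]
      refine mul_le_of_le_one_left (abs_nonneg _) ?_
      obtain ⟨h3, h4⟩ := hu.2 j
      rw [coord_eq_coordIn] at h3 h4
      rw [abs_of_nonneg h3]
      exact h4.le
    exact_mod_cast h2
  exact ⟨fun i => (abs_le.1 (key i)).1, fun i => (abs_le.1 (key i)).2⟩

/-- The residue of `p u`, as a point of the fundamental domain. -/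
noncomputable def frobPoint (p : ℕ) (h : (expMatrix w).det ≠ 0) (s : fundDomain w) : fundDomain w :=
  ⟨conePart w (p • (s : Fin n → ℤ)), conePart_mem h <| (mem_latticeCone_iff h _).2 fun i => by
    rw [coord_eq_coordIn, coordIn_nsmul, Pi.smul_apply, smul_eq_mul]
    exact mul_nonneg (Nat.cast_nonneg _) (s.2.2 i).1⟩

/-- The integral part of the coordinates of `p u`. -/
noncomputable def frobDigit (p : ℕ) (s : fundDomain w) (i : Fin n) : ℕ :=
  ⌊coord w (p • (s : Fin n → ℤ)) i⌋₊

theorem coord_nsmul (p : ℕ) (u : Fin n → ℤ) (i : Fin n) :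
    coord w (p • u) i = p * coord w u i := by
  rw [coord_eq_coordIn, coordIn_nsmul]
  rfl

theorem frobPoint_add (p : ℕ) (h : (expMatrix w).det ≠ 0) (s : fundDomain w) :
    (frobPoint p h s : Fin n → ℤ) + ∑ i, frobDigit p s i • w i = p • (s : Fin n → ℤ) := by
  simp [frobPoint, conePart, frobDigit]

theorem frobDigit_lt {p : ℕ} (hp : 0 < p) (s : fundDomain w) (i : Fin n) : frobDigit p s i < p := by
  have hp' : (0 : ℝ) < p := by exact_mod_cast hp
  have h0 : 0 ≤ (p : ℝ) * coord w s i := mul_nonneg hp'.le (s.2.2 i).1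
  rw [frobDigit, coord_nsmul, Nat.floor_lt h0]
  exact mul_lt_of_lt_one_right hp' (s.2.2 i).2

theorem coordIn_frobPoint {K : Type*} [Field K] [CharZero K] (p : ℕ) (h : (expMatrix w).det ≠ 0)
    (s : fundDomain w) (i : Fin n) :
    (p : K) * coordIn w K s i = coordIn w K (frobPoint p h s) i + frobDigit p s i := by
  have := congrArg (fun u => coordIn w K u i) (frobPoint_add p h s)
  simp only [coordIn_add, coordIn_sum_nsmul w h, coordIn_nsmul, Pi.add_apply, Pi.smul_apply,
    smul_eq_mul] at this
  exact this.symm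

theorem toReal_injective : Function.Injective (toReal : (Fin n → ℤ) → Fin n → ℝ) := by
  intro u v huv
  funext i
  simpa [toReal] using congrFun huv i

theorem pAct_eq (p : ℕ) (h : (expMatrix w).det ≠ 0) (s : fundDomain w) :
    pAct p w s = toReal (frobPoint p h s : Fin n → ℤ) := by
  rw [← sum_coord w h, pAct]
  refine Finset.sum_congr rfl fun i _ => ?_
  have hmem : p • (s : Fin n → ℤ) ∈ latticeCone w := (mem_latticeCone_iff h _).2 fun i => by
    rw [coord_nsmul]
    exact mul_nonneg (Nat.cast_nonneg _) (s.2.2 i).1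
  rw [frobPoint, coord_conePart h hmem, coord_nsmul]

theorem pAct_eq_toReal_iff (p : ℕ) (h : (expMatrix w).det ≠ 0) (s s' : fundDomain w) :
    pAct p w s' = toReal (s : Fin n → ℤ) ↔ frobPoint p h s' = s := by
  rw [pAct_eq p h, toReal_injective.eq_iff, Subtype.ext_iff]

theorem sum_frobDigit (p : ℕ) (h : (expMatrix w).det ≠ 0) (s : fundDomain w) :
    ((∑ i, frobDigit p s i : ℕ) : ℝ) = p * weight w s - weight w (frobPoint p h s) := by
  rw [weight, weight, Finset.mul_sum, ← Finset.sum_sub_distrib]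
  push_cast
  refine Finset.sum_congr rfl fun i _ => ?_
  have := coordIn_frobPoint (K := ℝ) p h s i
  rw [coord_eq_coordIn, coord_eq_coordIn]
  linarith

theorem weight_conePoint (h : (expMatrix w).det ≠ 0) (v : fundDomain w × (Fin n → ℕ)) :
    weight w (conePoint w v) = weight w v.1 + ((∑ i, v.2 i : ℕ) : ℝ) := by
  simp only [weight, coord_conePoint h, Finset.sum_add_distrib, Nat.cast_sum]

end Cone

end DworkDiag

namespace DworkDiag

open Filter Topology ZeroAtInfty

/-! ### Series supported in the lattice cone -/

section ConeSeries

variable {n : ℕ} {w : Fin n → Fin n → ℤ}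

section Field

variable {K : Type*} [Field K]

/-- The Laurent series with normalized coordinates `A`. -/
noncomputable def coneSeries (w : Fin n → Fin n → ℤ) (γ : K) (A : fundDomain w × (Fin n → ℕ) → K) :
    Laurent n K :=
  Function.extend (conePoint w) (fun v => γ ^ (∑ i, v.2 i) * A v) 0

theorem coneSeries_conePoint (h : (expMatrix w).det ≠ 0) (γ : K)
    (A : fundDomain w × (Fin n → ℕ) → K) (v : fundDomain w × (Fin n → ℕ)) :
    coneSeries w γ A (conePoint w v) = γ ^ (∑ i, v.2 i) * A v :=
  (conePoint_injective h).extend_apply _ _ _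

theorem coneSeries_of_notMem (h : (expMatrix w).det ≠ 0) (γ : K)
    (A : fundDomain w × (Fin n → ℕ) → K) {u : Fin n → ℤ} (hu : u ∉ latticeCone w) :
    coneSeries w γ A u = 0 := by
  rw [← range_conePoint h] at hu
  exact Function.extend_apply' _ _ _ hu

theorem ext_on_cone {K : Type*} (h : (expMatrix w).det ≠ 0) {ξ η : Laurent n K}
    (h1 : ∀ v, ξ (conePoint w v) = η (conePoint w v))
    (h2 : ∀ u, u ∉ latticeCone w → ξ u = η u) : ξ = η := by
  funext u
  by_cases hu : u ∈ latticeCone w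
  · obtain ⟨v, rfl⟩ := exists_conePoint_eq h hu
    exact h1 v
  · exact h2 u hu

/-- Transfers the lattice sums defining the Cauchy product to sums over ℕ or ℕⁿ. The finiteness
hypothesis ensures that neither side is a default value. -/
theorem finsum_eq_tsum_comp [TopologicalSpace K] [T2Space K] {α β : Type*} {f : α → K} {g : β → α}
    (hg : Function.Injective g) (hsupp : Function.support f ⊆ Set.range g)
    (hfin : {b | f (g b) ≠ 0}.Finite) : ∑ᶠ t, f t = ∑' b, f (g b) := by
  rw [hg.tsum_eq hsupp, tsum_eq_finsum]
  refine (hfin.image g).subset fun t ht => ?_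
  obtain ⟨b, rfl⟩ := hsupp ht
  exact ⟨b, ht, rfl⟩

theorem nsmul_injective_of_ne_zero {v : Fin n → ℤ} (hv : v ≠ 0) :
    Function.Injective fun k : ℕ => k • v := by
  obtain ⟨i, hi⟩ := Function.ne_iff.1 hv
  intro k k' hk
  have h1 := congrFun hk i
  simp only [Pi.smul_apply, nsmul_eq_mul] at h1
  exact_mod_cast mul_right_cancel₀ hi h1

theorem evalMono_nsmul {v : Fin n → ℤ} (hv : v ≠ 0) (g : PowerSeries K) (k : ℕ) :
    evalMono g v (k • v) = PowerSeries.coeff k g := by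
  have : {j : ℕ | j • v = k • v} = {k} := by
    ext j
    simp only [Set.mem_ofPred_eq, Set.mem_singleton_iff]
    exact (nsmul_injective_of_ne_zero hv).eq_iff
  rw [evalMono, this, finsum_mem_singleton]

theorem evalMono_eq_zero {v : Fin n → ℤ} (g : PowerSeries K) {u : Fin n → ℤ}
    (hu : ∀ k : ℕ, k • v = u → PowerSeries.coeff k g = 0) : evalMono g v u = 0 :=
  finsum_mem_eq_zero_of_forall_eq_zero hu

theorem coeff_hSeries_pow {p : ℕ} (hp : 1 < p) (γ : K) (l : ℕ) :
    PowerSeries.coeff (p ^ l) (hSeries p γ) = gammaSum p γ l := by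
  have : {j : ℕ | p ^ j = p ^ l} = {l} := by
    ext j
    simp only [Set.mem_ofPred_eq, Set.mem_singleton_iff]
    exact (Nat.pow_right_injective hp).eq_iff
  rw [hSeries, PowerSeries.coeff_mk, this, finsum_mem_singleton]

theorem coeff_hSeries_eq_zero {p : ℕ} (γ : K) {m : ℕ} (hm : ∀ l, p ^ l ≠ m) :
    PowerSeries.coeff m (hSeries p γ) = 0 := by
  rw [hSeries, PowerSeries.coeff_mk]
  exact finsum_mem_eq_zero_of_forall_eq_zero fun l hl => absurd hl (hm l)

theorem vector_ne_zero (h : (expMatrix w).det ≠ 0) (j : Fin n) : w j ≠ 0 := fun h0 =>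
  h (Matrix.det_eq_zero_of_row_eq_zero j fun i => congrFun h0 i)

theorem mem_of_sub_mem (h : (expMatrix w).det ≠ 0) {u : Fin n → ℤ} (k : Fin n → ℕ)
    (hu : u - ∑ i, k i • w i ∈ latticeCone w) (i : Fin n) : (k i : ℝ) ≤ coord w u i := by
  have := nonneg_coord h hu i
  rw [coord_eq_coordIn, coordIn_sub, coordIn_sum_nsmul w h, Pi.sub_apply] at this
  rw [coord_eq_coordIn]
  linarith

theorem sum_single_nsmul (w : Fin n → Fin n → ℤ) (j : Fin n) (t : ℕ) :
    ∑ i, (Pi.single j t : Fin n → ℕ) i • w i = t • w j := by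
  classical
  rw [Finset.sum_eq_single_of_mem j (Finset.mem_univ _) fun i _ hi => by simp [hi]]
  simp

theorem conePoint_sub (v : fundDomain w × (Fin n → ℕ)) {k : Fin n → ℕ} (hk : k ≤ v.2) :
    conePoint w v - ∑ i, k i • w i = conePoint w (v.1, v.2 - k) := by
  have h1 : ∑ i, v.2 i • w i = ∑ i, (v.2 - k) i • w i + ∑ i, k i • w i := by
    rw [← Finset.sum_add_distrib]
    refine Finset.sum_congr rfl fun i _ => ?_
    rw [← add_nsmul, Pi.sub_apply, Nat.sub_add_cancel (hk i)]
  rw [conePoint, conePoint, h1]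
  simp only
  abel

theorem le_of_conePoint_sub_mem (h : (expMatrix w).det ≠ 0) (v : fundDomain w × (Fin n → ℕ))
    {k : Fin n → ℕ} (hk : conePoint w v - ∑ i, k i • w i ∈ latticeCone w) : k ≤ v.2 := by
  intro i
  have h1 := mem_of_sub_mem h k hk i
  rw [coord_conePoint h] at h1
  have h2 := (v.1.2.2 i).2
  have h3 : (k i : ℝ) < v.2 i + 1 := by linarith
  exact Nat.lt_succ_iff.1 (by exact_mod_cast h3)

theorem mem_of_sub_sum_mem (h : (expMatrix w).det ≠ 0) {u : Fin n → ℤ} (k : Fin n → ℕ)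
    (hu : u - ∑ i, k i • w i ∈ latticeCone w) : u ∈ latticeCone w :=
  (mem_latticeCone_iff h u).2 fun i => (Nat.cast_nonneg _).trans (mem_of_sub_mem h k hu i)

end Field

/-! ### The operators D̂_i and α on series supported in the cone -/

section Operators

set_option linter.unusedSectionVars false

variable {p : ℕ} [Fact p.Prime] {K : Type*} [NormedField K] [NormedAlgebra ℚ_[p] K]
  [IsUltrametricDist K] [CompleteSpace K] [CharZero K]

/-- The data attached to the vectors `w` and the zero `γ`. -/
noncomputable def coneData (hw : IsCoprime (p : ℤ) (expMatrix w).det) {γ : K} (h0 : γ ≠ 0)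
    (hρ : ‖γ‖ ^ (p - 1) = (p : ℝ)⁻¹) (hγ : HasSum (fun i : ℕ => γ ^ p ^ i / (p : K) ^ i) 0) :
    DworkData p n (fundDomain w) K where
  γ := γ
  γ_ne_zero := h0
  norm_γ_pow := hρ
  hasSum_γ := hγ
  r := fun s => coordIn w K s
  norm_r_le := fun s j => norm_coordIn_le w hw s j
  σ := frobPoint p (det_ne_zero_of_isCoprime w hw)
  m := frobDigit p
  m_lt := frobDigit_lt (Fact.out : p.Prime).pos
  mul_r := coordIn_frobPoint p (det_ne_zero_of_isCoprime w hw)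

variable (hw : IsCoprime (p : ℤ) (expMatrix w).det) {γ : K} (h0 : γ ≠ 0)
  (hρ : ‖γ‖ ^ (p - 1) = (p : ℝ)⁻¹) (hγ : HasSum (fun i : ℕ => γ ^ p ^ i / (p : K) ^ i) 0)

/-- H lives on the points p^l w_j, where E_i acts by p^l w_{ji}. As ξ is supported in the cone, only
l with p^l at most the j-th coordinate of u contribute. -/
theorem mul_euler_bigH (hdet : (expMatrix w).det ≠ 0) (i : Fin n) {ξ : Laurent n K}
    (hξ : ∀ u, u ∉ latticeCone w → ξ u = 0) (u : Fin n → ℤ) :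
    mul (euler i (bigH p w γ)) ξ u =
      ∑ j, (w j i : K) * ∑' l, (p : K) ^ l * gammaSum p γ l * ξ (u - p ^ l • w j) := by
  have hp : 1 < p := (Fact.out : p.Prime).one_lt
  have hterm : ∀ t, euler i (bigH p w γ) t * ξ (u - t) =
      ∑ j, (t i : K) * evalMono (hSeries p γ) (w j) t * ξ (u - t) := fun t => by
    rw [euler, bigH, Finset.sum_apply, Finset.mul_sum, Finset.sum_mul]
  have hval : ∀ j l, (((p ^ l • w j : Fin n → ℤ) i : ℤ) : K) *
      evalMono (hSeries p γ) (w j) (p ^ l • w j) * ξ (u - p ^ l • w j) =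
      (w j i : K) * ((p : K) ^ l * gammaSum p γ l * ξ (u - p ^ l • w j)) := fun j l => by
    rw [evalMono_nsmul (vector_ne_zero hdet j), coeff_hSeries_pow hp]
    simp only [Pi.smul_apply, nsmul_eq_mul]
    push_cast
    ring
  have hinj : ∀ j, Function.Injective fun l : ℕ => p ^ l • w j := fun j =>
    (nsmul_injective_of_ne_zero (vector_ne_zero hdet j)).comp (Nat.pow_right_injective hp)
  have hsupp : ∀ j, (Function.support fun t : Fin n → ℤ =>
      (t i : K) * evalMono (hSeries p γ) (w j) t * ξ (u - t)) ⊆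
      Set.range fun l : ℕ => p ^ l • w j := fun j t ht => by
    by_contra hcon
    refine ht ?_
    simp only
    rw [evalMono_eq_zero, mul_zero, zero_mul]
    rintro k rfl
    exact coeff_hSeries_eq_zero γ fun l hl => hcon ⟨l, by simp only; rw [hl]⟩
  have hfin : ∀ j, {l : ℕ | (((p ^ l • w j : Fin n → ℤ) i : ℤ) : K) *
      evalMono (hSeries p γ) (w j) (p ^ l • w j) * ξ (u - p ^ l • w j) ≠ 0}.Finite := fun j => by
    refine (Set.finite_Iic ⌊coord w u j⌋₊).subset fun l hl => ?_
    have hmem : u - ∑ i, (Pi.single j (p ^ l) : Fin n → ℕ) i • w i ∈ latticeCone w := by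
      rw [sum_single_nsmul]
      by_contra hcon
      exact hl (by rw [hξ _ hcon, mul_zero])
    have h1 := mem_of_sub_mem hdet _ hmem j
    rw [Pi.single_eq_same] at h1
    exact (Nat.lt_pow_self hp).le.trans (Nat.le_floor h1)
  rw [mul, finsum_congr hterm, finsum_sum_comm]
  · refine Finset.sum_congr rfl fun j _ => ?_
    rw [finsum_eq_tsum_comp (hinj j) (hsupp j) (hfin j), tsum_congr (hval j), tsum_mul_left]
  · intro j _
    refine ((hfin j).image fun l : ℕ => p ^ l • w j).subset fun t ht => ?_
    obtain ⟨l, rfl⟩ := hsupp j ht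
    exact ⟨l, ht, rfl⟩

/-- Writing u_i = ∑_j r_j w_{ji} gives E_i = ∑_j w_{ji} E'_j with E'_j multiplication by the j-th
coordinate; E_i H splits in the same way. -/
theorem Dhat_coneSeries (i : Fin n) (A : C₀(fundDomain w × (Fin n → ℕ), K)) :
    Dhat p w γ i (coneSeries w γ A) =
      coneSeries w γ ⇑(∑ j, (w j i : K) • (coneData hw h0 hρ hγ).diffOp j A :
        C₀(fundDomain w × (Fin n → ℕ), K)) := by
  have hdet := det_ne_zero_of_isCoprime w hw
  have hzero : ∀ u, u ∉ latticeCone w → coneSeries w γ A u = 0 := fun u hu =>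
    coneSeries_of_notMem hdet γ A hu
  refine ext_on_cone hdet (fun v => ?_) fun u hu => ?_
  · rw [coneSeries_conePoint hdet, Dhat, Pi.add_apply, mul_euler_bigH hdet i hzero, euler,
      coneSeries_conePoint hdet, ← sum_coordIn_mul (K := K) w hdet, Finset.sum_mul,
      ← Finset.sum_add_distrib, ← evalCLM_apply v (∑ j, _), map_sum, Finset.mul_sum]
    refine Finset.sum_congr rfl fun j _ => ?_
    have hterm : ∀ l, (p : K) ^ l * gammaSum p γ l *
        coneSeries w γ A (conePoint w v - p ^ l • w j) =
        γ ^ (∑ i, v.2 i) * (coneData hw h0 hρ hγ).diffTerm j A v l := fun l => by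
      rw [← sum_single_nsmul w j (p ^ l), DworkData.diffTerm]
      split_ifs with hl
      · have hle : Pi.single j (p ^ l) ≤ v.2 := by
          intro i
          obtain rfl | hi := eq_or_ne i j
          · simpa using hl
          · simp [hi]
        have hsum : ∑ i, v.2 i = ∑ i, (v.2 - Pi.single j (p ^ l) : Fin n → ℕ) i + p ^ l := by
          conv_lhs => rw [← tsub_add_cancel_of_le hle, DworkData.sum_add_single]
        rw [conePoint_sub v hle, coneSeries_conePoint hdet, hsum, dworkEps, pow_add]
        rw [show (coneData hw h0 hρ hγ).γ = γ from rfl]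
        field_simp
      · rw [coneSeries_of_notMem hdet, mul_zero, mul_zero]
        intro hmem
        exact hl (by simpa using le_of_conePoint_sub_mem hdet v hmem j)
    rw [tsum_congr hterm, tsum_mul_left, map_smul, evalCLM_apply, DworkData.diffOp_apply,
      coordIn_conePoint hdet, smul_eq_mul]
    change _ = _ * (_ * ((coordIn w K v.1 j + v.2 j) * _ + _))
    ring
  · rw [coneSeries_of_notMem hdet _ _ hu, Dhat, Pi.add_apply, mul_euler_bigH hdet i hzero, euler,
      hzero u hu, mul_zero, zero_add]
    refine Finset.sum_eq_zero fun j _ => ?_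
    have hterm : ∀ l : ℕ, (p : K) ^ l * gammaSum p γ l *
        coneSeries w γ A (u - p ^ l • w j) = 0 := fun l => by
      rw [hzero, mul_zero]
      rw [← sum_single_nsmul w j (p ^ l)]
      exact fun hmem => hu (mem_of_sub_sum_mem hdet _ hmem)
    simp only [hterm, tsum_zero, mul_zero]

theorem sum_nsmul_injective (hdet : (expMatrix w).det ≠ 0) :
    Function.Injective fun k : Fin n → ℕ => ∑ i, k i • w i := by
  intro k k' hk
  have h1 := coordIn_sum_nsmul (K := ℝ) w hdet k
  simp only at hk
  rw [hk, coordIn_sum_nsmul (K := ℝ) w hdet k'] at h1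
  funext i
  exact_mod_cast (congrFun h1 i).symm

theorem bigF_sum (hdet : (expMatrix w).det ≠ 0) (γ : K) (k : Fin n → ℕ) :
    bigF p w γ (∑ i, k i • w i) = ∏ i, PowerSeries.coeff (k i) (theta p γ) := by
  have : {j : Fin n → ℕ | ∑ i, j i • w i = ∑ i, k i • w i} = {k} := by
    ext j
    simp only [Set.mem_ofPred_eq, Set.mem_singleton_iff]
    exact (sum_nsmul_injective hdet).eq_iff
  rw [bigF, this, finsum_mem_singleton]

theorem support_bigF (γ : K) :
    Function.support (bigF p w γ) ⊆ Set.range fun k : Fin n → ℕ => ∑ i, k i • w i := by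
  intro t ht
  by_contra hcon
  refine ht ?_
  rw [bigF]
  exact finsum_mem_eq_zero_of_forall_eq_zero fun k hk => absurd ⟨k, hk⟩ hcon

theorem nsmul_conePoint (hdet : (expMatrix w).det ≠ 0) (v : fundDomain w × (Fin n → ℕ)) :
    p • conePoint w v =
      conePoint w (frobPoint p hdet v.1, fun i => frobDigit p v.1 i + p * v.2 i) := by
  rw [conePoint, conePoint, smul_add, ← frobPoint_add p hdet, Finset.smul_sum]
  simp only [add_nsmul, Finset.sum_add_distrib, mul_nsmul', add_assoc]

theorem alpha_coneSeries [Finite (fundDomain w)] (A : C₀(fundDomain w × (Fin n → ℕ), K)) :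
    alpha p w γ (coneSeries w γ A) = coneSeries w γ ((coneData hw h0 hρ hγ).alphaOp A) := by
  have hdet := det_ne_zero_of_isCoprime w hw
  have hsupp : ∀ u, (Function.support fun t => bigF p w γ t * coneSeries w γ A (p • u - t)) ⊆
      Set.range fun k : Fin n → ℕ => ∑ i, k i • w i := fun u =>
    (Function.support_mul_subset_left _ _).trans (support_bigF γ)
  refine ext_on_cone hdet (fun v => ?_) fun u hu => ?_
  · set a : Fin n → ℕ := fun i => frobDigit p v.1 i + p * v.2 i with ha
    have hval : ∀ k : Fin n → ℕ, ¬ k ≤ a → bigF p w γ (∑ i, k i • w i) *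
        coneSeries w γ A (p • conePoint w v - ∑ i, k i • w i) = 0 := fun k hk => by
      rw [nsmul_conePoint hdet, coneSeries_of_notMem hdet, mul_zero]
      exact fun hmem => hk (le_of_conePoint_sub_mem hdet _ hmem)
    rw [coneSeries_conePoint hdet, alpha, psi, mul, finsum_eq_tsum_comp (sum_nsmul_injective hdet)
      (hsupp _) ((Set.finite_Iic a).subset fun k hk => by
        by_contra hcon; exact hk (hval k hcon)),
      tsum_eq_sum (s := Finset.Iic a) fun k hk => hval k (by simpa using hk),
      DworkData.alphaOp_apply, DworkData.alphaFun, Finset.mul_sum]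
    -- The product is indexed by the exponent taken from F₀, the matrix of α by the complementary
    -- exponent taken from ξ.
    refine Finset.sum_nbij' (fun k => a - k) (fun k => a - k) ?_ ?_ ?_ ?_ ?_
    · exact fun k _ => Finset.mem_Iic.2 tsub_le_self
    · exact fun k _ => Finset.mem_Iic.2 tsub_le_self
    · exact fun k hk => tsub_tsub_cancel_of_le (Finset.mem_Iic.1 hk)
    · exact fun k hk => tsub_tsub_cancel_of_le (Finset.mem_Iic.1 hk)
    · intro k hk
      have hka : k ≤ a := Finset.mem_Iic.1 hk
      rw [nsmul_conePoint hdet, conePoint_sub _ hka, coneSeries_conePoint hdet, bigF_sum hdet,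
        DworkData.alphaCoeff]
      have hprod : ∏ i, PowerSeries.coeff (k i) (theta p γ) =
          ∏ i, thetaCoeff p γ (((frobDigit p v.1 i + p * v.2 i : ℕ) : ℤ) - ((a - k) i : ℕ)) := by
        refine Finset.prod_congr rfl fun i _ => ?_
        rw [← thetaCoeff_natCast]
        congr 1
        have := hka i
        rw [Pi.sub_apply, Nat.cast_sub this]
        simp only [ha]
        ring
      change _ = γ ^ (∑ i, v.2 i) * (γ ^ (∑ i, (a - k) i) / γ ^ (∑ i, v.2 i) * (∏ i, thetaCoeff p γ
        (((frobDigit p v.1 i + p * v.2 i : ℕ) : ℤ) - ((a - k) i : ℕ))) * A (frobPoint p hdet v.1, a - k))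
      rw [hprod]
      field_simp
      rfl
  · rw [coneSeries_of_notMem hdet _ _ hu, alpha, psi, mul]
    refine finsum_eq_zero_of_forall_eq_zero fun t => ?_
    by_contra hne
    obtain ⟨k, rfl⟩ := hsupp u hne
    refine hne ?_
    simp only
    rw [coneSeries_of_notMem hdet, mul_zero]
    intro hmem
    -- A nonzero product puts p u in the cone, and the cone is saturated.
    refine hu ((mem_latticeCone_iff hdet u).2 fun i => ?_)
    have h1 := nonneg_coord hdet (mem_of_sub_sum_mem hdet k hmem) i
    rw [coord_nsmul] at h1
    exact nonneg_of_mul_nonneg_right h1 (by exact_mod_cast (Fact.out : p.Prime).pos)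

end Operators

end ConeSeries

end DworkDiag

namespace DworkDiag

open Filter Topology ZeroAtInfty

/-! ### The space `B` in normalized coordinates -/

section SpaceB

variable {n : ℕ} {w : Fin n → Fin n → ℤ} {K : Type*} [NormedField K] {M : ℕ} {π : K}

theorem floor_weight_conePoint (hdet : (expMatrix w).det ≠ 0) (M : ℕ)
    (v : fundDomain w × (Fin n → ℕ)) :
    ⌊(M : ℝ) * weight w (conePoint w v)⌋₊ = ⌊(M : ℝ) * weight w v.1⌋₊ + M * ∑ i, v.2 i := by
  have h0 : 0 ≤ (M : ℝ) * weight w v.1 :=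
    mul_nonneg (Nat.cast_nonneg _) (Finset.sum_nonneg fun i _ => (v.1.2.2 i).1)
  rw [weight_conePoint hdet, mul_add, ← Nat.cast_mul, Nat.floor_add_natCast h0]

/-- The two normalizations of a coefficient, by γ^{|k|} and by π^{⌊M w(u)⌋}, differ by a factor
depending only on s, and s takes finitely many values. -/
theorem coneSeries_mem_spaceB (hdet : (expMatrix w).det ≠ 0) (h0 : π ≠ 0)
    (A : C₀(fundDomain w × (Fin n → ℕ), K)) : coneSeries w (π ^ M) A ∈ spaceB w M π := by
  have hfin : Finite (fundDomain w) := (finite_fundDomain hdet).to_subtype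
  have hfin' : Fintype (fundDomain w) := Fintype.ofFinite _
  let e : fundDomain w → ℕ := fun s => ⌊(M : ℝ) * weight w s⌋₊
  have hC : ∀ v : fundDomain w × (Fin n → ℕ), ‖(π ^ e v.1)⁻¹‖ ≤ ∑ s, ‖(π ^ e s)⁻¹‖ := fun v =>
    Finset.single_le_sum (f := fun s => ‖(π ^ e s)⁻¹‖) (fun _ _ => norm_nonneg _)
      (Finset.mem_univ v.1)
  have hlim : Tendsto (fun v : fundDomain w × (Fin n → ℕ) => (π ^ e v.1)⁻¹ * A v) cofinite (𝓝 0) := by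
    refine squeeze_zero_norm (a := fun v => (∑ s, ‖(π ^ e s)⁻¹‖) * ‖A v‖) (fun v => ?_) ?_
    · rw [norm_mul]
      exact mul_le_mul_of_nonneg_right (hC v) (norm_nonneg _)
    · simpa using (tendsto_apply A).norm.const_mul (∑ s, ‖(π ^ e s)⁻¹‖)
  have hinj := conePoint_injective hdet
  refine ⟨Function.extend (conePoint w) (fun v => (π ^ e v.1)⁻¹ * A v) 0, fun u hu => ?_, ?_,
    fun u => ?_⟩
  · rw [← range_conePoint hdet] at hu
    exact Function.extend_apply' _ _ _ hu
  · refine tendsto_cofinite_zero_iff.2 fun δ hδ => ?_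
    refine ((tendsto_cofinite_zero_iff.1 hlim δ hδ).image (conePoint w)).subset fun u hu => ?_
    by_cases hex : ∃ v, conePoint w v = u
    · obtain ⟨v, rfl⟩ := hex
      refine ⟨v, ?_, rfl⟩
      rwa [Set.mem_ofPred_eq, hinj.extend_apply] at hu
    · rw [Set.mem_ofPred_eq, Function.extend_apply' _ _ _ hex, Pi.zero_apply, norm_zero] at hu
      exact absurd hδ hu.not_gt
  · by_cases hex : ∃ v, conePoint w v = u
    · obtain ⟨v, rfl⟩ := hex
      rw [hinj.extend_apply, coneSeries_conePoint hdet, floor_weight_conePoint hdet, pow_add,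
        pow_mul]
      have : π ^ e v.1 ≠ 0 := pow_ne_zero _ h0
      change _ = (π ^ e v.1)⁻¹ * A v * (π ^ e v.1 * _)
      field_simp
    · rw [Function.extend_apply' _ _ _ hex, coneSeries, Function.extend_apply' _ _ _ hex]
      simp

theorem exists_coneSeries_eq (hdet : (expMatrix w).det ≠ 0) (hπ : ‖π‖ ≤ 1) {ξ : Laurent n K}
    (hξ : ξ ∈ spaceB w M π) :
    ∃ A : C₀(fundDomain w × (Fin n → ℕ), K), coneSeries w (π ^ M) A = ξ := by
  obtain ⟨A, hA0, hA, hAξ⟩ := hξ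
  let e : fundDomain w → ℕ := fun s => ⌊(M : ℝ) * weight w s⌋₊
  have hlim : Tendsto (fun v => π ^ e v.1 * A (conePoint w v)) cofinite (𝓝 0) := by
    refine squeeze_zero_norm (fun v => ?_)
      (by simpa using (hA.comp (conePoint_injective hdet).tendsto_cofinite).norm)
    rw [norm_mul, norm_pow]
    exact mul_le_of_le_one_left (norm_nonneg _) (pow_le_one₀ (norm_nonneg _) hπ)
  refine ⟨ofTendsto _ hlim, ext_on_cone hdet (fun v => ?_) fun u hu => ?_⟩
  · rw [coneSeries_conePoint hdet, hAξ, floor_weight_conePoint hdet, pow_add, pow_mul,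
      ofTendsto_apply]
    ring
  · rw [coneSeries_of_notMem hdet _ _ hu, hAξ, hA0 u hu, zero_mul]

/-- Passage from normalized coordinates to `B`. -/
noncomputable def toSpaceB (hdet : (expMatrix w).det ≠ 0) (M : ℕ) (h0 : π ≠ 0) (hπ : ‖π‖ ≤ 1) :
    C₀(fundDomain w × (Fin n → ℕ), K) ≃ₗ[K] spaceB w M π :=
  LinearEquiv.ofBijective
    { toFun := fun A : C₀(fundDomain w × (Fin n → ℕ), K) =>
        (⟨coneSeries w (π ^ M) A, coneSeries_mem_spaceB hdet h0 A⟩ : spaceB w M π)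
      map_add' := fun A B => Subtype.ext <| ext_on_cone hdet
        (fun v => by
          simp only [Submodule.coe_add, Pi.add_apply, coneSeries_conePoint hdet,
            ZeroAtInftyContinuousMap.add_apply, mul_add])
        fun u hu => by
          simp only [Submodule.coe_add, Pi.add_apply, coneSeries_of_notMem hdet _ _ hu, add_zero]
      map_smul' := fun c A => Subtype.ext <| ext_on_cone hdet
        (fun v => by
          simp only [Submodule.coe_smul, Pi.smul_apply, coneSeries_conePoint hdet,
            ZeroAtInftyContinuousMap.smul_apply, smul_eq_mul, RingHom.id_apply, mul_left_comm])
        fun u hu => by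
          simp only [Submodule.coe_smul, Pi.smul_apply, coneSeries_of_notMem hdet _ _ hu,
            smul_zero] }
    ⟨fun A B hAB => by
      ext v
      have h1 := congrFun (congrArg Subtype.val hAB) (conePoint w v)
      simp only [LinearMap.coe_mk, AddHom.coe_mk, coneSeries_conePoint hdet] at h1
      exact mul_left_cancel₀ (pow_ne_zero _ (pow_ne_zero _ h0)) h1,
    fun ξ => by
      obtain ⟨A, hA⟩ := exists_coneSeries_eq hdet hπ ξ.2
      exact ⟨A, Subtype.ext hA⟩⟩

theorem coneSeries_single (hdet : (expMatrix w).det ≠ 0) (γ : K) (s : fundDomain w) :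
    coneSeries w γ (single K (s, (0 : Fin n → ℕ))) = mono K (s : Fin n → ℤ) := by
  classical
  have hs : conePoint w (s, 0) = s := by simp [conePoint]
  refine ext_on_cone hdet (fun v => ?_) fun u hu => ?_
  · rw [coneSeries_conePoint hdet, single_apply, mono, Pi.single_apply]
    have : conePoint w v = (s : Fin n → ℤ) ↔ v = (s, 0) := by
      rw [← hs]
      exact (conePoint_injective hdet).eq_iff
    simp only [this]
    split_ifs with hv
    · simp [hv]
    · simp
  · rw [coneSeries_of_notMem hdet _ _ hu, mono, Pi.single_eq_of_ne]
    rintro rfl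
    exact hu s.2.1

theorem mem_imageD {p : ℕ} {i : Fin n} {ξ η : spaceB w M π}
    (h : (η : Laurent n K) = Dhat p w (π ^ M) i (ξ : Laurent n K)) : η ∈ imageD p w M π :=
  Submodule.subset_span ⟨i, ξ, h⟩

end SpaceB

/-! ### The basis of the quotient and the matrix of `α` -/

section Quotient

variable {n : ℕ} {w : Fin n → Fin n → ℤ} {p : ℕ} [Fact p.Prime] {K : Type*} [NormedField K]
  [NormedAlgebra ℚ_[p] K] [IsUltrametricDist K] [CompleteSpace K] [CharZero K]

theorem exists_basis_quotB (hw : IsCoprime (p : ℤ) (expMatrix w).det) {M : ℕ} (hM : 0 < M) {π : K}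
    (h0 : π ^ M ≠ 0) (hρ : ‖π ^ M‖ ^ (p - 1) = (p : ℝ)⁻¹)
    (hγ : HasSum (fun i : ℕ => (π ^ M) ^ p ^ i / (p : K) ^ i) 0) :
    (∀ i, ∀ ξ ∈ spaceB w M π, Dhat p w (π ^ M) i ξ ∈ spaceB w M π) ∧
    (∀ ξ ∈ spaceB w M π, alpha p w (π ^ M) ξ ∈ spaceB w M π) ∧
    ∃ (b : Module.Basis (fundDomain w) K (QuotB p w M π)) (αbar : Module.End K (QuotB p w M π)),
      (∀ u : fundDomain w, ∃ h : mono K (u : Fin n → ℤ) ∈ spaceB w M π,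
        b u = toQuotB p w M π ⟨_, h⟩) ∧
      (∀ ξ η : spaceB w M π, (η : Laurent n K) = alpha p w (π ^ M) ξ →
        αbar (toQuotB p w M π ξ) = toQuotB p w M π η) ∧
      ∀ u u' : fundDomain w,
        (frobPoint p (det_ne_zero_of_isCoprime w hw) u' ≠ u → b.repr (αbar (b u)) u' = 0) ∧
        (frobPoint p (det_ne_zero_of_isCoprime w hw) u' = u →
          ‖b.repr (αbar (b u)) u'‖ = ‖π ^ M‖ ^ (∑ i, frobDigit p u' i)) := by
  classical
  have hdet := det_ne_zero_of_isCoprime w hw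
  have hfin : Finite (fundDomain w) := (finite_fundDomain hdet).to_subtype
  have hfin' : Fintype (fundDomain w) := Fintype.ofFinite _
  let d := coneData hw h0 hρ hγ
  have hπ0 : π ≠ 0 := fun h => h0 (by rw [h, zero_pow hM.ne'])
  have hπ1 : ‖π‖ ≤ 1 := by
    have h1 : ‖π ^ M‖ ≤ 1 := d.norm_γ_le_one
    rw [norm_pow] at h1
    exact (pow_le_one_iff_of_nonneg (norm_nonneg _) hM.ne').1 h1
  let Θ := toSpaceB hdet M hπ0 hπ1
  let D : Fin n → C₀(fundDomain w × (Fin n → ℕ), K) → C₀(fundDomain w × (Fin n → ℕ), K) :=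
    fun i A => ∑ j, (w j i : K) • d.diffOp j A
  have hD : ∀ i A, Dhat p w (π ^ M) i (Θ A : Laurent n K) = Θ (D i A) := fun i A =>
    Dhat_coneSeries hw h0 hρ hγ i A
  have hα : ∀ A, alpha p w (π ^ M) (Θ A : Laurent n K) = Θ (d.alphaOp A) := fun A =>
    alpha_coneSeries hw h0 hρ hγ A
  -- The matrix (w_{ji}) is invertible over K, so the D̂_i and the D_j have the same span of images.
  have hDinv : ∀ j A, d.diffOp j A =
      ∑ i, ((expMatrix w).map (Int.cast : ℤ → K))⁻¹ i j • D i A := fun j A => by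
    have hmat : ∀ k, ∑ i, (w k i : K) * ((expMatrix w).map (Int.cast : ℤ → K))⁻¹ i j =
        if k = j then 1 else 0 := fun k => by
      have h1 := congrFun (congrFun (Matrix.mul_nonsing_inv _ (isUnit_det_map (K := K) w hdet)) k) j
      rw [Matrix.mul_apply, Matrix.one_apply] at h1
      simpa [expMatrix] using h1
    simp only [D, Finset.smul_sum, smul_smul]
    rw [Finset.sum_comm]
    simp only [← Finset.sum_smul, mul_comm _ ((w _ _ : ℤ) : K), hmat, ite_smul, one_smul, zero_smul,
      Finset.sum_ite_eq', Finset.mem_univ, if_true]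
  let Λ : spaceB w M π →ₗ[K] fundDomain w → K :=
    LinearMap.pi fun s => (d.functional s : C₀(fundDomain w × (Fin n → ℕ), K) →ₗ[K] K) ∘ₗ Θ.symm.toLinearMap
  have hΛ : ∀ A s, Λ (Θ A) s = d.functional s A := fun A s =>
    congrArg (d.functional s) (Θ.symm_apply_apply A)
  have hfD : ∀ s i A, d.functional s (D i A) = 0 := fun s i A => by
    simp only [D, map_sum, map_smul, d.functional_diffOp, smul_zero, Finset.sum_const_zero]
  -- One inclusion is that the functionals kill the images; the other is the spanning theorem. The
  -- quotient thus becomes the space of functions on S(Δ).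
  have hker : imageD p w M π = LinearMap.ker Λ := by
    refine le_antisymm (Submodule.span_le.2 ?_) fun ξ hξ => ?_
    · rintro η ⟨i, ξ, hη⟩
      obtain ⟨A, rfl⟩ := Θ.surjective ξ
      have h1 : η = Θ (D i A) := Subtype.ext (hη.trans (hD i A))
      rw [SetLike.mem_coe, LinearMap.mem_ker, h1]
      funext s
      rw [hΛ, hfD, Pi.zero_apply]
    · obtain ⟨A, rfl⟩ := Θ.surjective ξ
      obtain ⟨η, rfl⟩ := d.eq_of_functional_eq_zero (A := A) fun s => by
        rw [← hΛ, LinearMap.mem_ker.1 hξ, Pi.zero_apply]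
      rw [map_sum]
      refine Submodule.sum_mem _ fun j _ => ?_
      rw [hDinv, map_sum]
      refine Submodule.sum_mem _ fun i _ => ?_
      rw [map_smul]
      exact Submodule.smul_mem _ _ (mem_imageD (ξ := Θ (η j)) (hD i (η j)).symm)
  have hmono : ∀ s : fundDomain w, (Θ (single K (s, 0)) : Laurent n K) = mono K (s : Fin n → ℤ) :=
    fun s => coneSeries_single hdet _ s
  have hΛs : ∀ s : fundDomain w, Λ (Θ (single K (s, 0))) = Pi.single s 1 := fun s => by
    funext s'
    rw [hΛ, d.functional_single_zero, Pi.single_apply]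
    split_ifs <;> rfl
  have hsurj : Function.Surjective Λ := fun a => by
    refine ⟨∑ s, a s • Θ (single K (s, 0)), ?_⟩
    rw [map_sum]
    simp only [map_smul, hΛs]
    exact (pi_eq_sum_univ' a).symm
  let αB : spaceB w M π →ₗ[K] spaceB w M π :=
    Θ.toLinearMap ∘ₗ (d.alphaOp : C₀(fundDomain w × (Fin n → ℕ), K) →ₗ[K] _) ∘ₗ
      Θ.symm.toLinearMap
  have hαB : ∀ A, αB (Θ A) = Θ (d.alphaOp A) := fun A =>
    congrArg (fun B => Θ (d.alphaOp B)) (Θ.symm_apply_apply A)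
  -- By αD_j = p D_j α, the functionals still vanish after α is applied to an image.
  have hstable : imageD p w M π ≤ (imageD p w M π).comap αB := by
    refine Submodule.span_le.2 ?_
    rintro η ⟨i, ξ, hη⟩
    obtain ⟨A, rfl⟩ := Θ.surjective ξ
    have h1 : η = Θ (D i A) := Subtype.ext (hη.trans (hD i A))
    rw [SetLike.mem_coe, Submodule.mem_comap, hker, LinearMap.mem_ker, h1, hαB]
    funext s
    rw [hΛ]
    simp only [D, map_sum, map_smul, d.alphaOp_diffOp, d.functional_diffOp, smul_zero,
      Finset.sum_const_zero, Pi.zero_apply]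
  let e : QuotB p w M π ≃ₗ[K] (fundDomain w → K) :=
    (Submodule.quotEquivOfEq _ _ hker).trans (Λ.quotKerEquivOfSurjective hsurj)
  have he : ∀ ξ, e (toQuotB p w M π ξ) = Λ ξ := fun ξ => rfl
  let b : Module.Basis (fundDomain w) K (QuotB p w M π) := Module.Basis.ofEquivFun e
  let αbar : Module.End K (QuotB p w M π) := Submodule.mapQ _ _ αB hstable
  have hαbar : ∀ ξ, αbar (toQuotB p w M π ξ) = toQuotB p w M π (αB ξ) := fun ξ => rfl
  have hb : ∀ s : fundDomain w, b s = toQuotB p w M π (Θ (single K (s, 0))) := fun s => by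
    refine e.injective ?_
    rw [he, hΛs]
    simp [b]
  have hrepr : ∀ u u' : fundDomain w, b.repr (αbar (b u)) u' =
      d.functional u' (d.alphaOp (single K (u, 0))) := fun u u' => by
    rw [hb, hαbar, hαB, Module.Basis.ofEquivFun_repr_apply, he, hΛ]
  refine ⟨fun i ξ hξ => ?_, fun ξ hξ => ?_, b, αbar, fun u => ?_, fun ξ η hη => ?_, fun u u' =>
    ⟨fun hu => ?_, fun hu => ?_⟩⟩
  · obtain ⟨A, hA⟩ := Θ.surjective ⟨ξ, hξ⟩
    have h1 : (Θ A : Laurent n K) = ξ := congrArg Subtype.val hA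
    rw [← h1, hD]
    exact (Θ (D i A)).2
  · obtain ⟨A, hA⟩ := Θ.surjective ⟨ξ, hξ⟩
    have h1 : (Θ A : Laurent n K) = ξ := congrArg Subtype.val hA
    rw [← h1, hα]
    exact (Θ _).2
  · refine ⟨hmono u ▸ (Θ (single K (u, 0))).2, ?_⟩
    rw [hb]
    congr 1
    exact Subtype.ext (hmono u)
  · obtain ⟨A, rfl⟩ := Θ.surjective ξ
    rw [hαbar, hαB]
    congr 1
    exact Subtype.ext ((hα A).symm.trans hη.symm)
  · rw [hrepr]
    exact d.functional_alphaOp_of_ne hu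
  · rw [hrepr]
    exact d.norm_functional_alphaOp hu

end Quotient

/-! ### The coefficient field `ℚ_p(π)` -/

section CoefficientField

variable {p : ℕ} [Fact p.Prime] {π : ℂ_[p]}

theorem BaseField.norm_incl (x : BaseField p π) : ‖BaseField.incl p π x‖ = ‖x‖ := rfl

theorem BaseField.incl_gen : BaseField.incl p π (gen p π) = π := rfl

theorem BaseField.hasSum_iff {f : ℕ → BaseField p π} {a : BaseField p π} :
    HasSum (fun i => BaseField.incl p π (f i)) (BaseField.incl p π a) ↔ HasSum f a :=
  (AddMonoidHomClass.isometry_of_norm (BaseField.incl p π)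
    BaseField.norm_incl).isEmbedding.isInducing.hasSum_iff f a

theorem ord_eq_of_norm_eq {x γ : ℂ_[p]} (hγ : ‖γ‖ ^ (p - 1) = (p : ℝ)⁻¹) {m : ℕ}
    (hx : ‖x‖ = ‖γ‖ ^ m) : ord p x = (((m : ℝ) / ((p : ℝ) - 1) : ℝ) : WithTop ℝ) := by
  have hp : 1 < p := (Fact.out : p.Prime).one_lt
  have hp1 : (1 : ℝ) < p := by exact_mod_cast hp
  have hγ0 : ‖γ‖ ≠ 0 := fun h => by
    rw [h, zero_pow (by omega)] at hγ
    exact (inv_ne_zero (by positivity)) hγ.symm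
  have hx0 : x ≠ 0 := by
    rw [← norm_ne_zero_iff, hx]
    exact pow_ne_zero m hγ0
  have hlog : ((p : ℝ) - 1) * Real.logb p ‖γ‖ = -1 := by
    have h1 := congrArg (Real.logb p) hγ
    rw [Real.logb_pow, Real.logb_inv, Real.logb_self_eq_one hp1, Nat.cast_sub hp.le,
      Nat.cast_one] at h1
    exact h1
  rw [ord, if_neg hx0, hx, Real.logb_pow, WithTop.coe_eq_coe, eq_div_iff (by linarith)]
  linear_combination (-(m : ℝ)) * hlog

end CoefficientField

end DworkDiag

/-! ### The theorem over K = ℚ_p(π) -/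

theorem mainTheorem2 (p : ℕ) [Fact p.Prime] (n : ℕ) (w : Fin n → Fin n → ℤ)
    (hdet : IsCoprime (p : ℤ) (DworkDiag.expMatrix w).det)
    (γ : ℂ_[p]) (hγ : HasSum (fun i : ℕ => γ ^ p ^ i / (p : ℂ_[p]) ^ i) 0)
    (hγord : DworkDiag.ord p γ = ((1 / ((p : ℝ) - 1) : ℝ) : WithTop ℝ))
    (M : ℕ) (hM : 0 < M)
    (hMw : ∀ u ∈ DworkDiag.latticeCone w, ∃ m : ℤ, DworkDiag.weight w u = (m : ℝ) / (M : ℝ))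
    (π : ℂ_[p]) (hπ : π ^ M = γ) :
    (∀ i, ∀ ξ ∈ DworkDiag.spaceB w M (DworkDiag.gen p π),
      DworkDiag.Dhat p w (DworkDiag.gen p π ^ M) i ξ ∈ DworkDiag.spaceB w M (DworkDiag.gen p π)) ∧
    (∀ ξ ∈ DworkDiag.spaceB w M (DworkDiag.gen p π),
      DworkDiag.alpha p w (DworkDiag.gen p π ^ M) ξ ∈ DworkDiag.spaceB w M (DworkDiag.gen p π)) ∧
    ∃ (b : Module.Basis (DworkDiag.fundDomain w) (DworkDiag.BaseField p π) (DworkDiag.QuotB p w M (DworkDiag.gen p π)))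
      (αbar : Module.End (DworkDiag.BaseField p π) (DworkDiag.QuotB p w M (DworkDiag.gen p π))),
      (∀ u : DworkDiag.fundDomain w,
        ∃ h : DworkDiag.mono (DworkDiag.BaseField p π) (u : Fin n → ℤ) ∈ DworkDiag.spaceB w M (DworkDiag.gen p π),
          b u = DworkDiag.toQuotB p w M (DworkDiag.gen p π) ⟨_, h⟩) ∧
      (∀ ξ η : DworkDiag.spaceB w M (DworkDiag.gen p π),
        (η : DworkDiag.Laurent n (DworkDiag.BaseField p π)) = DworkDiag.alpha p w (DworkDiag.gen p π ^ M) ξ →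
          αbar (DworkDiag.toQuotB p w M (DworkDiag.gen p π) ξ) = DworkDiag.toQuotB p w M (DworkDiag.gen p π) η) ∧
      ∀ u u' : DworkDiag.fundDomain w,
        (DworkDiag.pAct p w u' ≠ DworkDiag.toReal (u : Fin n → ℤ) →
          DworkDiag.ord p (DworkDiag.BaseField.incl p π (b.repr (αbar (b u)) u')) = ⊤) ∧
        (DworkDiag.pAct p w u' = DworkDiag.toReal (u : Fin n → ℤ) →
          DworkDiag.ord p (DworkDiag.BaseField.incl p π (b.repr (αbar (b u)) u')) =
            ((((p : ℝ) * DworkDiag.weight w u' - DworkDiag.weight w u) / ((p : ℝ) - 1) : ℝ) : WithTop ℝ)) := by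

  have hp : 1 < p := (Fact.out : p.Prime).one_lt
  obtain ⟨hγ0, hγρ⟩ := DworkDiag.norm_pow_eq_of_ord hγord
  have hγint := DworkDiag.isIntegral_of_hasSum hγ0 hγρ hγ
  have hπint : IsIntegral ℚ_[p] π := IsIntegral.of_pow hM (hπ ▸ hγint)
  have hcomplete := DworkDiag.BaseField.completeSpace hπint
  have hultra : IsUltrametricDist (DworkDiag.BaseField p π) :=
    IsUltrametricDist.of_normedAlgebra ℚ_[p]
  have hgen : DworkDiag.BaseField.incl p π (DworkDiag.gen p π ^ M) = γ := by
    rw [map_pow, DworkDiag.BaseField.incl_gen, hπ]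
  have hnorm : ‖DworkDiag.gen p π ^ M‖ = ‖γ‖ := by
    rw [← DworkDiag.BaseField.norm_incl, hgen]
  have hne : DworkDiag.gen p π ^ M ≠ 0 := by
    rw [← norm_ne_zero_iff, hnorm]
    exact norm_ne_zero_iff.2 hγ0
  have hsum : HasSum (fun i : ℕ => (DworkDiag.gen p π ^ M) ^ p ^ i /
      (p : DworkDiag.BaseField p π) ^ i) 0 := by
    -- The inclusion into ℂ_p is isometric, so the vanishing of the series descends to K.
    rw [← DworkDiag.BaseField.hasSum_iff]
    simpa only [map_div₀, map_pow _ (DworkDiag.gen p π ^ M), hgen, map_pow, map_natCast,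
      map_zero] using hγ
  have hdet' := DworkDiag.det_ne_zero_of_isCoprime w hdet
  obtain ⟨h1, h2, b, αbar, hb, hα, hmat⟩ :=
    DworkDiag.exists_basis_quotB hdet hM hne (by rw [hnorm, hγρ]) hsum
  refine ⟨h1, h2, b, αbar, hb, hα, fun u u' => ⟨fun hu => ?_, fun hu => ?_⟩⟩
  · rw [Ne, DworkDiag.pAct_eq_toReal_iff p hdet'] at hu
    rw [(hmat u u').1 hu, map_zero, DworkDiag.ord, if_pos rfl]
  · rw [DworkDiag.pAct_eq_toReal_iff p hdet'] at hu
    have h3 := (hmat u u').2 hu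
    rw [hnorm, ← DworkDiag.BaseField.norm_incl] at h3
    rw [DworkDiag.ord_eq_of_norm_eq hγρ h3, DworkDiag.sum_frobDigit p hdet', hu]
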